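/- Let $d,m\in\mathbb N$, $T>0$, $\lambda>0$, and write $B_R(0)$ for the open Euclidean ball of radius $R$ about $0$. **Velocity field.** Let $\mathcal F:[0,T]\times\mathbb R^d\times\mathbb R^m\to\mathbb R^d$ be such that $t\mapsto\mathcal F(t,x,\theta)$ is (Lebesgue) measurable for all $x,\theta$; for a.e. $t$ the map $\mathcal F(t,\cdot,\cdot)$ is differentiable in $x$ and in $\theta$; there is $L>0$ with $$|\mathcal F(t,x,\theta)|\le L(1+|x|)(1+|\theta|)\qquad\text{for a.e. } t\in[0,T] \text{ and all } x\in\mathbb R^d,\ \theta\in\mathbb R^m;$$ and for every $R>0$ there is a constant $L_R>0$ such that for a.e. $t\in[0,T]$, all $x,x_1,x_2\in B_R(0)$ and all $\theta,\theta_1,\theta_2\in\mathbb R^m$: - $|\mathcal F(t,x_1,\theta)-\mathcal F(t,x_2,\theta)|\le L_R(1+|\theta|)|x_1-x_2|$, - $|\mathcal F(t,x,\theta_1)-\mathcal F(t,x,\theta_2)|\le L_R(1+|\theta_1|+|\theta_2|)|\theta_1-\theta_2|$, - $|\nabla_x\mathcal F(t,x_1,\theta)-\nabla_x\mathcal F(t,x_2,\theta)|\le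 L_R(1+|\theta|^2)|x_1-x_2|$, - $|\nabla_\theta\mathcal F(t,x,\theta_1)-\nabla_\theta\mathcal F(t,x,\theta_2)|\le L_R|\theta_1-\theta_2|$, - $|\nabla_x\mathcal F(t,x,\theta_1)-\nabla_x\mathcal F(t,x,\theta_2)|\le L_R(1+|\theta_1|+|\theta_2|)|\theta_1-\theta_2|$, - $|\nabla_\theta\mathcal F(t,x_1,\theta)-\nabla_\theta\mathcal F(t,x_2,\theta)|\le L_R(1+|\theta|)|x_1-x_2|$. **Loss.** Let $\ell:\mathbb R^d\times\mathbb R^d\to[0,\infty)$ be of class $C^1$ and such that for every $R>0$ there is $L_R>0$ with $|\nabla_x\ell(x_1,y_1)-\nabla_x\ell(x_2,y_2)|\le L_R(|x_1-x_2|+|y_1-y_2|)$ for all $x_1,x_2,y_1,y_2\in B_R(0)$. **Costs.** For a control $\theta\in L^2([0,T],\mathbb R^m)$ and a compactly supported probability measure $\mu_0$ on $\mathbb R^{2d}=\mathbb R^d\times\mathbb R^d$, let $t\mapsto\mu_t^\theta$ be the weak (distributional) solution on $[0,T]$, among the $W_1$-continuous curves of compactly supported probability measures, of $$\partial_t\mu_t(x,y)+\nabla_x\cdot\big(\mathcal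 F(t,x,\theta(t))\,\mu_t(x,y)\big)=0,\qquad \mu_t|_{t=0}=\mu_0,$$ and set $$J(\theta)=\int_{\mathbb R^{2d}}\ell(x,y)\,d\mu_T^\theta(x,y)+\lambda\int_0^T|\theta(t)|^2\,dt .$$ For every $N\ge1$ let $(X_0^i,Y_0^i)_{i=1}^N$ (depending on $N$) be points of $\mathbb R^{2d}$, let $\mu_0^N=\frac1N\sum_{i=1}^N\delta_{(X_0^i,Y_0^i)}$, and $$J^N(\theta)=\frac1N\sum_{i=1}^N\ell\big(X^i(T),Y_0^i\big)+\lambda\int_0^T|\theta(t)|^2\,dt,$$ where $X^i$ is the absolutely continuous solution of $\dot X^i(t)=\mathcal F(t,X^i(t),\theta(t))$ for a.e. $t\in[0,T]$, $X^i(0)=X_0^i$. Below, $\mu_T^{\theta^*}$ is the solution at time $T$ with control $\theta^*$ and initial datum $\mu_0$, and $\mu_T^{\theta^{*,N}}$ the one with control $\theta^{*,N}$ and initial datum $\mu_0^N$. **Theorem.** Assume that, for some $R>0$, the supports of $\mu_0$ and of all $\mu_0^N$ ($N\ge1$) lie in the ball of radius $R$ about the origin of $\mathbb R^{2d}$, and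 that $W_1(\mu_0^N,\mu_0)\to0$ as $N\to\infty$. Let $\theta^*$ be a local minimizer of $J$ in $L^2([0,T],\mathbb R^m)$ and let $\rho>0$. Then there is a constant $C>0$ with the following property. Let $\eta>0$ and $\bar N\ge1$, let $\theta^{*,N}$ be a local minimizer of $J^N$ for every $N\ge1$, and suppose that for every $N\ge\bar N$ we have $\theta^{*,N}\in B_\rho(\theta^*)$ (the open $L^2$-ball) and $J^N$ is $\eta$-strongly convex on $B_\rho(\theta^*)$, i.e. $J^N((1-s)\theta_1+s\theta_2)\le(1-s)J^N(\theta_1)+sJ^N(\theta_2)-\frac\eta2 s(1-s)\|\theta_1-\theta_2\|_{L^2}^2$ for all $\theta_1,\theta_2\in B_\rho(\theta^*)$ and $s\in[0,1]$. Then, for every $N\ge\bar N$, $$\left|\int_{\mathbb R^{2d}}\ell\,d\mu_T^{\theta^{*,N}}-\int_{\mathbb R^{2d}}\ell\,d\mu_T^{\theta^*}\right|\le C\left(W_1(\mu_0^N,\mu_0)+\frac1{\sqrt\eta}\sqrt{W_1(\mu_0^N,\mu_0)}\right).$$ -/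

import Mathlib

open MeasureTheory Filter Topology Set

noncomputable section

namespace NeurODE

/-- Euclidean space `ℝⁿ`. -/
abbrev Vec (n : ℕ) := EuclideanSpace ℝ (Fin n)

/-- The space `ℝ^{2d} = ℝᵈ × ℝᵈ` of pairs (datum, label), with its Euclidean norm. -/
abbrev DataSpace (d : ℕ) := WithLp 2 (Vec d × Vec d)

/-- The space of admissible controls `L²([0,T], ℝᵐ)`. -/
abbrev Control (T : ℝ) (m : ℕ) := Lp (Vec m) 2 (volume.restrict (Icc (0 : ℝ) T))

/-- The Wasserstein distance of order one, as the infimum of the transport cost over all transport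
plans with marginals `μ` and `ν`. -/
def wasserstein {X : Type*} [EDist X] [MeasurableSpace X] (μ ν : Measure X) : ENNReal :=
  ⨅ π : {π : Measure (X × X) // π.map Prod.fst = μ ∧ π.map Prod.snd = ν},
    ∫⁻ z, edist z.1 z.2 ∂(π : Measure (X × X))

/-- The standing assumptions on the velocity field `F : [0,T] × ℝᵈ × ℝᵐ → ℝᵈ`. The gradients are
Fréchet derivatives and are measured in the operator norm. -/
structure VelocityAssumptions {d m : ℕ} (T : ℝ) (F : ℝ → Vec d → Vec m → Vec d) : Prop where
  measurable_time : ∀ (x : Vec d) (θ : Vec m),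
    AEMeasurable (fun t => F t x θ) (volume.restrict (Icc (0 : ℝ) T))
  lipschitz_state : ∀ R : ℝ, 0 < R → ∃ L : ℝ, 0 < L ∧
    ∀ᵐ t ∂(volume.restrict (Icc (0 : ℝ) T)), ∀ θ : Vec m,
      ∀ x₁ ∈ Metric.ball (0 : Vec d) R, ∀ x₂ ∈ Metric.ball (0 : Vec d) R,
        ‖F t x₁ θ - F t x₂ θ‖ ≤ L * (1 + ‖θ‖) * ‖x₁ - x₂‖
  linear_growth : ∃ L : ℝ, 0 < L ∧
    ∀ᵐ t ∂(volume.restrict (Icc (0 : ℝ) T)), ∀ (x : Vec d) (θ : Vec m),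
      ‖F t x θ‖ ≤ L * (1 + ‖x‖) * (1 + ‖θ‖)
  lipschitz_control : ∀ R : ℝ, 0 < R → ∃ L : ℝ, 0 < L ∧
    ∀ᵐ t ∂(volume.restrict (Icc (0 : ℝ) T)), ∀ θ₁ θ₂ : Vec m,
      ∀ x ∈ Metric.ball (0 : Vec d) R,
        ‖F t x θ₁ - F t x θ₂‖ ≤ L * (1 + ‖θ₁‖ + ‖θ₂‖) * ‖θ₁ - θ₂‖
  differentiable_state : ∀ᵐ t ∂(volume.restrict (Icc (0 : ℝ) T)), ∀ θ : Vec m,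
    Differentiable ℝ (fun x => F t x θ)
  differentiable_control : ∀ᵐ t ∂(volume.restrict (Icc (0 : ℝ) T)), ∀ x : Vec d,
    Differentiable ℝ (fun θ => F t x θ)
  grad_state_lipschitz_state : ∀ R : ℝ, 0 < R → ∃ L : ℝ, 0 < L ∧
    ∀ᵐ t ∂(volume.restrict (Icc (0 : ℝ) T)), ∀ θ : Vec m,
      ∀ x₁ ∈ Metric.ball (0 : Vec d) R, ∀ x₂ ∈ Metric.ball (0 : Vec d) R,
        ‖fderiv ℝ (fun x => F t x θ) x₁ - fderiv ℝ (fun x => F t x θ) x₂‖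
          ≤ L * (1 + ‖θ‖ ^ 2) * ‖x₁ - x₂‖
  grad_control_lipschitz_control : ∀ R : ℝ, 0 < R → ∃ L : ℝ, 0 < L ∧
    ∀ᵐ t ∂(volume.restrict (Icc (0 : ℝ) T)), ∀ θ₁ θ₂ : Vec m,
      ∀ x ∈ Metric.ball (0 : Vec d) R,
        ‖fderiv ℝ (fun θ => F t x θ) θ₁ - fderiv ℝ (fun θ => F t x θ) θ₂‖ ≤ L * ‖θ₁ - θ₂‖
  grad_state_lipschitz_control : ∀ R : ℝ, 0 < R → ∃ L : ℝ, 0 < L ∧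
    ∀ᵐ t ∂(volume.restrict (Icc (0 : ℝ) T)), ∀ θ₁ θ₂ : Vec m,
      ∀ x ∈ Metric.ball (0 : Vec d) R,
        ‖fderiv ℝ (fun z => F t z θ₁) x - fderiv ℝ (fun z => F t z θ₂) x‖
          ≤ L * (1 + ‖θ₁‖ + ‖θ₂‖) * ‖θ₁ - θ₂‖
  grad_control_lipschitz_state : ∀ R : ℝ, 0 < R → ∃ L : ℝ, 0 < L ∧
    ∀ᵐ t ∂(volume.restrict (Icc (0 : ℝ) T)), ∀ θ : Vec m,
      ∀ x₁ ∈ Metric.ball (0 : Vec d) R, ∀ x₂ ∈ Metric.ball (0 : Vec d) R,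
        ‖fderiv ℝ (fun ϑ => F t x₁ ϑ) θ - fderiv ℝ (fun ϑ => F t x₂ ϑ) θ‖
          ≤ L * (1 + ‖θ‖) * ‖x₁ - x₂‖

/-- The standing assumptions on the loss `ℓ : ℝᵈ × ℝᵈ → [0, ∞)`. -/
structure LossAssumptions {d : ℕ} (ℓ : Vec d → Vec d → ℝ) : Prop where
  nonneg : ∀ x y : Vec d, 0 ≤ ℓ x y
  contDiff : ContDiff ℝ 1 (fun p : Vec d × Vec d => ℓ p.1 p.2)
  grad_lipschitz : ∀ R : ℝ, 0 < R → ∃ L : ℝ, 0 < L ∧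
    ∀ x₁ ∈ Metric.ball (0 : Vec d) R, ∀ x₂ ∈ Metric.ball (0 : Vec d) R,
    ∀ y₁ ∈ Metric.ball (0 : Vec d) R, ∀ y₂ ∈ Metric.ball (0 : Vec d) R,
      ‖gradient (fun x => ℓ x y₁) x₁ - gradient (fun x => ℓ x y₂) x₂‖
        ≤ L * (‖x₁ - x₂‖ + ‖y₁ - y₂‖)

/-- `x` is an absolutely continuous curve on `[0,T]` with `x(0) = x₀` and
`x'(t) = F(t, x(t), θ(t))` for a.e. `t ∈ [0,T]`. -/
structure IsTrajectory {d m : ℕ} (T : ℝ) (F : ℝ → Vec d → Vec m → Vec d) (θ : Control T m)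
    (x₀ : Vec d) (x : ℝ → Vec d) : Prop where
  absolutelyContinuous : AbsolutelyContinuousOnInterval x 0 T
  initial : x 0 = x₀
  ode : ∀ᵐ t ∂(volume.restrict (Icc (0 : ℝ) T)), HasDerivAt x (F t (x t) (θ t)) t

/-- The flow `Φ^θ_{(0,t)}(x₀)`: the value at time `t` of the trajectory starting at `x₀`. -/
def flow {d m : ℕ} (T : ℝ) (F : ℝ → Vec d → Vec m → Vec d) (θ : Control T m)
    (t : ℝ) (x₀ : Vec d) : Vec d :=
  Classical.epsilon (IsTrajectory T F θ x₀) t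

/-- `μ ∈ C([0,T], 𝒫_c(ℝ^{2d}))` is a weak solution of the continuity equation
`∂ₜ μₜ + ∇ₓ · (F(t, x, θ(t)) μₜ) = 0` on `[0,T]` with initial datum `μ₀`, tested against
`C¹` functions with compact support in `(0,T) × ℝ^{2d}`. Continuity in time is with respect to
the Wasserstein distance. -/
structure IsWeakSolution {d m : ℕ} (T : ℝ) (F : ℝ → Vec d → Vec m → Vec d) (θ : Control T m)
    (μ₀ : Measure (DataSpace d)) (μ : ℝ → Measure (DataSpace d)) : Prop where
  isProbabilityMeasure : ∀ t ∈ Icc (0 : ℝ) T, IsProbabilityMeasure (μ t)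
  isCompact_support : ∀ t ∈ Icc (0 : ℝ) T, IsCompact (μ t).support
  continuous : ∀ t ∈ Icc (0 : ℝ) T,
    Tendsto (fun s => wasserstein (μ s) (μ t)) (𝓝[Icc (0 : ℝ) T] t) (𝓝 0)
  initial : μ 0 = μ₀
  weak : ∀ ψ : ℝ × Vec d × Vec d → ℝ, ContDiff ℝ 1 ψ → HasCompactSupport ψ →
    tsupport ψ ⊆ Ioo (0 : ℝ) T ×ˢ univ →
    ∫ t in (0 : ℝ)..T, ∫ z : DataSpace d,
      (deriv (fun s => ψ (s, z.fst, z.snd)) t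
        + fderiv ℝ (fun x => ψ (t, x, z.snd)) z.fst (F t z.fst (θ t))) ∂(μ t) = 0

/-- The solution `t ↦ μₜ^θ` of the continuity equation with control `θ` and initial datum `μ₀`. -/
def meanFieldCurve {d m : ℕ} (T : ℝ) (F : ℝ → Vec d → Vec m → Vec d) (θ : Control T m)
    (μ₀ : Measure (DataSpace d)) : ℝ → Measure (DataSpace d) :=
  Classical.epsilon (IsWeakSolution T F θ μ₀)

/-- The terminal loss `∫ ℓ(x,y) dμ_T^θ(x,y)` for the initial datum `μ₀`. -/
def terminalLoss {d m : ℕ} (T : ℝ) (F : ℝ → Vec d → Vec m → Vec d) (ℓ : Vec d → Vec d → ℝ)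
    (μ₀ : Measure (DataSpace d)) (θ : Control T m) : ℝ :=
  ∫ z : DataSpace d, ℓ z.fst z.snd ∂(meanFieldCurve T F θ μ₀ T)

/-- The mean-field cost `J(θ) = ∫ ℓ dμ_T^θ + λ ∫₀ᵀ |θ(t)|² dt`. -/
def meanFieldCost {d m : ℕ} (T : ℝ) (F : ℝ → Vec d → Vec m → Vec d) (ℓ : Vec d → Vec d → ℝ)
    (lam : ℝ) (μ₀ : Measure (DataSpace d)) (θ : Control T m) : ℝ :=
  terminalLoss T F ℓ μ₀ θ + lam * ∫ t in (0 : ℝ)..T, ‖θ t‖ ^ 2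

/-- The empirical cost `J^N(θ) = (1/N) ∑ᵢ ℓ(Xⁱ(T), Yⁱ(T)) + λ ∫₀ᵀ |θ(t)|² dt`, where `Xⁱ` is the
trajectory that starts at the first component of the `i`-th sample, and the label `Yⁱ` does not
move. -/
def empiricalCost {d m : ℕ} (T : ℝ) (F : ℝ → Vec d → Vec m → Vec d) (ℓ : Vec d → Vec d → ℝ)
    (lam : ℝ) {N : ℕ} (Z : Fin N → DataSpace d) (θ : Control T m) : ℝ :=
  (1 / (N : ℝ)) * ∑ i, ℓ (flow T F θ T (Z i).fst) (Z i).snd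
    + lam * ∫ t in (0 : ℝ)..T, ‖θ t‖ ^ 2

/-- The empirical measure `(1/N) ∑ᵢ δ_{Zᵢ}` of the samples `Z₁, …, Z_N`. -/
def empiricalMeasure {d N : ℕ} (Z : Fin N → DataSpace d) : Measure (DataSpace d) :=
  (N : ENNReal)⁻¹ • ∑ i, Measure.dirac (Z i)

end NeurODE

end

noncomputable section

namespace NeurODE

/-! The variational core is short. On the ball around `θstar` the costs satisfy |J^N - J| ≤ K W,
where W is the Wasserstein distance of the initial data, because the terminal loss is K-Lipschitz in
the datum and the penalty cancels. So J is a pointwise limit of convex functions, hence convex on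
the ball, and the local minimizers `θstar` and `θN N` minimize J and J^N over the whole ball. Strong
convexity gives quadratic growth of J^N at its minimizer, and J(θ*) ≤ J(θ^N) bounds the growth by
two cost discrepancies: (η/4)‖θ^N - θ*‖² ≤ 2KW. Thus the controls are at distance O(√(W/η)). The gap
between the terminal losses is at most K W for changing the datum at the control θ^N, plus K‖θ^N -
θ*‖ for changing the control at the datum `μ₀` (`exists_lipschitz_terminalLoss`).

The analytic work is to reach these Lipschitz bounds. Flow and mean-field curve are arbitrary
choices of solutions, so existence and uniqueness are needed for both. Truncation outside a large
ball turns the driven velocity into a Carathéodory field, bounded and Lipschitz at an integrable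
rate C(1 + |θ(t)|); its evolution is built by a fixed point and agrees with the flow by Grönwall's
inequality. Pushing the datum forward gives a weak solution (`isWeakSolution_transport`).

Uniqueness (`integral_eq_of_solvesWeakly`) is a duality argument. For a terminal test function g,
the backward transport u_t = g ∘ Φ_{t,T} should make ∫ u_t dν_t constant. As u_t is only Lipschitz,
it is mollified; over short intervals the mollified integral changes by O(ε) times the increment of
the rate, and continuous induction adds these errors. Hence the terminal loss is the average of ℓ
along the flow (`terminalLoss_eq`), and Grönwall's inequality with Kantorovich duality gives the
Lipschitz bounds. -/

/-! ### Absolute continuity, Grönwall's inequality and continuous induction. -/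

lemma absolutelyContinuousOnInterval_of_dist_le {X Y : Type*} [PseudoMetricSpace X]
    [PseudoMetricSpace Y] {f : ℝ → X} {g : ℝ → Y} {a b C : ℝ}
    (hg : AbsolutelyContinuousOnInterval g a b)
    (h : ∀ s ∈ uIcc a b, ∀ t ∈ uIcc a b, dist (f s) (f t) ≤ C * dist (g s) (g t)) :
    AbsolutelyContinuousOnInterval f a b := by
  have h1 := Tendsto.const_mul C hg
  rw [mul_zero] at h1
  refine squeeze_zero' (Eventually.of_forall fun _ => Finset.sum_nonneg fun _ _ => dist_nonneg) ?_ h1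
  have : ∀ᶠ I : ℕ × (ℕ → ℝ × ℝ) in AbsolutelyContinuousOnInterval.totalLengthFilter ⊓
      𝓟 (AbsolutelyContinuousOnInterval.disjWithin a b),
      I ∈ AbsolutelyContinuousOnInterval.disjWithin a b :=
    eventually_inf_principal.mpr (by simp)
  filter_upwards [this] with I hI
  rw [Finset.mul_sum]
  exact Finset.sum_le_sum fun i hi => h _ (hI.1 i hi).1 _ (hI.1 i hi).2

/-- The exponential of a primitive of an integrable function is absolutely continuous. -/
lemma absolutelyContinuousOnInterval_exp_integral {k : ℝ → ℝ} {a b : ℝ}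
    (hk : IntervalIntegrable k volume a b) (c : ℝ) :
    AbsolutelyContinuousOnInterval (fun t => Real.exp (c * ∫ r in a..t, k r)) a b := by
  have hK := (hk.absolutelyContinuousOnInterval_intervalIntegral (c := a) (by simp)).const_mul c
  obtain ⟨M, hM⟩ := hK.exists_bound
  have hexp : ContDiffOn ℝ 1 Real.exp (Icc (-M) M) := Real.contDiff_exp.contDiffOn
  obtain ⟨C, hC⟩ := hexp.exists_lipschitzOnWith (by decide) (convex_Icc _ _) isCompact_Icc
  refine absolutelyContinuousOnInterval_of_dist_le (C := C) hK fun s hs t ht => ?_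
  exact hC.dist_le_mul _ (abs_le.1 (hM s hs)) _ (abs_le.1 (hM t ht))

/-- The fundamental theorem of calculus applies although `k` is merely integrable, since the
exponential is absolutely continuous. This computes the contraction constant of the weighted Picard
map. -/
lemma integral_mul_exp_integral {k : ℝ → ℝ} {a b : ℝ}
    (hk : IntervalIntegrable k volume a b) (c : ℝ) :
    ∫ t in a..b, c * k t * Real.exp (c * ∫ r in a..t, k r)
      = Real.exp (c * ∫ r in a..b, k r) - 1 := by
  have h := (absolutelyContinuousOnInterval_exp_integral hk c).integral_deriv_eq_sub
  simp only [intervalIntegral.integral_same, mul_zero, Real.exp_zero] at h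
  rw [← h]
  apply intervalIntegral.integral_congr_ae
  filter_upwards [hk.ae_hasDerivAt_integral] with t ht hab
  have h2 := ((ht (uIoc_subset_uIcc hab) a (by simp)).const_mul c).exp
  rw [h2.deriv]; ring

/-- Grönwall's inequality in integral form, with an integrable kernel. -/
lemma le_mul_exp_of_le_add_integral {w k : ℝ → ℝ} {a b c : ℝ} (hab : a ≤ b)
    (hw : ContinuousOn w (Icc a b)) (hk : IntervalIntegrable k volume a b) (hk0 : ∀ t, 0 ≤ k t)
    (h : ∀ t ∈ Icc a b, w t ≤ c + ∫ r in a..t, k r * w r) :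
    w b ≤ c * Real.exp (∫ r in a..b, k r) := by
  have hkw : IntervalIntegrable (fun r => k r * w r) volume a b :=
    hk.mul_continuousOn (by rwa [uIcc_of_le hab])
  have hW : AbsolutelyContinuousOnInterval (fun t => c + ∫ r in a..t, k r * w r) a b := by
    refine absolutelyContinuousOnInterval_of_dist_le (C := 1)
      (hkw.absolutelyContinuousOnInterval_intervalIntegral (c := a) (by simp)) fun s _ t _ => ?_
    rw [dist_add_left, one_mul]
  -- The majorant c + ∫ k w times exp(-∫ k) is absolutely continuous and its derivative is
  -- nonpositive almost everywhere, so its value at `b` is at most its value `c` at `a`.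
  have hE := absolutelyContinuousOnInterval_exp_integral hk (-1)
  have key := (hW.fun_mul hE).integral_deriv_eq_sub
  simp only [intervalIntegral.integral_same, mul_zero, Real.exp_zero, add_zero, mul_one] at key
  have hle : ∫ t in a..b, deriv (fun x => (c + ∫ r in a..x, k r * w r) *
      Real.exp (-1 * ∫ r in a..x, k r)) t ≤ 0 := by
    rw [← neg_nonneg, ← intervalIntegral.integral_neg]
    apply intervalIntegral.integral_nonneg_of_ae_restrict hab
    rw [Filter.EventuallyLE, ae_restrict_iff' measurableSet_Icc]
    filter_upwards [hk.ae_hasDerivAt_integral, hkw.ae_hasDerivAt_integral] with t h1 h2 ht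
    have ht' : t ∈ uIcc a b := by rwa [uIcc_of_le hab]
    have d1 := ((h1 ht' a (by simp)).const_mul (-1)).exp
    have d2 := (h2 ht' a (by simp)).const_add c
    rw [(d2.fun_mul d1).deriv]
    have := h t ht
    have e := Real.exp_pos (-1 * ∫ r in a..t, k r)
    have : 0 ≤ k t * Real.exp (-1 * ∫ r in a..t, k r) * ((c + ∫ r in a..t, k r * w r) - w t) :=
      mul_nonneg (mul_nonneg (hk0 t) e.le) (by linarith)
    simp only [Pi.zero_apply]
    linarith
  rw [key, sub_nonpos, neg_one_mul, Real.exp_neg] at hle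
  have e := Real.exp_pos (∫ r in a..b, k r)
  refine (h b ⟨hab, le_rfl⟩).trans ?_
  rwa [← div_eq_mul_inv, div_le_iff₀ e] at hle

variable {E : Type*} [NormedAddCommGroup E] [NormedSpace ℝ E]

/-- Stability of integral equations. -/
lemma norm_sub_le_of_integral_eq {x y β γ : ℝ → E} {x₀ y₀ : E} {k e : ℝ → ℝ} {a b : ℝ} (hab : a ≤ b)
    (hx : ContinuousOn x (Icc a b)) (hy : ContinuousOn y (Icc a b))
    (hβ : IntervalIntegrable β volume a b) (hγ : IntervalIntegrable γ volume a b)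
    (hk : IntervalIntegrable k volume a b) (he : IntervalIntegrable e volume a b)
    (hk0 : ∀ t, 0 ≤ k t) (he0 : ∀ t, 0 ≤ e t)
    (hxβ : ∀ t ∈ Icc a b, x t = x₀ + ∫ r in a..t, β r)
    (hyγ : ∀ t ∈ Icc a b, y t = y₀ + ∫ r in a..t, γ r)
    (h : ∀ᵐ r, r ∈ Icc a b → ‖β r - γ r‖ ≤ k r * ‖x r - y r‖ + e r) :
    ‖x b - y b‖ ≤ (‖x₀ - y₀‖ + ∫ r in a..b, e r) * Real.exp (∫ r in a..b, k r) := by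
  refine le_mul_exp_of_le_add_integral (w := fun t => ‖x t - y t‖) hab (hx.sub hy).norm hk hk0 ?_
  intro t ht
  have sub : uIcc a t ⊆ uIcc a b := by
    rw [uIcc_of_le hab, uIcc_of_le ht.1]; exact Icc_subset_Icc_right ht.2
  have hβ' := hβ.mono_set sub
  have hγ' := hγ.mono_set sub
  have he' := he.mono_set sub
  have hkw : IntervalIntegrable (fun r => k r * ‖x r - y r‖) volume a t :=
    (hk.mul_continuousOn (by rw [uIcc_of_le hab]; exact (hx.sub hy).norm)).mono_set sub
  have e1 : x t - y t = (x₀ - y₀) + ∫ r in a..t, (β r - γ r) := by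
    rw [hxβ t ht, hyγ t ht, intervalIntegral.integral_sub hβ' hγ']; abel
  have e2 : ‖∫ r in a..t, (β r - γ r)‖ ≤ ∫ r in a..t, (k r * ‖x r - y r‖ + e r) := by
    refine intervalIntegral.norm_integral_le_of_norm_le ht.1 ?_ (hkw.add he')
    filter_upwards [h] with r hr hr'
    exact hr ⟨hr'.1.le, hr'.2.trans ht.2⟩
  have e3 : ∫ r in a..t, e r ≤ ∫ r in a..b, e r :=
    intervalIntegral.integral_mono_interval le_rfl ht.1 ht.2 (ae_of_all _ he0) he
  rw [intervalIntegral.integral_add hkw he'] at e2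
  calc ‖x t - y t‖ ≤ ‖x₀ - y₀‖ + ‖∫ r in a..t, (β r - γ r)‖ := by rw [e1]; exact norm_add_le _ _
    _ ≤ _ := by linarith

/-- A continuous curve whose increments to the left are infinitesimally dominated by those of a
function `A` is globally dominated by `A`. -/
lemma abs_sub_le_of_forall_exists_lt {f A : ℝ → ℝ} {a b c : ℝ} (hab : a ≤ b)
    (hf : ContinuousOn f (Icc a b)) (hA : ContinuousOn A (Icc a b))
    (h : ∀ t ∈ Ioc a b, ∀ δ > 0, ∃ s ∈ Ico a t, |f t - f s| ≤ (c + δ) * (A t - A s)) :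
    |f b - f a| ≤ c * (A b - A a) := by
  have main : ∀ δ > 0, |f b - f a| ≤ (c + δ) * (A b - A a) := by
    intro δ hδ
    -- The induction runs leftwards from `b`: `S` is closed and can always be extended to the left.
    -- The slack `δ` stays fixed here and is sent to zero at the end.
    let S : Set ℝ := {t | |f b - f t| ≤ (c + δ) * (A b - A t)}
    have hS : IsClosed (S ∩ Icc a b) := by
      have : S ∩ Icc a b = Icc a b ∩ {t | |f b - f t| ≤ (c + δ) * (A b - A t)} := inter_comm _ _
      rw [this]
      exact isClosed_Icc.isClosed_le (continuousOn_const.sub hf).abs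
        (continuousOn_const.mul (continuousOn_const.sub hA))
    refine hS.mem_of_ge_of_forall_exists_lt (b := b) (by simp [S]) hab ?_
    rintro t ⟨ht, ht'⟩
    obtain ⟨s, hs, hs'⟩ := h t ht' δ hδ
    refine ⟨s, ?_, hs⟩
    have ht : |f b - f t| ≤ (c + δ) * (A b - A t) := ht
    calc |f b - f s| ≤ |f b - f t| + |f t - f s| := abs_sub_le _ _ _
      _ ≤ (c + δ) * (A b - A s) := by linarith
  have lim : Tendsto (fun δ : ℝ => (c + δ) * (A b - A a)) (𝓝[>] 0) (𝓝 ((c + 0) * (A b - A a))) := by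
    refine Tendsto.mono_left (Continuous.tendsto (by fun_prop) 0) nhdsWithin_le_nhds
  rw [add_zero] at lim
  exact ge_of_tendsto lim (eventually_mem_nhdsWithin.mono fun δ hδ => main δ hδ)

/-! ### Evolutions of Carathéodory vector fields. -/

/-- A Carathéodory vector field that is bounded and Lipschitz with the integrable rate `k`. -/
structure IsCaratheodory {E : Type*} [NormedAddCommGroup E] [MeasurableSpace E]
    (b : ℝ → E → E) (k : ℝ → ℝ) : Prop where
  measurable : Measurable (Function.uncurry b)
  integrable : Integrable k
  lipschitz : ∀ t x y, ‖b t x - b t y‖ ≤ k t * ‖x - y‖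
  bound : ∀ t x, ‖b t x‖ ≤ k t

/-- The evolution of the vector field `b` from time `s` to time `t`, as the value at `t` of a
continuous solution of the integral equation. -/
def evolution {E : Type*} [NormedAddCommGroup E] [NormedSpace ℝ E] (b : ℝ → E → E) (s t : ℝ)
    (x₀ : E) : E :=
  Classical.epsilon (fun x : ℝ → E => Continuous x ∧ ∀ t, s ≤ t → x t = x₀ + ∫ r in s..t, b r (x r)) t

namespace IsCaratheodory

section Basic

variable {E : Type*} [NormedAddCommGroup E] [MeasurableSpace E] {b : ℝ → E → E} {k : ℝ → ℝ}

lemma nonneg (h : IsCaratheodory b k) (t : ℝ) : 0 ≤ k t :=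
  (norm_nonneg _).trans (h.bound t 0)

lemma integral_mono (h : IsCaratheodory b k) {s t u v : ℝ} (hst : s ≤ t) (hus : u ≤ s)
    (htv : t ≤ v) : (∫ r in s..t, k r) ≤ ∫ r in u..v, k r := by
  exact intervalIntegral.integral_mono_interval hus hst htv (ae_of_all _ h.nonneg)
    h.integrable.intervalIntegrable

end Basic

variable {E : Type*} [NormedAddCommGroup E] [NormedSpace ℝ E] [CompleteSpace E]
  [MeasurableSpace E] [BorelSpace E] [SecondCountableTopology E]
  {b : ℝ → E → E} {k : ℝ → ℝ}

lemma integrable_comp {E : Type*} [NormedAddCommGroup E] [MeasurableSpace E] [BorelSpace E]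
    [SecondCountableTopology E] {b : ℝ → E → E} {k : ℝ → ℝ} (h : IsCaratheodory b k) {x : ℝ → E} (hx : Measurable x) :
    Integrable (fun t => b t (x t)) :=
  h.integrable.mono' (h.measurable.comp (measurable_id.prodMk hx)).aestronglyMeasurable
    (ae_of_all _ fun t => h.bound t _)

/-- Banach's fixed point theorem for the unknown y = exp(-2K) x with K the primitive of the rate.
The weight makes the Picard map a contraction on the whole half-line, so no local solutions have to
be glued. -/
lemma exists_solution (h : IsCaratheodory b k) (s : ℝ) (x₀ : E) :
    ∃ x : ℝ → E, Continuous x ∧ ∀ t, s ≤ t → x t = x₀ + ∫ r in s..t, b r (x r) := by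
  have hki : ∀ u v, IntervalIntegrable k volume u v := fun u v => h.integrable.intervalIntegrable
  -- The `max` freezes everything to the left of `s`, so that the fixed point can be sought among
  -- bounded continuous functions on all of ℝ.
  let K : ℝ → ℝ := fun t => ∫ r in s..max s t, k r
  have hKc : Continuous K := (intervalIntegral.continuous_primitive hki s).comp (by fun_prop)
  have hK0 : ∀ t, 0 ≤ K t := fun t =>
    intervalIntegral.integral_nonneg (le_max_left _ _) fun r _ => h.nonneg r
  have hKeq : ∀ t, s ≤ t → K t = ∫ r in s..t, k r := fun t ht => by simp [K, max_eq_right ht]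
  have hint : ∀ y : BoundedContinuousFunction ℝ E,
      Integrable (fun r => b r (Real.exp (2 * K r) • y r)) := fun y =>
    h.integrable_comp (by fun_prop : Continuous fun r => Real.exp (2 * K r) • y r).measurable
  have hle : ∀ (β : ℝ → E) (κ : ℝ → ℝ) t, Integrable κ → (∀ r, ‖β r‖ ≤ κ r) →
      ‖∫ r in s..max s t, β r‖ ≤ ∫ r in s..max s t, κ r := fun β κ t hκ hβ =>
    intervalIntegral.norm_integral_le_of_norm_le (le_max_left _ _) (ae_of_all _ fun r _ => hβ r)
      hκ.intervalIntegrable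
  have hexp : ∀ t, Real.exp (-2 * K t) ≤ 1 := fun t => by
    rw [Real.exp_le_one_iff]; linarith [hK0 t]
  let G : BoundedContinuousFunction ℝ E → ℝ → E := fun y t =>
    Real.exp (-2 * K t) • (x₀ + ∫ r in s..max s t, b r (Real.exp (2 * K r) • y r))
  have hGc : ∀ y, Continuous (G y) := fun y => by
    have : Continuous fun t => ∫ r in s..max s t, b r (Real.exp (2 * K r) • y r) :=
      (intervalIntegral.continuous_primitive
        (fun _ _ => (hint y).intervalIntegrable) s).comp (by fun_prop)
    fun_prop
  have hKle : ∀ t, K t ≤ ∫ r, k r := fun t => by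
    simp only [K]
    rw [intervalIntegral.integral_of_le (le_max_left _ _)]
    exact setIntegral_le_integral h.integrable (ae_of_all _ h.nonneg)
  have hGb : ∀ y t, ‖G y t‖ ≤ ‖x₀‖ + ∫ r, k r := fun y t => by
    simp only [G, norm_smul, Real.norm_eq_abs, Real.abs_exp]
    calc _ ≤ 1 * ‖x₀ + ∫ r in s..max s t, b r (Real.exp (2 * K r) • y r)‖ := by gcongr; exact hexp t
      _ ≤ ‖x₀‖ + ‖∫ r in s..max s t, b r (Real.exp (2 * K r) • y r)‖ := by
        rw [one_mul]; exact norm_add_le _ _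
      _ ≤ _ := by gcongr; exact (hle _ k t h.integrable fun r => h.bound r _).trans (hKle t)
  let Γ : BoundedContinuousFunction ℝ E → BoundedContinuousFunction ℝ E := fun y =>
    BoundedContinuousFunction.ofNormedAddCommGroup (G y) (hGc y) _ (hGb y)
  -- The constant comes from exp(-2K) ∫ k exp(2K) = (1 - exp(-2K)) / 2 ≤ 1/2.
  have hΓ : ContractingWith (1 / 2) Γ := by
    refine ⟨by norm_num, LipschitzWith.of_dist_le_mul fun y z => ?_⟩
    rw [BoundedContinuousFunction.dist_le (by positivity)]
    intro t
    have hD : 0 ≤ dist y z := dist_nonneg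
    have hKi : Integrable fun r => k r * Real.exp (2 * K r) * dist y z := by
      refine Integrable.mul_const ?_ _
      refine h.integrable.mul_bdd (c := Real.exp (2 * ∫ r, k r)) (by fun_prop) (ae_of_all _ fun r => ?_)
      rw [Real.norm_eq_abs, Real.abs_exp, Real.exp_le_exp]
      linarith [hKle r]
    have e1 : G y t - G z t = Real.exp (-2 * K t) • ∫ r in s..max s t,
        (b r (Real.exp (2 * K r) • y r) - b r (Real.exp (2 * K r) • z r)) := by
      rw [intervalIntegral.integral_sub (hint y).intervalIntegrable (hint z).intervalIntegrable]
      simp only [G]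
      rw [← smul_sub]; congr 1; abel
    have e2 := hle (fun r => b r (Real.exp (2 * K r) • y r) - b r (Real.exp (2 * K r) • z r)) _ t hKi
      (fun r => by
        refine (h.lipschitz r _ _).trans ?_
        rw [← smul_sub, norm_smul, Real.norm_eq_abs, Real.abs_exp, mul_assoc, ← dist_eq_norm]
        have := h.nonneg r
        gcongr
        exact BoundedContinuousFunction.dist_coe_le_dist r)
    have e3 : ∫ r in s..max s t, k r * Real.exp (2 * K r) * dist y z
        = (Real.exp (2 * K t) - 1) / 2 * dist y z := by
      rw [intervalIntegral.integral_mul_const]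
      congr 1
      have := integral_mul_exp_integral (hki s (max s t)) 2
      rw [eq_div_iff two_ne_zero, ← this, mul_comm, ← intervalIntegral.integral_const_mul]
      refine intervalIntegral.integral_congr fun r hr => ?_
      rw [uIcc_of_le (le_max_left _ _)] at hr
      simp only [hKeq r hr.1]
      ring
    change dist (G y t) (G z t) ≤ _
    rw [dist_eq_norm, e1, norm_smul, Real.norm_eq_abs, Real.abs_exp]
    rw [e3] at e2
    have e4 : Real.exp (-2 * K t) * Real.exp (2 * K t) = 1 := by
      rw [← Real.exp_add]; simp
    have e5 := Real.exp_pos (-2 * K t)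
    calc _ ≤ Real.exp (-2 * K t) * ((Real.exp (2 * K t) - 1) / 2 * dist y z) := by gcongr
      _ = (1 - Real.exp (-2 * K t)) / 2 * dist y z := by linear_combination (1 / 2 * dist y z) * e4
      _ ≤ 1 / 2 * dist y z := by gcongr; linarith
      _ = _ := by norm_num
  obtain ⟨y, hy⟩ : ∃ y, Γ y = y := ⟨_, hΓ.fixedPoint_isFixedPt⟩
  refine ⟨fun t => Real.exp (2 * K t) • y t, by fun_prop, fun t ht => ?_⟩
  have : y t = G y t := by 
    conv_lhs => rw [← hy]
    rfl
  simp only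
  rw [this]
  simp only [G]
  rw [smul_smul, ← Real.exp_add, max_eq_right ht]
  simp

lemma evolution_spec (h : IsCaratheodory b k) (s : ℝ) (x₀ : E) :
    Continuous (fun t => evolution b s t x₀) ∧
      ∀ t, s ≤ t → evolution b s t x₀ = x₀ + ∫ r in s..t, b r (evolution b s r x₀) :=
  Classical.epsilon_spec (h.exists_solution s x₀)

lemma continuous_evolution (h : IsCaratheodory b k) (s : ℝ) (x₀ : E) :
    Continuous (fun t => evolution b s t x₀) := (h.evolution_spec s x₀).1

lemma evolution_eq (h : IsCaratheodory b k) {s t : ℝ} (hst : s ≤ t) (x₀ : E) :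
    evolution b s t x₀ = x₀ + ∫ r in s..t, b r (evolution b s r x₀) :=
  (h.evolution_spec s x₀).2 t hst

lemma integrable_evolution (h : IsCaratheodory b k) (s : ℝ) (x₀ : E) :
    Integrable (fun r => b r (evolution b s r x₀)) :=
  h.integrable_comp (h.continuous_evolution s x₀).measurable

lemma evolution_self (h : IsCaratheodory b k) (s : ℝ) (x₀ : E) : evolution b s s x₀ = x₀ := by
  simpa using h.evolution_eq le_rfl x₀

/-- Uniqueness is stability with no error term. The integrand needs to agree with the field only
almost everywhere along `y`, which lets trajectories of the original velocity be compared with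
evolutions of truncated fields. -/
lemma eq_evolution (h : IsCaratheodory b k) {s t : ℝ} (hst : s ≤ t) {x₀ : E} {y β : ℝ → E}
    (hy : ContinuousOn y (Icc s t)) (hβ : IntervalIntegrable β volume s t)
    (hyβ : ∀ r ∈ Icc s t, y r = x₀ + ∫ u in s..r, β u)
    (hb : ∀ᵐ r, r ∈ Icc s t → β r = b r (y r)) : y t = evolution b s t x₀ := by
  have := norm_sub_le_of_integral_eq (e := fun _ => 0) hst hy
    (h.continuous_evolution s x₀).continuousOn
    hβ (h.integrable_evolution s x₀).intervalIntegrable h.integrable.intervalIntegrable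
    intervalIntegrable_const h.nonneg (fun _ => le_rfl) hyβ
    (fun r hr => h.evolution_eq hr.1 x₀)
    (by filter_upwards [hb] with r hr hr'
        rw [hr hr', add_zero]; exact h.lipschitz _ _ _)
  simpa [sub_eq_zero] using this

lemma evolution_comp (h : IsCaratheodory b k) {s t u : ℝ} (hst : s ≤ t) (htu : t ≤ u) (x₀ : E) :
    evolution b t u (evolution b s t x₀) = evolution b s u x₀ := by
  refine (h.eq_evolution htu (y := fun r => evolution b s r x₀)
    (h.continuous_evolution s x₀).continuousOn
    (h.integrable_evolution s x₀).intervalIntegrable (fun r hr => ?_) (ae_of_all _ fun _ _ => rfl)).symm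
  rw [h.evolution_eq (hst.trans hr.1), h.evolution_eq hst, add_assoc,
    intervalIntegral.integral_add_adjacent_intervals] <;>
  exact (h.integrable_evolution s x₀).intervalIntegrable

lemma norm_evolution_sub_le (h : IsCaratheodory b k) {s t : ℝ} (hst : s ≤ t) (x y : E) :
    ‖evolution b s t x - evolution b s t y‖ ≤ Real.exp (∫ r in s..t, k r) * ‖x - y‖ := by
  have := norm_sub_le_of_integral_eq (e := fun _ => 0) hst
    (h.continuous_evolution s x).continuousOn (h.continuous_evolution s y).continuousOn
    (h.integrable_evolution s x).intervalIntegrable (h.integrable_evolution s y).intervalIntegrable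
    h.integrable.intervalIntegrable
    intervalIntegrable_const h.nonneg (fun _ => le_rfl)
    (fun r hr => h.evolution_eq hr.1 x) (fun r hr => h.evolution_eq hr.1 y)
    (ae_of_all _ fun r _ => by rw [add_zero]; exact h.lipschitz _ _ _)
  simpa [mul_comm] using this

lemma norm_evolution_sub_self_le (h : IsCaratheodory b k) {s t : ℝ} (hst : s ≤ t) (x : E) :
    ‖evolution b s t x - x‖ ≤ ∫ r in s..t, k r := by
  rw [h.evolution_eq hst, add_sub_cancel_left]
  exact intervalIntegral.norm_integral_le_of_norm_le hst (ae_of_all _ fun r _ => h.bound r _)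
    h.integrable.intervalIntegrable

lemma norm_evolution_sub_evolution_le (h : IsCaratheodory b k) {a s t : ℝ} (hs : a ≤ s)
    (ht : a ≤ t) (x : E) : ‖evolution b a s x - evolution b a t x‖ ≤ |∫ r in s..t, k r| := by
  wlog hst : s ≤ t generalizing s t with H
  · rw [norm_sub_rev, intervalIntegral.integral_symm, abs_neg]
    exact H ht hs (le_of_not_ge hst)
  rw [norm_sub_rev, ← h.evolution_comp hs hst]
  exact (h.norm_evolution_sub_self_le hst _).trans (le_abs_self _)

lemma ae_hasDerivAt_evolution (h : IsCaratheodory b k) (s : ℝ) (x : E) :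
    ∀ᵐ t, s < t → HasDerivAt (fun r => evolution b s r x) (b t (evolution b s t x)) t := by
  filter_upwards [LocallyIntegrable.ae_hasDerivAt_integral
    (h.integrable_evolution s x).locallyIntegrable] with t ht hst
  refine ((ht s).const_add x).congr_of_eventuallyEq ?_
  filter_upwards [lt_mem_nhds hst] with r hr
  exact h.evolution_eq hr.le x

/-- The displacement has a Lipschitz constant of the order of ∫ k, small over short times. This
controls the commutator of mollification and transport without differentiating the evolution in the
initial point. -/
lemma norm_evolution_displacement_sub_le (h : IsCaratheodory b k) {s t : ℝ} (hst : s ≤ t) (x y : E) :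
    ‖(evolution b s t x - x) - (evolution b s t y - y)‖
      ≤ (∫ r in s..t, k r) * (Real.exp (∫ r in s..t, k r) * ‖x - y‖) := by
  rw [h.evolution_eq hst x, h.evolution_eq hst y, add_sub_cancel_left, add_sub_cancel_left,
    ← intervalIntegral.integral_sub (h.integrable_evolution s x).intervalIntegrable
      (h.integrable_evolution s y).intervalIntegrable, ← intervalIntegral.integral_mul_const]
  refine intervalIntegral.norm_integral_le_of_norm_le hst (ae_of_all _ fun r hr => ?_)
    (h.integrable.intervalIntegrable.mul_const _)
  refine (h.lipschitz _ _ _).trans ?_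
  have := h.nonneg r
  gcongr
  refine (h.norm_evolution_sub_le hr.1.le x y).trans ?_
  gcongr
  exact h.integral_mono hr.1.le le_rfl hr.2

/-- Under linear growth with rate `κ`, points far out stay far out. -/
lemma one_add_norm_le_mul_exp (h : IsCaratheodory b k) {κ : ℝ → ℝ} (hκ : Integrable κ)
    (hκ0 : ∀ t, 0 ≤ κ t) (hb : ∀ t x, ‖b t x‖ ≤ κ t * (1 + ‖x‖)) {s t : ℝ} (hst : s ≤ t) (x : E) :
    1 + ‖x‖ ≤ (1 + ‖evolution b s t x‖) * Real.exp (∫ r in s..t, κ r) := by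
  have hc := h.continuous_evolution s x
  have hi : ∀ u v, IntervalIntegrable (fun r => b r (evolution b s r x)) volume u v :=
    fun u v => (h.integrable_evolution s x).intervalIntegrable
  -- Grönwall's inequality in reversed time τ = -r, started from the endpoint of the evolution.
  have key := le_mul_exp_of_le_add_integral (a := -t) (b := -s) (neg_le_neg hst)
    (w := fun τ => 1 + ‖evolution b s (-τ) x‖) (k := fun τ => κ (-τ))
    (c := 1 + ‖evolution b s t x‖)
    (by fun_prop) hκ.comp_neg.intervalIntegrable (fun τ => hκ0 _) (fun τ hτ => ?_)
  · simp only [neg_neg, h.evolution_self] at key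
    rwa [intervalIntegral.integral_comp_neg (fun r => κ r), neg_neg, neg_neg] at key
  · have h1 : s ≤ -τ := by linarith [hτ.2]
    have h2 : -τ ≤ t := by linarith [hτ.1]
    have e1 : evolution b s (-τ) x = evolution b s t x - ∫ r in (-τ)..t, b r (evolution b s r x) := by
      rw [h.evolution_eq hst, h.evolution_eq h1,
        ← intervalIntegral.integral_add_adjacent_intervals (hi s (-τ)) (hi (-τ) t)]
      abel
    have e2 := intervalIntegral.norm_integral_le_of_norm_le h2
      (f := fun r => b r (evolution b s r x)) (g := fun r => κ r * (1 + ‖evolution b s r x‖))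
      (ae_of_all _ fun r _ => hb r _)
      (hκ.intervalIntegrable.mul_continuousOn (by fun_prop))
    have e3 := intervalIntegral.integral_comp_neg (a := -t) (b := τ)
      (fun r => κ r * (1 + ‖evolution b s r x‖))
    rw [neg_neg] at e3
    simp only [e3]
    rw [add_assoc, e1]
    gcongr
    exact (norm_sub_le _ _).trans (by gcongr)

/-- Under linear growth with rate `κ`, the evolution grows at most exponentially. -/
lemma one_add_norm_evolution_le (h : IsCaratheodory b k) {κ : ℝ → ℝ} (hκ : Integrable κ)
    (hκ0 : ∀ t, 0 ≤ κ t) (hb : ∀ t x, ‖b t x‖ ≤ κ t * (1 + ‖x‖)) {s t : ℝ} (hst : s ≤ t) (x : E) :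
    1 + ‖evolution b s t x‖ ≤ (1 + ‖x‖) * Real.exp (∫ r in s..t, κ r) := by
  have hc := h.continuous_evolution s x
  refine le_mul_exp_of_le_add_integral (w := fun τ => 1 + ‖evolution b s τ x‖) hst
    (by fun_prop) hκ.intervalIntegrable hκ0 fun τ hτ => ?_
  rw [h.evolution_eq hτ.1, add_assoc]
  gcongr
  refine (norm_add_le _ _).trans ?_
  gcongr
  exact intervalIntegral.norm_integral_le_of_norm_le hτ.1 (ae_of_all _ fun r _ => hb r _)
      (hκ.intervalIntegrable.mul_continuousOn (by fun_prop))

lemma continuous_evolution_right (h : IsCaratheodory b k) {s t : ℝ} (hst : s ≤ t) :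
    Continuous (evolution b s t) :=
  (LipschitzWith.of_dist_le_mul (K := ⟨Real.exp (∫ r in s..t, k r), (Real.exp_pos _).le⟩) fun x y => by
    rw [dist_eq_norm, dist_eq_norm]; exact h.norm_evolution_sub_le hst x y).continuous

/-- Continuity in each variable separately gives joint measurability. The `max` is needed because
the choice of `evolution` is uncontrolled in the initial point at times before `s`. -/
lemma measurable_evolution (h : IsCaratheodory b k) (s : ℝ) :
    Measurable (fun p : ℝ × E => evolution b s (max s p.1) p.2) :=
  measurable_uncurry_of_continuous_of_measurable (u := fun t x => evolution b s (max s t) x)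
    (fun x => (h.continuous_evolution s x).comp (by fun_prop))
    (fun _ => (h.continuous_evolution_right (le_max_left _ _)).measurable)

end IsCaratheodory

/-! ### Measurable representatives, control rates and truncation of the velocity. -/

/-- A family that is measurable in the parameter and a.e. continuous agrees a.e. with a jointly
measurable family. -/
lemma exists_measurable_uncurry_ae_eq {P Y : Type*} [TopologicalSpace P]
    [TopologicalSpace.MetrizableSpace P] [SecondCountableTopology P] [MeasurableSpace P] [OpensMeasurableSpace P]
    [NormedAddCommGroup Y] [MeasurableSpace Y] [BorelSpace Y] {μ : Measure ℝ} {g : ℝ → P → Y}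
    (hmeas : ∀ p, AEMeasurable (fun t => g t p) μ) (hcont : ∀ᵐ t ∂μ, Continuous (g t)) :
    ∃ g' : ℝ → P → Y, Measurable (Function.uncurry g') ∧ ∀ᵐ t ∂μ, g' t = g t := by
  let _ := TopologicalSpace.metrizableSpaceMetric P
  rcases isEmpty_or_nonempty P with hP | hP
  · exact ⟨fun _ p => (hP.false p).elim, measurable_of_empty _, ae_of_all _ fun t => by
      ext p; exact (hP.false p).elim⟩
  let D := TopologicalSpace.denseSeq P
  have hD : DenseRange D := TopologicalSpace.denseRange_denseSeq P
  -- Null sets are discarded only for a countable dense set of parameters; measurability at the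
  -- other parameters follows by passing to limits.
  have hgood : ∀ᵐ t ∂μ, Continuous (g t) ∧ ∀ n, g t (D n) = (hmeas (D n)).mk _ t :=
    hcont.and (ae_all_iff.2 fun n => (hmeas (D n)).ae_eq_mk)
  obtain ⟨S, hSsub, hSm, hS⟩ : ∃ S : Set ℝ,
      S ⊆ {t | Continuous (g t) ∧ ∀ n, g t (D n) = (hmeas (D n)).mk _ t} ∧ MeasurableSet S ∧
        ∀ᵐ t ∂μ, t ∈ S := by
    obtain ⟨S, h1, h2, h3⟩ := hgood.exists_measurable_mem
    exact ⟨S, h3, h2, h1⟩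
  classical
  let g' : ℝ → P → Y := fun t p => if t ∈ S then g t p else 0
  have hg'D : ∀ n, Measurable fun t => g' t (D n) := fun n => by
    have : (fun t => g' t (D n)) = S.indicator ((hmeas (D n)).mk _) := by
      ext t
      by_cases ht : t ∈ S
      · simp [g', ht, (hSsub ht).2 n]
      · simp [g', ht]
    rw [this]
    exact (hmeas (D n)).measurable_mk.indicator hSm
  have hg'c : ∀ t, Continuous (g' t) := fun t => by
    by_cases ht : t ∈ S
    · simpa [g', ht] using (hSsub ht).1
    · simpa [g', ht] using (continuous_const : Continuous fun _ : P => (0 : Y))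
  have hg'm : ∀ p, Measurable fun t => g' t p := fun p => by
    obtain ⟨u, hu, hup⟩ := mem_closure_iff_seq_limit.1 (hD p)
    choose n hn using hu
    refine measurable_of_tendsto_metrizable (f := fun i t => g' t (u i)) (fun i => ?_)
      (tendsto_pi_nhds.2 fun t => ((hg'c t).tendsto p).comp hup)
    rw [← hn i]; exact hg'D _
  refine ⟨g', ?_, hS.mono fun t ht => by simp [g', ht]⟩
  have := measurable_uncurry_of_continuous_of_measurable (u := fun p t => g' t p) hg'c hg'm
  exact this.comp measurable_swap

/-- The rate `C (1 + |θ(t)|)` on `[0,T]`. -/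
def controlRate {T : ℝ} {m : ℕ} (θ : Control T m) (C : ℝ) : ℝ → ℝ :=
  (Icc (0 : ℝ) T).indicator fun t => C * (1 + ‖θ t‖)

section Rate

variable {T : ℝ} {m : ℕ}

lemma measurable_control (θ : Control T m) : Measurable θ :=
  (Lp.stronglyMeasurable θ).measurable

lemma integrable_norm_sq_control (θ : Control T m) :
    IntegrableOn (fun t => ‖θ t‖ ^ 2) (Icc 0 T) := (Lp.memLp θ).integrable_norm_pow (by norm_num)

lemma integral_norm_sq_control (θ : Control T m) : ∫ t in Icc 0 T, ‖θ t‖ ^ 2 = ‖θ‖ ^ 2 := by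
  rw [← real_inner_self_eq_norm_sq, L2.inner_def]
  simp

lemma integrable_norm_control (θ : Control T m) : IntegrableOn (fun t => ‖θ t‖) (Icc 0 T) :=
  ((Lp.memLp θ).integrable (by norm_num)).norm

lemma integrableOn_one_add_norm_control (θ : Control T m) (C : ℝ) :
    IntegrableOn (fun t => C * (1 + ‖θ t‖)) (Icc 0 T) :=
  ((integrable_const 1).add (integrable_norm_control θ)).const_mul C

lemma integrable_controlRate (θ : Control T m) (C : ℝ) : Integrable (controlRate θ C) :=
  (integrableOn_one_add_norm_control θ C).integrable_indicator measurableSet_Icc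

lemma controlRate_nonneg (θ : Control T m) {C : ℝ} (hC : 0 ≤ C) (t : ℝ) : 0 ≤ controlRate θ C t :=
  indicator_nonneg (fun _ _ => by positivity) _

lemma controlRate_eq (θ : Control T m) (C : ℝ) {t : ℝ} (ht : t ∈ Icc 0 T) :
    controlRate θ C t = C * (1 + ‖θ t‖) := indicator_of_mem ht _

/-- From 1 + a ≤ 2 + a². The bound depends on the control only through its L² norm, so the Grönwall
constants are uniform on L² balls. -/
lemma integral_controlRate_le (hT : 0 ≤ T) (θ : Control T m) {C : ℝ} (hC : 0 ≤ C) {s t : ℝ}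
    (hst : s ≤ t) : ∫ r in s..t, controlRate θ C r ≤ C * (2 * T + ‖θ‖ ^ 2) := by
  rw [intervalIntegral.integral_of_le hst]
  refine (setIntegral_le_integral (integrable_controlRate θ C)
    (ae_of_all _ (controlRate_nonneg θ hC))).trans ?_
  rw [controlRate, integral_indicator measurableSet_Icc, integral_const_mul]
  gcongr
  calc ∫ t in Icc 0 T, (1 + ‖θ t‖) ≤ ∫ t in Icc 0 T, (2 + ‖θ t‖ ^ 2) := by
        refine integral_mono ((integrable_const 1).add (integrable_norm_control θ))
          ((integrable_const 2).add (integrable_norm_sq_control θ)) fun t => ?_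
        simp only
        nlinarith [sq_nonneg (‖θ t‖ - 1)]
    _ = _ := by
      rw [integral_add (integrable_const 2) (integrable_norm_sq_control θ), integral_norm_sq_control]
      simp [hT]
      ring

end Rate

section Velocity

variable {d m : ℕ} {T : ℝ} {F : ℝ → Vec d → Vec m → Vec d}

/-- The exceptional null set in the Lipschitz assumptions depends on the radius; integer radii
suffice, so only countably many null sets are united. -/
lemma VelocityAssumptions.ae_continuous (hF : VelocityAssumptions T F) :
    ∀ᵐ t ∂(volume.restrict (Icc (0 : ℝ) T)), Continuous fun p : Vec d × Vec m => F t p.1 p.2 := by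
  have h1 : ∀ᵐ t ∂(volume.restrict (Icc (0 : ℝ) T)), ∀ n : ℕ, ∃ L : ℝ, ∀ θ₁ θ₂ : Vec m,
      ∀ x₁ ∈ Metric.ball (0 : Vec d) (n + 1), ∀ x₂ ∈ Metric.ball (0 : Vec d) (n + 1),
        ‖F t x₁ θ₁ - F t x₂ θ₂‖ ≤ L * (1 + ‖θ₁‖) * ‖x₁ - x₂‖
          + L * (1 + ‖θ₁‖ + ‖θ₂‖) * ‖θ₁ - θ₂‖ := by
    refine ae_all_iff.2 fun n => ?_
    obtain ⟨L₁, hL₁, h₁⟩ := hF.lipschitz_state (n + 1) (by positivity)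
    obtain ⟨L₂, hL₂, h₂⟩ := hF.lipschitz_control (n + 1) (by positivity)
    filter_upwards [h₁, h₂] with t h₁ h₂
    refine ⟨max L₁ L₂, fun θ₁ θ₂ x₁ hx₁ x₂ hx₂ => ?_⟩
    calc ‖F t x₁ θ₁ - F t x₂ θ₂‖ ≤ ‖F t x₁ θ₁ - F t x₂ θ₁‖ + ‖F t x₂ θ₁ - F t x₂ θ₂‖ :=
          norm_sub_le_norm_sub_add_norm_sub _ _ _
      _ ≤ L₁ * (1 + ‖θ₁‖) * ‖x₁ - x₂‖ + L₂ * (1 + ‖θ₁‖ + ‖θ₂‖) * ‖θ₁ - θ₂‖ :=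
          add_le_add (h₁ _ _ hx₁ _ hx₂) (h₂ _ _ _ hx₂)
      _ ≤ _ := by gcongr <;> simp
  filter_upwards [h1] with t ht
  rw [continuous_iff_continuousAt]
  rintro ⟨x, θ⟩
  obtain ⟨n, hn⟩ := exists_nat_gt ‖x‖
  obtain ⟨L, hL⟩ := ht n
  have hx : x ∈ Metric.ball (0 : Vec d) (n + 1) := by simp; linarith
  rw [ContinuousAt, tendsto_iff_norm_sub_tendsto_zero]
  have hlim : Tendsto (fun p : Vec d × Vec m => L * (1 + ‖p.2‖) * ‖p.1 - x‖
          + L * (1 + ‖p.2‖ + ‖θ‖) * ‖p.2 - θ‖) (𝓝 (x, θ)) (𝓝 0) := by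
    have : Continuous (fun p : Vec d × Vec m => L * (1 + ‖p.2‖) * ‖p.1 - x‖
          + L * (1 + ‖p.2‖ + ‖θ‖) * ‖p.2 - θ‖) := by fun_prop
    simpa using this.tendsto (x, θ)
  refine squeeze_zero' (Eventually.of_forall fun _ => norm_nonneg _) ?_ hlim
  have : ∀ᶠ p : Vec d × Vec m in 𝓝 (x, θ), p.1 ∈ Metric.ball (0 : Vec d) (n + 1) :=
    continuous_fst.continuousAt.eventually (Metric.isOpen_ball.mem_nhds hx)
  filter_upwards [this] with p hp
  exact hL _ _ _ hp _ hx

lemma VelocityAssumptions.exists_measurable (hF : VelocityAssumptions T F) :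
    ∃ G : ℝ → Vec d × Vec m → Vec d, Measurable (Function.uncurry G) ∧
      ∀ᵐ t ∂(volume.restrict (Icc (0 : ℝ) T)), G t = fun p => F t p.1 p.2 :=
  exists_measurable_uncurry_ae_eq (fun p => hF.measurable_time p.1 p.2) hF.ae_continuous

/-- Near a bounded set, the velocity field driven by a control agrees with a Carathéodory field. -/
lemma VelocityAssumptions.exists_isCaratheodory (hF : VelocityAssumptions T F) (θ : Control T m)
    {R L : ℝ} (hR : 0 < R) (hL : 0 < L)
    (hgrowth : ∀ᵐ t ∂(volume.restrict (Icc (0 : ℝ) T)), ∀ (x : Vec d) (θ : Vec m),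
      ‖F t x θ‖ ≤ L * (1 + ‖x‖) * (1 + ‖θ‖)) :
    ∃ (b : ℝ → Vec d → Vec d) (C : ℝ), 0 < C ∧ IsCaratheodory b (controlRate θ C) ∧
      (∀ᵐ t ∂(volume.restrict (Icc (0 : ℝ) T)), ∀ x ∈ Metric.closedBall 0 R,
        b t x = F t x (θ t)) ∧
      ∀ t x, ‖b t x‖ ≤ controlRate θ L t * (1 + ‖x‖) := by
  obtain ⟨G, hGm, hG⟩ := hF.exists_measurable
  obtain ⟨L₁, hL₁, h₁⟩ := hF.lipschitz_state (R + 1) (by positivity)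
  let good : Set ℝ := {t | (∀ (x : Vec d) (θ : Vec m), ‖G t (x, θ)‖ ≤ L * (1 + ‖x‖) * (1 + ‖θ‖)) ∧
    (∀ θ : Vec m, ∀ x₁ ∈ Metric.ball (0 : Vec d) (R + 1), ∀ x₂ ∈ Metric.ball (0 : Vec d) (R + 1),
        ‖G t (x₁, θ) - G t (x₂, θ)‖ ≤ L₁ * (1 + ‖θ‖) * ‖x₁ - x₂‖) ∧ G t = fun p => F t p.1 p.2}
  have hgood : ∀ᵐ t ∂(volume.restrict (Icc (0 : ℝ) T)), t ∈ good := by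
    filter_upwards [hG, hgrowth, h₁] with t ht h h'
    refine ⟨?_, ?_, ht⟩ <;> rw [ht]
    · exact h
    · exact h'
  obtain ⟨S, hSm, hSg, hST, hS⟩ : ∃ S : Set ℝ, MeasurableSet S ∧ S ⊆ good ∧ S ⊆ Icc 0 T ∧
      ∀ᵐ t ∂(volume.restrict (Icc (0 : ℝ) T)), t ∈ S := by
    obtain ⟨S, h1, h2, h3⟩ := (hgood.and (ae_restrict_mem measurableSet_Icc)).exists_measurable_mem
    exact ⟨S, h2, fun t ht => (h3 t ht).1, fun t ht => (h3 t ht).2, h1⟩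
  -- A 1-Lipschitz cutoff, equal to 1 on the closed ball of radius `R` and to 0 off the open ball of
  -- radius `R + 1`. Since it is at most 1, linear growth survives with the same `L`.
  let χ : Vec d → ℝ := fun x => max 0 (min 1 (R + 1 - ‖x‖))
  have hχ0 : ∀ x, 0 ≤ χ x := fun x => le_max_left _ _
  have hχ1 : ∀ x, χ x ≤ 1 := fun x => max_le zero_le_one (min_le_left _ _)
  have hχR : ∀ x ∈ Metric.closedBall (0 : Vec d) R, χ x = 1 := fun x hx => by
    rw [mem_closedBall_zero_iff] at hx
    simp only [χ]
    rw [min_eq_left (by linarith), max_eq_right zero_le_one]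
  have hχout : ∀ x ∉ Metric.ball (0 : Vec d) (R + 1), χ x = 0 := fun x hx => by
    rw [mem_ball_zero_iff, not_lt] at hx
    exact max_eq_left ((min_le_right _ _).trans (by linarith))
  have hχl : ∀ x y, |χ x - χ y| ≤ ‖x - y‖ := fun x y => by
    have h1 := abs_max_sub_max_le_abs (min 1 (R + 1 - ‖x‖)) (min 1 (R + 1 - ‖y‖)) 0
    have h2 := abs_min_sub_min_le_max 1 (R + 1 - ‖x‖) 1 (R + 1 - ‖y‖)
    simp only [χ]
    rw [max_comm 0, max_comm 0]
    refine h1.trans (h2.trans ?_)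
    simp only [sub_self, abs_zero]
    refine max_le (norm_nonneg _) ?_
    rw [show R + 1 - ‖x‖ - (R + 1 - ‖y‖) = ‖y‖ - ‖x‖ by ring, norm_sub_rev]
    exact abs_norm_sub_norm_le _ _
  have hχm : Measurable χ := by fun_prop
  classical
  let b : ℝ → Vec d → Vec d := fun t x => if t ∈ S then χ x • G t (x, θ t) else 0
  -- Product rule for Lipschitz constants: `L₁` comes from the velocity, and `L * (R + 2)` bounds
  -- the velocity on the ball of radius `R + 1`, multiplied by the Lipschitz constant 1 of the
  -- cutoff.
  let C : ℝ := L₁ + L * (R + 2)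
  have hC : 0 < C := by positivity
  have hCrate : ∀ t, 0 ≤ controlRate θ C t := controlRate_nonneg θ hC.le
  have hin : ∀ t ∈ S, ∀ x ∈ Metric.ball (0 : Vec d) (R + 1),
      ‖G t (x, θ t)‖ ≤ L * (R + 2) * (1 + ‖θ t‖) := fun t ht x hx => by
    refine ((hSg ht).1 x _).trans ?_
    rw [mem_ball_zero_iff] at hx
    have : 1 + ‖x‖ ≤ R + 2 := by linarith
    gcongr
  refine ⟨b, C, hC, ⟨?_, integrable_controlRate θ C, ?_, ?_⟩, ?_, ?_⟩
  · refine Measurable.ite (hSm.preimage measurable_fst) ?_ measurable_const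
    refine (hχm.comp measurable_snd).smul (hGm.comp (measurable_fst.prodMk
      (measurable_snd.prodMk ((measurable_control θ).comp measurable_fst))))
  · intro t x y
    by_cases ht : t ∈ S
    swap
    · simp only [b, ht, if_false, sub_self, norm_zero]
      have := hCrate t
      positivity
    simp only [b, ht, if_true]
    rw [controlRate_eq θ C (hST ht)]
    wlog hx : x ∈ Metric.ball (0 : Vec d) (R + 1) generalizing x y with H
    · by_cases hy : y ∈ Metric.ball (0 : Vec d) (R + 1)
      · rw [norm_sub_rev, norm_sub_rev x]; exact H y x hy
      · rw [hχout x hx, hχout y hy]; simp only [zero_smul, sub_self, norm_zero]; positivity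
    have e0 : χ x • G t (x, θ t) - χ y • G t (y, θ t)
        = (χ x - χ y) • G t (x, θ t) + χ y • (G t (x, θ t) - G t (y, θ t)) := by
      rw [sub_smul, smul_sub]; abel
    have e1 : ‖(χ x - χ y) • G t (x, θ t)‖ ≤ ‖x - y‖ * (L * (R + 2) * (1 + ‖θ t‖)) := by
      rw [norm_smul]
      exact mul_le_mul (hχl x y) (hin t ht x hx) (norm_nonneg _) (norm_nonneg _)
    have e2 : ‖χ y • (G t (x, θ t) - G t (y, θ t))‖ ≤ L₁ * (1 + ‖θ t‖) * ‖x - y‖ := by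
      by_cases hy : y ∈ Metric.ball (0 : Vec d) (R + 1)
      · rw [norm_smul, Real.norm_of_nonneg (hχ0 y)]
        calc _ ≤ 1 * ‖G t (x, θ t) - G t (y, θ t)‖ := by gcongr; exact hχ1 y
          _ ≤ _ := by rw [one_mul]; exact (hSg ht).2.1 _ _ hx _ hy
      · rw [hχout y hy, zero_smul, norm_zero]; positivity
    rw [e0]
    refine (norm_add_le _ _).trans ((add_le_add e1 e2).trans (le_of_eq ?_))
    simp only [C]; ring
  · intro t x
    by_cases ht : t ∈ S
    swap
    · simpa only [b, ht, if_false, norm_zero] using hCrate t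
    simp only [b, ht, if_true]
    rw [controlRate_eq θ C (hST ht), norm_smul, Real.norm_of_nonneg (hχ0 x)]
    by_cases hx : x ∈ Metric.ball (0 : Vec d) (R + 1)
    · calc _ ≤ 1 * (L * (R + 2) * (1 + ‖θ t‖)) := by gcongr; exacts [hχ1 x, hin t ht x hx]
        _ ≤ _ := by rw [one_mul]; gcongr; simp only [C]; linarith
    · rw [hχout x hx, zero_mul]; positivity
  · filter_upwards [hS] with t ht x hx
    simp only [b, ht, if_true, hχR x hx, one_smul, (hSg ht).2.2]
  · intro t x
    by_cases ht : t ∈ S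
    swap
    · simp only [b, ht, if_false, norm_zero]
      have := controlRate_nonneg θ hL.le t
      positivity
    simp only [b, ht, if_true]
    rw [controlRate_eq θ L (hST ht), norm_smul, Real.norm_of_nonneg (hχ0 x)]
    calc _ ≤ 1 * (L * (1 + ‖x‖) * (1 + ‖θ t‖)) := by gcongr; exacts [hχ1 x, (hSg ht).1 _ _]
      _ = _ := by ring

end Velocity

/-! ### Trajectories and the flow of a control. -/

section Trajectory

variable {d m : ℕ} {T : ℝ} {F : ℝ → Vec d → Vec m → Vec d}

/-- The trajectory minus the primitive of its velocity is absolutely continuous with zero derivative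
almost everywhere, hence constant. Integrability of the velocity follows from linear growth, as the
trajectory is bounded. -/
lemma IsTrajectory.eq_integral (hT : 0 < T) (hF : VelocityAssumptions T F) {θ : Control T m}
    {x₀ : Vec d} {x : ℝ → Vec d} (hx : IsTrajectory T F θ x₀ x) :
    ContinuousOn x (Icc 0 T) ∧ IntervalIntegrable (fun t => F t (x t) (θ t)) volume 0 T ∧
      ∀ t ∈ Icc 0 T, x t = x₀ + ∫ r in 0..t, F r (x r) (θ r) := by
  have hu : uIcc 0 T = Icc 0 T := uIcc_of_le hT.le
  have hc : ContinuousOn x (Icc 0 T) := by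
    have := hx.absolutelyContinuous.continuousOn
    rwa [hu] at this
  obtain ⟨M, hM⟩ := hx.absolutelyContinuous.exists_bound
  rw [hu] at hM
  obtain ⟨L, hL, hgrowth⟩ := hF.linear_growth
  obtain ⟨G, hGm, hG⟩ := hF.exists_measurable
  have hint : IntegrableOn (fun t => F t (x t) (θ t)) (Icc 0 T) := by
    refine Integrable.mono' (integrableOn_one_add_norm_control θ (L * (1 + M))) ?_ ?_
    · have h1 : AEMeasurable x (volume.restrict (Icc 0 T)) := hc.aemeasurable measurableSet_Icc
      have h2 := hGm.comp_aemeasurable (aemeasurable_id.prodMk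
        (h1.prodMk (measurable_control θ).aemeasurable))
      refine (h2.congr ?_).aestronglyMeasurable
      filter_upwards [hG] with t ht
      simp [Function.uncurry, ht]
    · filter_upwards [hgrowth, ae_restrict_mem measurableSet_Icc] with t ht h
      refine (ht _ _).trans ?_
      have := hM t h
      gcongr
  have hii : IntervalIntegrable (fun t => F t (x t) (θ t)) volume 0 T := by
    rwa [intervalIntegrable_iff_integrableOn_Icc_of_le hT.le]
  refine ⟨hc, hii, ?_⟩
  have hI : AbsolutelyContinuousOnInterval (fun t => ∫ r in 0..t, F r (x r) (θ r)) 0 T := by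
    refine absolutelyContinuousOnInterval_of_dist_le (C := 1)
      (hii.norm.absolutelyContinuousOnInterval_intervalIntegral (c := 0) (by simp))
      fun s hs t ht => ?_
    have h0s := hii.mono_set (uIcc_subset_uIcc_left hs)
    have h0t := hii.mono_set (uIcc_subset_uIcc_left ht)
    rw [one_mul, dist_eq_norm, dist_eq_norm, intervalIntegral.integral_interval_sub_left h0s h0t,
      intervalIntegral.integral_interval_sub_left h0s.norm h0t.norm]
    exact intervalIntegral.norm_integral_le_abs_integral_norm
  have hconst := (hx.absolutelyContinuous.sub hI).const_of_ae_hasDerivAt_zero (by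
    have := hx.ode
    rw [ae_restrict_iff' measurableSet_Icc] at this
    filter_upwards [this, hii.ae_hasDerivAt_integral] with t h1 h2 ht
    simpa using (h1 (hu ▸ ht)).sub (h2 ht 0 (by simp)))
  obtain ⟨c, hcst⟩ := hconst
  rw [hu] at hcst
  have h0 := hcst 0 ⟨le_rfl, hT.le⟩
  simp only [Pi.sub_apply, intervalIntegral.integral_same, sub_zero, hx.initial] at h0
  intro t ht
  have := hcst t ht
  simp only [Pi.sub_apply] at this
  rw [h0, ← this]; abel

/-- An a priori bound for every trajectory: it guarantees that the trajectory stays where a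
truncated field agrees with the velocity, before any uniqueness is known. -/
lemma IsTrajectory.one_add_norm_le (hT : 0 < T) (hF : VelocityAssumptions T F) {θ : Control T m}
    {x₀ : Vec d} {x : ℝ → Vec d} (hx : IsTrajectory T F θ x₀ x) {L : ℝ} (hL : 0 < L)
    (hgrowth : ∀ᵐ t ∂(volume.restrict (Icc (0 : ℝ) T)), ∀ (x : Vec d) (θ : Vec m),
      ‖F t x θ‖ ≤ L * (1 + ‖x‖) * (1 + ‖θ‖)) {t : ℝ} (ht : t ∈ Icc 0 T) :
    1 + ‖x t‖ ≤ (1 + ‖x₀‖) * Real.exp (L * (2 * T + ‖θ‖ ^ 2)) := by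
  obtain ⟨hc, hi, heq⟩ := hx.eq_integral hT hF
  have hc' := hc.mono (Icc_subset_Icc_right ht.2)
  rw [ae_restrict_iff' measurableSet_Icc] at hgrowth
  have key := le_mul_exp_of_le_add_integral (w := fun τ => 1 + ‖x τ‖) (c := 1 + ‖x₀‖) ht.1
    (by fun_prop) (integrable_controlRate θ L).intervalIntegrable
    (controlRate_nonneg θ hL.le) fun τ hτ => ?_
  · refine key.trans ?_
    gcongr
    exact integral_controlRate_le hT.le θ hL.le ht.1
  · rw [heq τ ⟨hτ.1, hτ.2.trans ht.2⟩, add_assoc]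
    gcongr
    refine (norm_add_le _ _).trans ?_
    gcongr
    refine intervalIntegral.norm_integral_le_of_norm_le hτ.1 ?_
      ((integrable_controlRate θ L).intervalIntegrable.mul_continuousOn ?_)
    · filter_upwards [hgrowth] with r h hr
      have hr' : r ∈ Icc 0 T := ⟨hr.1.le, hr.2.trans (hτ.2.trans ht.2)⟩
      rw [controlRate_eq θ L hr']
      exact (h hr' _ _).trans (le_of_eq (by ring))
    · rw [uIcc_of_le hτ.1]
      have := hc.mono (Icc_subset_Icc_right (hτ.2.trans ht.2))
      fun_prop

/-- For initial data in the ball of radius `R`, the flow exists, and is the evolution of every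
Carathéodory field that agrees with the velocity on a sufficiently large ball. -/
lemma isTrajectory_flow_and_eq_evolution (hT : 0 < T) (hF : VelocityAssumptions T F)
    {θ : Control T m} {L R R' C : ℝ} (hL : 0 < L)
    (hgrowth : ∀ᵐ t ∂(volume.restrict (Icc (0 : ℝ) T)), ∀ (x : Vec d) (θ : Vec m),
      ‖F t x θ‖ ≤ L * (1 + ‖x‖) * (1 + ‖θ‖))
    {b : ℝ → Vec d → Vec d} (hb : IsCaratheodory b (controlRate θ C))
    (hbF : ∀ᵐ t ∂(volume.restrict (Icc (0 : ℝ) T)), ∀ x ∈ Metric.closedBall 0 R',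
        b t x = F t x (θ t))
    (hbL : ∀ t x, ‖b t x‖ ≤ controlRate θ L t * (1 + ‖x‖))
    (hR' : (1 + R) * Real.exp (L * (2 * T + ‖θ‖ ^ 2)) ≤ 1 + R')
    {x₀ : Vec d} (hx₀ : ‖x₀‖ ≤ R) :
    IsTrajectory T F θ x₀ (fun t => flow T F θ t x₀) ∧
      ∀ t ∈ Icc 0 T, flow T F θ t x₀ = evolution b 0 t x₀ ∧ ‖flow T F θ t x₀‖ ≤ R' := by
  have hu : uIcc 0 T = Icc 0 T := uIcc_of_le hT.le
  have hstay : ∀ t ∈ Icc 0 T, ‖evolution b 0 t x₀‖ ≤ R' := fun t ht => by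
    have h1 := hb.one_add_norm_evolution_le (integrable_controlRate θ L)
      (controlRate_nonneg θ hL.le) hbL ht.1 x₀
    have h2 : (1 + ‖x₀‖) * Real.exp (∫ r in 0..t, controlRate θ L r)
        ≤ (1 + R) * Real.exp (L * (2 * T + ‖θ‖ ^ 2)) := by
      have : 0 ≤ R := (norm_nonneg _).trans hx₀
      gcongr
      exact integral_controlRate_le hT.le θ hL.le ht.1
    linarith
  rw [ae_restrict_iff' measurableSet_Icc] at hbF
  have hex : IsTrajectory T F θ x₀ (fun t => evolution b 0 t x₀) := by
    refine ⟨?_, hb.evolution_self 0 x₀, ?_⟩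
    · refine absolutelyContinuousOnInterval_of_dist_le (C := 1)
        ((integrable_controlRate θ C).intervalIntegrable
          |>.absolutelyContinuousOnInterval_intervalIntegral (c := 0) (by simp)) ?_
      have hki : ∀ u v, IntervalIntegrable (controlRate θ C) volume u v :=
        fun u v => hb.integrable.intervalIntegrable
      intro s hs t ht
      rw [hu] at hs ht
      rw [one_mul, dist_eq_norm, dist_comm, Real.dist_eq,
        intervalIntegral.integral_interval_sub_left (hki _ _) (hki _ _)]
      exact hb.norm_evolution_sub_evolution_le hs.1 ht.1 x₀
    · rw [ae_restrict_iff' measurableSet_Icc]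
      filter_upwards [hbF, hb.ae_hasDerivAt_evolution 0 x₀,
        Measure.ae_ne volume (0 : ℝ)] with t h1 h2 h3 ht
      rw [← h1 ht _ (mem_closedBall_zero_iff.2 (hstay t ht))]
      exact h2 (lt_of_le_of_ne ht.1 (Ne.symm h3))
  have hflow : IsTrajectory T F θ x₀ (fun t => flow T F θ t x₀) :=
    Classical.epsilon_spec (p := IsTrajectory T F θ x₀) ⟨_, hex⟩
  obtain ⟨hc, hi, heq⟩ := hflow.eq_integral hT hF
  -- Whichever trajectory was chosen, the a priori bound keeps it in the ball of radius `R'`, so it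
  -- solves the truncated equation, whose solution is unique.
  have hfl : ∀ t ∈ Icc 0 T, flow T F θ t x₀ = evolution b 0 t x₀ := fun t ht => by
    refine hb.eq_evolution ht.1 (y := fun t => flow T F θ t x₀)
      (hc.mono (Icc_subset_Icc_right ht.2)) (hi.mono_set ?_)
      (fun r hr => heq r ⟨hr.1, hr.2.trans ht.2⟩) ?_
    · rw [uIcc_of_le ht.1, hu]; exact Icc_subset_Icc_right ht.2
    · filter_upwards [hbF] with r h hr
      have hr' : r ∈ Icc 0 T := ⟨hr.1, hr.2.trans ht.2⟩
      refine (h hr' _ (mem_closedBall_zero_iff.2 ?_)).symm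
      have h1 := hflow.one_add_norm_le hT hF hL hgrowth hr'
      have h2 : (1 + ‖x₀‖) * Real.exp (L * (2 * T + ‖θ‖ ^ 2))
          ≤ (1 + R) * Real.exp (L * (2 * T + ‖θ‖ ^ 2)) := by gcongr
      linarith
  exact ⟨hflow, fun t ht => ⟨hfl t ht, (hfl t ht).symm ▸ hstay t ht⟩⟩

/-- The Cauchy–Schwarz inequality in L²([0,T]), where √T is the norm of the constant 1. It turns the
locally Lipschitz dependence of the velocity on the control into a Lipschitz bound in the L² norm.
-/
lemma integral_one_add_mul_norm_sub_le (hT : 0 ≤ T) (θ₁ θ₂ : Control T m) :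
    ∫ t in Icc 0 T, (1 + ‖θ₁ t‖ + ‖θ₂ t‖) * ‖θ₁ t - θ₂ t‖
      ≤ (√(T) + ‖θ₁‖ + ‖θ₂‖) * ‖θ₁ - θ₂‖ := by
  let one : Lp ℝ 2 (volume.restrict (Icc (0 : ℝ) T)) := indicatorConstLp 2 MeasurableSet.univ
    (by simp) (1 : ℝ)
  have hnorm : ∀ θ : Control T m, ∃ f : Lp ℝ 2 (volume.restrict (Icc (0 : ℝ) T)),
      ‖f‖ = ‖θ‖ ∧ ∀ᵐ t ∂(volume.restrict (Icc (0 : ℝ) T)), f t = ‖θ t‖ := fun θ => by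
    refine ⟨(Lp.memLp θ).norm.toLp _, ?_, MemLp.coeFn_toLp _⟩
    rw [Lp.norm_toLp, eLpNorm_norm]; rfl
  obtain ⟨f₁, hf₁, h₁⟩ := hnorm θ₁
  obtain ⟨f₂, hf₂, h₂⟩ := hnorm θ₂
  obtain ⟨g, hg, h₃⟩ := hnorm (θ₁ - θ₂)
  have hone : ‖one‖ = √T := by
    simp only [one]
    rw [norm_indicatorConstLp (by norm_num) (by norm_num)]
    simp [Measure.real, hT, Real.sqrt_eq_rpow]
  have h := real_inner_le_norm (one + f₁ + f₂) g
  rw [L2.inner_def] at h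
  calc _ = ∫ t in Icc 0 T, inner ℝ ((one + f₁ + f₂) t) (g t) := by
        refine integral_congr_ae ?_
        filter_upwards [h₁, h₂, h₃, Lp.coeFn_add (one + f₁) f₂, Lp.coeFn_add one f₁,
          Lp.coeFn_sub θ₁ θ₂, indicatorConstLp_coeFn (p := 2) (s := univ) (hs := MeasurableSet.univ)
            (hμs := (by simp : (volume.restrict (Icc (0 : ℝ) T)) univ ≠ ⊤)) (c := (1 : ℝ))]
          with t h1 h2 h3 h4 h5 h6 h7
        rw [h4, Pi.add_apply, h5, Pi.add_apply, h1, h2, h3, h6, Pi.sub_apply]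
        have : one t = 1 := by rw [h7]; simp
        rw [this]
        simp [mul_comm]
    _ ≤ _ := h
    _ ≤ (‖one‖ + ‖f₁‖ + ‖f₂‖) * ‖g‖ := by gcongr; exact norm_add₃_le
    _ = _ := by rw [hone, hf₁, hf₂, hg]

/-- The terminal value of the flow depends in a Lipschitz way on the initial datum and on the
control, uniformly on bounded sets. -/
lemma exists_lipschitz_flow (hT : 0 < T) (hF : VelocityAssumptions T F) {R : ℝ} (hR : 0 < R)
    (B : ℝ) (hB : 0 ≤ B) : ∃ M C : ℝ, 0 < M ∧ 0 < C ∧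
      (∀ θ : Control T m, ‖θ‖ ≤ B → ∀ x ∈ Metric.closedBall (0 : Vec d) R,
        ‖flow T F θ T x‖ ≤ M) ∧
      (∀ θ₁ θ₂ : Control T m, ‖θ₁‖ ≤ B → ‖θ₂‖ ≤ B →
        ∀ x ∈ Metric.closedBall (0 : Vec d) R, ∀ y ∈ Metric.closedBall (0 : Vec d) R,
        ‖flow T F θ₁ T x - flow T F θ₂ T y‖ ≤ C * (‖x - y‖ + ‖θ₁ - θ₂‖)) := by
  obtain ⟨L, hL, hgrowth⟩ := hF.linear_growth
  let M := (1 + R) * Real.exp (L * (2 * T + B ^ 2))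
  have hM : 0 < M := by positivity
  have hle : ∀ θ : Control T m, ‖θ‖ ≤ B →
      (1 + R) * Real.exp (L * (2 * T + ‖θ‖ ^ 2)) ≤ 1 + M := fun θ hθ => by
    have : (1 + R) * Real.exp (L * (2 * T + ‖θ‖ ^ 2)) ≤ M := by
      simp only [M]; gcongr
    linarith
  have htraj : ∀ θ : Control T m, ‖θ‖ ≤ B → ∀ x ∈ Metric.closedBall (0 : Vec d) R,
      IsTrajectory T F θ x (fun t => flow T F θ t x) ∧ ∀ t ∈ Icc 0 T, ‖flow T F θ t x‖ ≤ M := by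
    intro θ hθ x hx
    obtain ⟨b, C, hC, hb, hbF, hbL⟩ := hF.exists_isCaratheodory θ hM hL hgrowth
    have := isTrajectory_flow_and_eq_evolution hT hF hL hgrowth hb hbF hbL (hle θ hθ)
      (mem_closedBall_zero_iff.1 hx)
    exact ⟨this.1, fun t ht => (this.2 t ht).2⟩
  obtain ⟨L₁, hL₁, h₁⟩ := hF.lipschitz_state (M + 1) (by positivity)
  obtain ⟨L₂, hL₂, h₂⟩ := hF.lipschitz_control (M + 1) (by positivity)
  rw [ae_restrict_iff' measurableSet_Icc] at h₁ h₂
  let D := L₂ * (√T + B + B)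
  have hD : 0 ≤ D := by positivity
  refine ⟨M, (1 + D) * Real.exp (L₁ * (2 * T + B ^ 2)), hM, by positivity,
    fun θ hθ x hx => (htraj θ hθ x hx).2 T ⟨hT.le, le_rfl⟩, ?_⟩
  intro θ₁ θ₂ hθ₁ hθ₂ x hx y hy
  obtain ⟨t₁, b₁⟩ := htraj θ₁ hθ₁ x hx
  obtain ⟨t₂, b₂⟩ := htraj θ₂ hθ₂ y hy
  obtain ⟨c₁, i₁, e₁⟩ := t₁.eq_integral hT hF
  obtain ⟨c₂, i₂, e₂⟩ := t₂.eq_integral hT hF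
  -- The velocity error caused by switching controls at a common state; the error caused by
  -- different states is absorbed by the Grönwall rate.
  let e : ℝ → ℝ := (Icc 0 T).indicator
    fun t => L₂ * ((1 + ‖θ₁ t‖ + ‖θ₂ t‖) * ‖θ₁ t - θ₂ t‖)
  have hei : Integrable e := by
    refine IntegrableOn.integrable_indicator (Integrable.const_mul ?_ _) measurableSet_Icc
    have m₁ := (Lp.memLp θ₁).norm
    have m₂ := (Lp.memLp θ₂).norm
    exact (((memLp_const (1 : ℝ)).add m₁).add m₂).integrable_mul
      ((Lp.memLp θ₁).sub (Lp.memLp θ₂)).norm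
  have key := norm_sub_le_of_integral_eq (e := e) (k := controlRate θ₁ L₁) hT.le c₁ c₂ i₁ i₂
    (integrable_controlRate θ₁ L₁).intervalIntegrable hei.intervalIntegrable
    (controlRate_nonneg θ₁ hL₁.le) (fun t => indicator_nonneg (fun _ _ => by positivity) _) e₁ e₂ (by
      filter_upwards [h₁, h₂] with r h₁ h₂ hr
      rw [controlRate_eq θ₁ L₁ hr]
      simp only [e, indicator_of_mem hr]
      have m₁ : flow T F θ₁ r x ∈ Metric.ball (0 : Vec d) (M + 1) := by
        rw [mem_ball_zero_iff]; linarith [b₁ r hr]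
      have m₂ : flow T F θ₂ r y ∈ Metric.ball (0 : Vec d) (M + 1) := by
        rw [mem_ball_zero_iff]; linarith [b₂ r hr]
      refine (norm_sub_le_norm_sub_add_norm_sub _ (F r (flow T F θ₂ r y) (θ₁ r)) _).trans ?_
      refine add_le_add (h₁ hr _ _ m₁ _ m₂) ((h₂ hr _ _ _ m₂).trans (le_of_eq (by ring))))
  have he : ∫ r in 0..T, e r ≤ D * ‖θ₁ - θ₂‖ := by
    rw [intervalIntegral.integral_of_le hT.le, ← integral_Icc_eq_integral_Ioc,
      setIntegral_indicator measurableSet_Icc, inter_self, integral_const_mul]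
    simp only [D]
    rw [mul_assoc]
    gcongr
    refine (integral_one_add_mul_norm_sub_le hT.le θ₁ θ₂).trans ?_
    gcongr
  calc _ ≤ _ := key
    _ ≤ (‖x - y‖ + D * ‖θ₁ - θ₂‖) * Real.exp (L₁ * (2 * T + B ^ 2)) := by
        gcongr
        refine (integral_controlRate_le hT.le θ₁ hL₁.le hT.le).trans ?_
        gcongr
    _ ≤ ((1 + D) * (‖x - y‖ + ‖θ₁ - θ₂‖)) * Real.exp (L₁ * (2 * T + B ^ 2)) := by
        gcongr
        nlinarith [norm_nonneg (x - y), norm_nonneg (θ₁ - θ₂), mul_nonneg hD (norm_nonneg (x - y))]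
    _ = _ := by ring

end Trajectory

/-! ### Transport plans and the Wasserstein distance. -/

section Wasserstein

variable {X : Type*} [PseudoEMetricSpace X] [MeasurableSpace X]

/-- The easy half of Kantorovich duality. -/
lemma abs_integral_sub_le_mul_wasserstein {μ ν : Measure X} {g : X → ℝ} {K : NNReal}
    {S : Set X} (hg : LipschitzOnWith K g S) (hμS : ∀ᵐ x ∂μ, x ∈ S) (hνS : ∀ᵐ x ∂ν, x ∈ S)
    (hμ : Integrable g μ) (hν : Integrable g ν) (hfin : wasserstein μ ν ≠ ⊤) :
    |∫ x, g x ∂μ - ∫ x, g x ∂ν| ≤ K * (wasserstein μ ν).toReal := by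
  have key : ‖∫ x, g x ∂μ - ∫ x, g x ∂ν‖ₑ ≤ K * wasserstein μ ν := by
    -- Without plans the infimum would be `⊤`. Nonemptiness is needed to move the factor `K` inside
    -- the infimum when `K = 0`.
    have hne : Nonempty {π : Measure (X × X) // π.map Prod.fst = μ ∧ π.map Prod.snd = ν} := by
      by_contra h
      rw [not_nonempty_iff] at h
      exact hfin (iInf_of_empty _)
    rw [wasserstein, ENNReal.mul_iInf' (by simp) (fun _ => hne)]
    refine le_iInf fun ⟨π, h1, h2⟩ => ?_
    subst h1 h2
    have m1 : AEMeasurable Prod.fst π := measurable_fst.aemeasurable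
    have m2 : AEMeasurable Prod.snd π := measurable_snd.aemeasurable
    have i1 : Integrable (fun z : X × X => g z.1) π := hμ.comp_aemeasurable m1
    have i2 : Integrable (fun z : X × X => g z.2) π := hν.comp_aemeasurable m2
    rw [integral_map m1 hμ.aestronglyMeasurable, integral_map m2 hν.aestronglyMeasurable,
      ← integral_sub i1 i2]
    refine (enorm_integral_le_lintegral_enorm _).trans ?_
    rw [← lintegral_const_mul' _ _ ENNReal.coe_ne_top]
    refine lintegral_mono_ae ?_
    filter_upwards [ae_of_ae_map m1 hμS, ae_of_ae_map m2 hνS] with z hz1 hz2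
    rw [← edist_eq_enorm_sub]
    exact hg hz1 hz2
  simpa using ENNReal.toReal_mono (ENNReal.mul_ne_top ENNReal.coe_ne_top hfin) key

/-- The image of `μ` under the pair of maps is an admissible plan. It yields time continuity of
transported measures. -/
lemma wasserstein_map_le {Y : Type*} [MeasurableSpace Y] {μ : Measure Y} {f g : Y → X}
    (hf : Measurable f) (hg : Measurable g) (hm : Measurable fun z : X × X => edist z.1 z.2) :
    wasserstein (μ.map f) (μ.map g) ≤ ∫⁻ y, edist (f y) (g y) ∂μ := by
  have h1 : (μ.map fun y => (f y, g y)).map Prod.fst = μ.map f :=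
    Measure.map_map measurable_fst (hf.prodMk hg)
  have h2 : (μ.map fun y => (f y, g y)).map Prod.snd = μ.map g :=
    Measure.map_map measurable_snd (hf.prodMk hg)
  exact (iInf_le _ ⟨μ.map fun y => (f y, g y), h1, h2⟩).trans (lintegral_map hm (hf.prodMk hg)).le

lemma wasserstein_ne_top {μ ν : Measure X} [IsProbabilityMeasure μ] [IsProbabilityMeasure ν]
    {D : NNReal} {S : Set X} (hS : ∀ x ∈ S, ∀ y ∈ S, edist x y ≤ D)
    (hμS : ∀ᵐ x ∂μ, x ∈ S) (hνS : ∀ᵐ x ∂ν, x ∈ S) : wasserstein μ ν ≠ ⊤ := by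
  refine ne_top_of_le_ne_top (ENNReal.coe_ne_top (r := D)) ?_
  refine (iInf_le _ ⟨μ.prod ν, by simp, by simp⟩).trans ?_
  have : ∀ᵐ z ∂(μ.prod ν), edist z.1 z.2 ≤ D := by
    have h1 : ∀ᵐ z ∂(μ.prod ν), z.1 ∈ S := Measure.quasiMeasurePreserving_fst.ae hμS
    have h2 : ∀ᵐ z ∂(μ.prod ν), z.2 ∈ S := Measure.quasiMeasurePreserving_snd.ae hνS
    filter_upwards [h1, h2] with z h1 h2 using hS _ h1 _ h2
  calc _ ≤ ∫⁻ _, D ∂(μ.prod ν) := lintegral_mono_ae this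
    _ = D := by simp

end Wasserstein

/-! ### Existence: transport along the evolution solves the continuity equation. -/

section DataSpace

variable {d : ℕ}

lemma measurable_fst_data : Measurable fun z : DataSpace d => z.fst := by fun_prop

lemma norm_data_fst_le (z : DataSpace d) : ‖z.fst‖ ≤ ‖z‖ := WithLp.norm_fst_le _ z

lemma norm_data_snd_le (z : DataSpace d) : ‖z.snd‖ ≤ ‖z‖ := WithLp.norm_snd_le _ z

lemma norm_le_fst_add_snd (z : DataSpace d) : ‖z‖ ≤ ‖z.fst‖ + ‖z.snd‖ := by
  rw [WithLp.prod_norm_eq_of_L2]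
  refine (Real.sqrt_le_sqrt (y := (‖z.fst‖ + ‖z.snd‖) ^ 2) ?_).trans
    (Real.sqrt_sq (by positivity)).le
  nlinarith [norm_nonneg z.fst, norm_nonneg z.snd, mul_nonneg (norm_nonneg z.fst) (norm_nonneg z.snd)]

/-- The transport of the data by the flow, which does not move the labels. -/
def transport (Φ : Vec d → Vec d) (z : DataSpace d) : DataSpace d := WithLp.toLp 2 (Φ z.fst, z.snd)

lemma continuous_transport {Φ : Vec d → Vec d} (hΦ : Continuous Φ) : Continuous (transport Φ) := by
  unfold transport
  fun_prop

lemma edist_transport (Φ Ψ : Vec d → Vec d) (z : DataSpace d) :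
    edist (transport Φ z) (transport Ψ z) = ENNReal.ofReal ‖Φ z.fst - Ψ z.fst‖ := by
  rw [edist_dist, dist_eq_norm, WithLp.prod_norm_eq_of_L2]
  simp [transport]

variable {m : ℕ} {T : ℝ} {F : ℝ → Vec d → Vec m → Vec d}

lemma deriv_comp_prodMk_left {P : Type*} [NormedAddCommGroup P] [NormedSpace ℝ P] {ψ : ℝ × P → ℝ}
    (hψ : Differentiable ℝ ψ) (t : ℝ) (p : P) :
    deriv (fun s => ψ (s, p)) t = fderiv ℝ ψ (t, p) (1, 0) := by
  have h1 : HasDerivAt (fun s : ℝ => (s, p)) ((1 : ℝ), (0 : P)) t :=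
    (hasDerivAt_id t).prodMk (hasDerivAt_const t p)
  exact ((hψ (t, p)).hasFDerivAt.comp_hasDerivAt t h1).deriv

lemma fderiv_comp_mid {P Q S : Type*} [NormedAddCommGroup P] [NormedSpace ℝ P]
    [NormedAddCommGroup Q] [NormedSpace ℝ Q] [NormedAddCommGroup S] [NormedSpace ℝ S]
    {ψ : S × P × Q → ℝ} (hψ : Differentiable ℝ ψ) (t : S) (x : P) (y : Q) (v : P) :
    fderiv ℝ (fun x => ψ (t, x, y)) x v = fderiv ℝ ψ (t, x, y) (0, v, 0) := by
  have h1 : HasFDerivAt (fun x : P => (t, x, y))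
      ((0 : P →L[ℝ] S).prod ((ContinuousLinearMap.id ℝ P).prod (0 : P →L[ℝ] Q))) x :=
    (hasFDerivAt_const t x).prodMk ((hasFDerivAt_id x).prodMk (hasFDerivAt_const y x))
  have h2 := ((hψ (t, x, y)).hasFDerivAt.comp x h1).fderiv
  have h3 : (fun x => ψ (t, x, y)) = ψ ∘ fun x => (t, x, y) := rfl
  rw [h3, h2]; rfl

/-- The transported measures form a weak solution. -/
lemma isWeakSolution_transport (hT : 0 < T) {θ : Control T m} {R R' C : ℝ}
    {b : ℝ → Vec d → Vec d} (hb : IsCaratheodory b (controlRate θ C))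
    (hbF : ∀ᵐ t ∂(volume.restrict (Icc (0 : ℝ) T)), ∀ x ∈ Metric.closedBall 0 R',
        b t x = F t x (θ t))
    (hstay : ∀ t ∈ Icc 0 T, ∀ x ∈ Metric.closedBall (0 : Vec d) R,
      evolution b 0 t x ∈ Metric.closedBall (0 : Vec d) R')
    {μ₀ : Measure (DataSpace d)} [IsProbabilityMeasure μ₀]
    (hμ₀ : ∀ᵐ z ∂μ₀, z ∈ Metric.closedBall 0 R) :
    IsWeakSolution T F θ μ₀ (fun t => μ₀.map (transport (evolution b 0 t))) := by
  have hkc : Continuous fun p : ℝ × ℝ => ∫ r in p.1..p.2, controlRate θ C r := by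
    have hki : ∀ u v, IntervalIntegrable (controlRate θ C) volume u v :=
      fun u v => hb.integrable.intervalIntegrable
    have h1 := intervalIntegral.continuous_primitive hki 0
    have : (fun p : ℝ × ℝ => ∫ r in p.1..p.2, controlRate θ C r)
        = fun p => (∫ r in 0..p.2, controlRate θ C r) - ∫ r in 0..p.1, controlRate θ C r := by
      ext p; rw [intervalIntegral.integral_interval_sub_left (hki _ _) (hki _ _)]
    rw [this]
    exact (h1.comp continuous_snd).sub (h1.comp continuous_fst)
  have hcont : ∀ t ∈ Icc 0 T, Continuous (transport (evolution b 0 t)) := fun t ht =>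
    continuous_transport (hb.continuous_evolution_right ht.1)
  refine ⟨fun t ht => Measure.isProbabilityMeasure_map (hcont t ht).measurable.aemeasurable,
    fun t ht => ?_, fun t ht => ?_, ?_, ?_⟩
  · refine (isCompact_closedBall (0 : DataSpace d) (R' + R)).of_isClosed_subset
      Measure.isClosed_support (Measure.support_subset_of_isClosed Metric.isClosed_closedBall ?_)
    refine (ae_map_iff (hcont t ht).measurable.aemeasurable
      Metric.isClosed_closedBall.measurableSet).2 ?_
    filter_upwards [hμ₀] with z hz
    rw [mem_closedBall_zero_iff] at hz
    refine mem_closedBall_zero_iff.2 ((norm_le_fst_add_snd _).trans (add_le_add ?_ ((norm_data_snd_le z).trans hz)))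
    exact mem_closedBall_zero_iff.1 (hstay t ht _ (mem_closedBall_zero_iff.2 ((norm_data_fst_le z).trans hz)))
  · have hlim : Tendsto (fun s => ENNReal.ofReal |∫ r in s..t, controlRate θ C r|)
        (𝓝[Icc 0 T] t) (𝓝 0) := by
      have : Continuous fun s => ENNReal.ofReal |∫ r in s..t, controlRate θ C r| :=
        ENNReal.continuous_ofReal.comp (hkc.comp (Continuous.prodMk_left t)).abs
      have h2 := this.tendsto t
      rw [intervalIntegral.integral_same, abs_zero, ENNReal.ofReal_zero] at h2
      exact h2.mono_left nhdsWithin_le_nhds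
    refine tendsto_of_tendsto_of_tendsto_of_le_of_le' tendsto_const_nhds hlim
      (Eventually.of_forall fun _ => bot_le) ?_
    filter_upwards [self_mem_nhdsWithin] with s hs
    refine (wasserstein_map_le (hcont s hs).measurable (hcont t ht).measurable
      measurable_edist).trans ?_
    calc _ ≤ ∫⁻ _, ENNReal.ofReal |∫ r in s..t, controlRate θ C r| ∂μ₀ := by
          refine lintegral_mono fun z => ?_
          rw [edist_transport]
          exact ENNReal.ofReal_le_ofReal (hb.norm_evolution_sub_evolution_le hs.1 ht.1 _)
      _ = _ := by simp
  · have : transport (evolution b 0 0) = id := by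
      ext1 z; simp only [transport, hb.evolution_self]; rfl
    simp only [this, Measure.map_id]
  · intro ψ hψ hψc hψs
    have hψd : Differentiable ℝ ψ := hψ.differentiable one_ne_zero
    have hψ' : Continuous (fderiv ℝ ψ) := hψ.continuous_fderiv one_ne_zero
    have hΨ : Continuous fun q : (ℝ × Vec d × Vec d) × Vec d => fderiv ℝ ψ q.1 (1, q.2, 0) :=
      (hψ'.comp continuous_fst).clm_apply (by fun_prop)
    obtain ⟨M, hM⟩ := hψ'.bounded_above_of_compact_support (hψc.fderiv ℝ)
    obtain ⟨K, hK⟩ := ContDiff.lipschitzWith_of_hasCompactSupport hψc hψ one_ne_zero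
    -- The derivative of the test function along the characteristic through `z`. The `max` only
    -- secures joint measurability and is invisible on [0,T].
    let h : ℝ → DataSpace d → ℝ := fun t z => fderiv ℝ ψ (t, evolution b 0 (max 0 t) z.fst, z.snd)
      (1, b t (evolution b 0 (max 0 t) z.fst), 0)
    have hhm : Measurable (Function.uncurry h) := by
      have e1 : Measurable fun p : ℝ × DataSpace d => evolution b 0 (max 0 p.1) p.2.fst :=
        (hb.measurable_evolution 0).comp
          (measurable_fst.prodMk (measurable_fst_data.comp measurable_snd))
      have e2 : Measurable fun p : ℝ × DataSpace d => b p.1 (evolution b 0 (max 0 p.1) p.2.fst) :=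
        hb.measurable.comp (measurable_fst.prodMk e1)
      exact hΨ.measurable.comp
        ((measurable_fst.prodMk (e1.prodMk (by fun_prop : Measurable fun p : ℝ × DataSpace d =>
          p.2.snd))).prodMk e2)
    have hhb : ∀ t z, ‖h t z‖ ≤ M * (1 + controlRate θ C t) := fun t z => by
      refine (ContinuousLinearMap.le_opNorm _ _).trans ?_
      have hk := hb.nonneg t
      have hM0 : 0 ≤ M := (norm_nonneg _).trans (hM 0)
      gcongr
      · exact hM _
      · refine max_le (by simp [hk]) (max_le ((hb.bound t _).trans (by linarith)) (by simp; linarith))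
    have step1 : ∀ᵐ t, t ∈ Ioc 0 T → ∫ z : DataSpace d,
        (deriv (fun s => ψ (s, z.fst, z.snd)) t
          + fderiv ℝ (fun x => ψ (t, x, z.snd)) z.fst (F t z.fst (θ t)))
          ∂(μ₀.map (transport (evolution b 0 t))) = ∫ z, h t z ∂μ₀ := by
      rw [ae_restrict_iff' measurableSet_Icc] at hbF
      filter_upwards [hbF] with t hbt ht
      have ht' : t ∈ Icc 0 T := Ioc_subset_Icc_self ht
      have e0 : ∀ᵐ z ∂(μ₀.map (transport (evolution b 0 t))),
          z ∈ {z : DataSpace d | z.fst ∈ Metric.closedBall (0 : Vec d) R'} := by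
        refine (ae_map_iff (hcont t ht').measurable.aemeasurable ?_).2 ?_
        · exact (Metric.isClosed_closedBall.preimage (by fun_prop :
            Continuous fun z : DataSpace d => z.fst)).measurableSet
        filter_upwards [hμ₀] with z hz
        rw [mem_closedBall_zero_iff] at hz
        exact hstay t ht' _ (mem_closedBall_zero_iff.2 ((norm_data_fst_le z).trans hz))
      have e1 : ∫ z : DataSpace d, (deriv (fun s => ψ (s, z.fst, z.snd)) t
          + fderiv ℝ (fun x => ψ (t, x, z.snd)) z.fst (F t z.fst (θ t)))
          ∂(μ₀.map (transport (evolution b 0 t)))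
          = ∫ z : DataSpace d, fderiv ℝ ψ (t, z.fst, z.snd) (1, b t z.fst, 0)
          ∂(μ₀.map (transport (evolution b 0 t))) := by
        refine integral_congr_ae ?_
        filter_upwards [e0] with z hz
        rw [deriv_comp_prodMk_left hψd, fderiv_comp_mid hψd, ← map_add, hbt ht' _ hz]
        simp
      have hm : Measurable fun z : DataSpace d => fderiv ℝ ψ (t, z.fst, z.snd) (1, b t z.fst, 0) := by
        have e2 : Measurable fun z : DataSpace d => b t z.fst :=
          hb.measurable.comp (measurable_const.prodMk measurable_fst_data)
        exact hΨ.measurable.comp ((measurable_const.prodMk (measurable_fst_data.prodMk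
          (by fun_prop : Measurable fun z : DataSpace d => z.snd))).prodMk e2)
      rw [e1, integral_map (hcont t ht').measurable.aemeasurable hm.aestronglyMeasurable]
      simp only [h, max_eq_right ht'.1]
      rfl
    -- Along one characteristic the integral is the difference of the endpoint values of `ψ`, which
    -- vanish since `ψ` is supported in the open time interval. Fubini's theorem then integrates
    -- over the data.
    have step2 : ∀ z, ∫ t in 0..T, h t z = 0 := fun z => by
      have hAC : AbsolutelyContinuousOnInterval (fun t => ψ (t, evolution b 0 t z.fst, z.snd)) 0 T := by
        have hi : Integrable (fun t => controlRate θ C t) := hb.integrable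
        have hi1 : ∀ u v, IntervalIntegrable (fun t => 1 + controlRate θ C t) volume u v :=
          fun u v => intervalIntegrable_const.add hi.intervalIntegrable
        refine absolutelyContinuousOnInterval_of_dist_le (C := K)
          ((hi1 0 T).absolutelyContinuousOnInterval_intervalIntegral (c := 0) (by simp)) ?_
        intro s hs t ht
        rw [uIcc_of_le hT.le] at hs ht
        refine (hK.dist_le_mul _ _).trans ?_
        gcongr
        wlog hst : s ≤ t generalizing s t with H
        · rw [dist_comm, dist_comm (∫ v in 0..s, _)]; exact H t ht s hs (le_of_not_ge hst)
        have hk0 : 0 ≤ ∫ r in s..t, controlRate θ C r :=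
          intervalIntegral.integral_nonneg hst fun r _ => hb.nonneg r
        have e := hb.norm_evolution_sub_evolution_le hs.1 ht.1 z.fst
        rw [abs_of_nonneg hk0] at e
        rw [dist_comm (∫ v in 0..s, _), Real.dist_eq,
          intervalIntegral.integral_interval_sub_left (hi1 _ _) (hi1 _ _),
          intervalIntegral.integral_add intervalIntegrable_const hi.intervalIntegrable]
        simp only [intervalIntegral.integral_const, smul_eq_mul, mul_one]
        rw [abs_of_nonneg (by linarith), Prod.dist_eq, Prod.dist_eq, dist_self, Real.dist_eq,
          abs_sub_comm, abs_of_nonneg (sub_nonneg.2 hst), dist_eq_norm]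
        exact max_le (by linarith) (max_le (by linarith) (by linarith))
      have hz : ∀ t, t ∉ Ioo 0 T → ∀ p, ψ (t, p) = 0 := fun t ht p => by
        refine image_eq_zero_of_notMem_tsupport fun hmem => ht (hψs hmem).1
      have h3 := hAC.integral_deriv_eq_sub
      rw [hz T (by simp), hz 0 (by simp), sub_zero] at h3
      refine Eq.trans ?_ h3
      refine intervalIntegral.integral_congr_ae ?_
      filter_upwards [hb.ae_hasDerivAt_evolution 0 z.fst] with t ht htT
      rw [uIoc_of_le hT.le] at htT
      have d1 : HasDerivAt (fun t : ℝ => (t, evolution b 0 t z.fst, z.snd))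
          ((1 : ℝ), b t (evolution b 0 t z.fst), (0 : Vec d)) t :=
        (hasDerivAt_id t).prodMk ((ht htT.1).prodMk (hasDerivAt_const t z.snd))
      have d2 := ((hψd _).hasFDerivAt.comp_hasDerivAt t d1).deriv
      simp only [h, max_eq_right htT.1.le]
      exact d2.symm
    rw [intervalIntegral.integral_of_le hT.le]
    calc _ = ∫ t in Ioc 0 T, ∫ z, h t z ∂μ₀ :=
          setIntegral_congr_ae measurableSet_Ioc step1
      _ = ∫ z, (∫ t in Ioc 0 T, h t z) ∂μ₀ := by
          refine integral_integral_swap ?_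
          have hdom : Integrable (fun p : ℝ × DataSpace d => M * (1 + controlRate θ C p.1))
              ((volume.restrict (Ioc 0 T)).prod μ₀) := by
            have : Integrable (fun t => M * (1 + controlRate θ C t)) (volume.restrict (Ioc 0 T)) :=
              ((integrable_const 1).add hb.integrable.restrict).const_mul M
            exact this.comp_fst μ₀
          exact hdom.mono' hhm.aestronglyMeasurable (ae_of_all _ fun p => hhb p.1 p.2)
      _ = 0 := by
          simp_rw [← intervalIntegral.integral_of_le hT.le, step2, integral_zero]

end DataSpace

/-! ### Weak derivatives in time and regularity of measure-valued curves. -/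

/-- The lemma of du Bois-Reymond, in the form of an integrated weak derivative. -/
lemma eq_add_integral_of_forall_integral_deriv_mul {T : ℝ} (hT : 0 < T) {m q : ℝ → ℝ}
    (hm : ContinuousOn m (Icc 0 T)) (hq : IntervalIntegrable q volume 0 T)
    (h : ∀ χ : ℝ → ℝ, ContDiff ℝ 1 χ → HasCompactSupport χ → tsupport χ ⊆ Ioo 0 T →
      ∫ t in 0..T, (deriv χ t * m t + χ t * q t) = 0) :
    ∀ t ∈ Icc 0 T, m t = m 0 + ∫ r in 0..t, q r := by
  have hu : uIcc 0 T = Icc 0 T := uIcc_of_le hT.le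
  let Q : ℝ → ℝ := fun t => ∫ r in 0..t, q r
  have hQ : AbsolutelyContinuousOnInterval Q 0 T :=
    hq.absolutelyContinuousOnInterval_intervalIntegral (by simp)
  have hQc : ContinuousOn Q (Icc 0 T) := hu ▸ hQ.continuousOn
  let W : ℝ → ℝ := fun t => m t - Q t
  have hWc : ContinuousOn W (Icc 0 T) := hm.sub hQc
  have hW : ∀ χ : ℝ → ℝ, ContDiff ℝ 1 χ → HasCompactSupport χ → tsupport χ ⊆ Ioo 0 T →
      ∫ t in 0..T, deriv χ t * W t = 0 := fun χ hχ hχc hχs => by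
    have hχT : χ T = 0 := image_eq_zero_of_notMem_tsupport fun h' => (hχs h').2.ne rfl
    have hd : Continuous (deriv χ) := hχ.continuous_deriv le_rfl
    have i1 : IntervalIntegrable (fun t => deriv χ t * m t) volume 0 T :=
      (hd.continuousOn.mul (hu ▸ hm)).intervalIntegrable
    have i2 : IntervalIntegrable (fun t => Q t * deriv χ t) volume 0 T :=
      ((hu ▸ hQc : ContinuousOn Q (uIcc 0 T)).mul hd.continuousOn).intervalIntegrable
    have i3 : IntervalIntegrable (fun t => χ t * q t) volume 0 T :=
      hq.continuousOn_mul hχ.continuous.continuousOn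
    have e1 := hQ.integral_mul_deriv_eq_deriv_mul
      (hχ.contDiffOn.absolutelyContinuousOnInterval : AbsolutelyContinuousOnInterval χ 0 T)
    have e2 : ∫ t in 0..T, deriv Q t * χ t = ∫ t in 0..T, χ t * q t := by
      refine intervalIntegral.integral_congr_ae ?_
      filter_upwards [hq.ae_hasDerivAt_integral] with t ht htT
      rw [(ht (uIoc_subset_uIcc htT) 0 (by simp)).deriv, mul_comm]
    have e3 := h χ hχ hχc hχs
    rw [intervalIntegral.integral_add i1 i3] at e3
    have e4 : ∫ t in 0..T, deriv χ t * W t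
        = (∫ t in 0..T, deriv χ t * m t) - ∫ t in 0..T, Q t * deriv χ t := by
      rw [← intervalIntegral.integral_sub i1 i2]
      refine intervalIntegral.integral_congr fun t _ => ?_
      simp only [W]; ring
    have hQ0 : Q 0 = 0 := by simp [Q]
    rw [e2, hχT, hQ0] at e1
    rw [e4, e1]; linarith
  -- Its normalization has integral 1 and support inside (0,T). Subtracting a multiple of it from a
  -- test function gives mean zero, so the primitive is again a compactly supported test function.
  let φ : ContDiffBump (T / 2) := ⟨T / 8, T / 4, by positivity, by linarith⟩
  let g₀ : ℝ → ℝ := φ.normed volume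
  have hg₀ : ContDiff ℝ 1 g₀ := φ.contDiff_normed (n := 1)
  have hg₀s : tsupport g₀ ⊆ Ioo 0 T := by
    simp only [g₀]
    rw [φ.tsupport_normed_eq, Real.closedBall_eq_Icc]
    intro t ht
    have e : φ.rOut = T / 4 := rfl
    rw [e] at ht
    exact ⟨by linarith [ht.1], by linarith [ht.2]⟩
  have hsupp : ∀ f : ℝ → ℝ, tsupport f ⊆ Ioo 0 T → ∫ t in 0..T, f t = ∫ t, f t := fun f hf =>
    intervalIntegral.integral_eq_integral_of_support_subset
      ((subset_tsupport f).trans (hf.trans Ioo_subset_Ioc_self))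
  have hg₀1 : ∫ t in 0..T, g₀ t = 1 := by rw [hsupp g₀ hg₀s]; exact φ.integral_normed
  let c : ℝ := ∫ t in 0..T, g₀ t * W t
  have hmain : ∀ g : ℝ → ℝ, ContDiff ℝ 1 g → HasCompactSupport g → tsupport g ⊆ Ioo 0 T →
      ∫ t, g t • (W t - c) = 0 := fun g hg hgc hgs => by
    let γ : ℝ := ∫ t in 0..T, g t
    let G : ℝ → ℝ := fun t => g t - γ * g₀ t
    have hGc : Continuous G := hg.continuous.sub (continuous_const.mul hg₀.continuous)
    let χ : ℝ → ℝ := fun t => ∫ r in 0..t, G r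
    have hχd : ∀ t, HasDerivAt χ (G t) t := fun t =>
      intervalIntegral.integral_hasDerivAt_right (hGc.intervalIntegrable _ _)
        (hGc.stronglyMeasurableAtFilter _ _) hGc.continuousAt
    have hχ' : deriv χ = G := funext fun t => (hχd t).deriv
    have hχ : ContDiff ℝ 1 χ := by
      rw [contDiff_one_iff_deriv]
      exact ⟨fun t => (hχd t).differentiableAt, hχ' ▸ hGc⟩
    have hK : IsCompact (tsupport g ∪ tsupport g₀) :=
      hgc.isCompact.union φ.hasCompactSupport_normed.isCompact
    -- The bump keeps the union nonempty even for `g = 0`, so its least and greatest elements exist;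
    -- the primitive is supported between them.
    have hKne : (tsupport g ∪ tsupport g₀).Nonempty := by
      refine ⟨T / 2, Or.inr ?_⟩
      simp only [g₀]
      rw [φ.tsupport_normed_eq]
      exact Metric.mem_closedBall_self φ.rOut_pos.le
    obtain ⟨a, haK, ha⟩ := hK.exists_isLeast hKne
    obtain ⟨b, hbK, hb⟩ := hK.exists_isGreatest hKne
    have haT : a ∈ Ioo 0 T := union_subset hgs hg₀s haK
    have hbT : b ∈ Ioo 0 T := union_subset hgs hg₀s hbK
    have hGz : ∀ t, t ∉ Icc a b → G t = 0 := fun t ht => by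
      have ht' : t ∉ tsupport g ∪ tsupport g₀ := fun h' => ht ⟨ha h', hb h'⟩
      rw [mem_union, not_or] at ht'
      simp only [G, image_eq_zero_of_notMem_tsupport ht'.1, image_eq_zero_of_notMem_tsupport ht'.2]
      ring
    have hχT : ∫ r in 0..T, G r = 0 := by
      simp only [G]
      have i2 : IntervalIntegrable (fun t => γ * g₀ t) volume 0 T :=
        (continuous_const.mul hg₀.continuous).intervalIntegrable _ _
      rw [intervalIntegral.integral_sub (hg.continuous.intervalIntegrable _ _) i2,
        intervalIntegral.integral_const_mul, hg₀1]
      simp [γ]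
    have hχz : ∀ t, t ∉ Icc a b → χ t = 0 := fun t ht => by
      rcases lt_or_ge t a with h1 | h1
      · refine intervalIntegral.integral_zero_ae (ae_of_all _ fun r hr => hGz r fun hr' => ?_)
        rw [uIoc, mem_Ioc, le_max_iff] at hr
        rcases hr.2 with h2 | h2
        · linarith [hr'.1, haT.1]
        · linarith [hr'.1]
      · have h2 : b < t := by
          by_contra h3
          exact ht ⟨h1, not_lt.1 h3⟩
        have e : χ t = (∫ r in 0..T, G r) + ∫ r in T..t, G r :=
          (intervalIntegral.integral_add_adjacent_intervals (hGc.intervalIntegrable _ _)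
            (hGc.intervalIntegrable _ _)).symm
        rw [e, hχT, zero_add]
        refine intervalIntegral.integral_zero_ae (ae_of_all _ fun r hr => hGz r fun hr' => ?_)
        rw [uIoc, mem_Ioc, min_lt_iff] at hr
        rcases hr.1 with h2 | h2
        · linarith [hr'.2, hbT.2]
        · linarith [hr'.2]
    have hχs : tsupport χ ⊆ Icc a b :=
      closure_minimal (fun t ht => by by_contra h'; exact ht (hχz t h')) isClosed_Icc
    have hχc : HasCompactSupport χ := isCompact_Icc.of_isClosed_subset (isClosed_tsupport _) hχs
    have h0 := hW χ hχ hχc (hχs.trans fun t ht => ⟨haT.1.trans_le ht.1, ht.2.trans_lt hbT.2⟩)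
    rw [hχ'] at h0
    have hWu : ContinuousOn W (uIcc 0 T) := hu ▸ hWc
    have i1 : IntervalIntegrable (fun t => g t * W t) volume 0 T :=
      (hg.continuous.continuousOn.mul hWu).intervalIntegrable
    have i2 : IntervalIntegrable (fun t => γ * (g₀ t * W t)) volume 0 T :=
      (continuousOn_const.mul (hg₀.continuous.continuousOn.mul hWu)).intervalIntegrable
    have i3 : IntervalIntegrable (fun t => g t * c) volume 0 T :=
      (hg.continuous.mul continuous_const).intervalIntegrable _ _
    have e1 : ∫ t in 0..T, G t * W t = (∫ t in 0..T, g t * W t) - γ * c := by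
      simp only [c]
      rw [← intervalIntegral.integral_const_mul, ← intervalIntegral.integral_sub i1 i2]
      refine intervalIntegral.integral_congr fun t _ => ?_
      simp only [G]; ring
    have hgs' : tsupport (fun t => g t • (W t - c)) ⊆ Ioo 0 T :=
      (closure_mono (Function.support_smul_subset_left g _)).trans hgs
    rw [← hsupp _ hgs']
    simp only [smul_eq_mul, mul_sub]
    rw [intervalIntegral.integral_sub i1 i3, intervalIntegral.integral_mul_const]
    rw [e1] at h0
    exact h0
  have hae := isOpen_Ioo.ae_eq_zero_of_integral_contDiff_smul_eq_zero (U := Ioo 0 T)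
    (f := fun t => W t - c) (μ := volume)
    (((hWc.mono Ioo_subset_Icc_self).sub continuousOn_const).locallyIntegrableOn measurableSet_Ioo)
    (fun g hg hgc hgs => hmain g (hg.of_le (by exact_mod_cast le_top)) hgc hgs)
  have heq : EqOn W (fun _ => c) (Icc 0 T) := by
    refine Measure.eqOn_Icc_of_ae_eq volume hT.ne ?_ hWc continuousOn_const
    rw [Filter.EventuallyEq, ← restrict_Ioo_eq_restrict_Icc, ae_restrict_iff' measurableSet_Ioo]
    filter_upwards [hae] with t ht h'
    exact sub_eq_zero.1 (ht h')
  intro t ht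
  have e1 := heq ht
  have e2 := heq (⟨le_rfl, hT.le⟩ : (0 : ℝ) ∈ Icc 0 T)
  simp only [W, Q, intervalIntegral.integral_same, sub_zero] at e1 e2
  linarith

/-- A curve of probability measures on `[0,T]` that is continuous when tested against bounded
Lipschitz functions, uniformly in the Lipschitz constant. -/
structure IsRegularCurve {P : Type*} [PseudoMetricSpace P] [MeasurableSpace P] (T : ℝ)
    (ν : ℝ → Measure P) : Prop where
  prob : ∀ t ∈ Icc (0 : ℝ) T, IsProbabilityMeasure (ν t)
  continuous : ∀ t ∈ Icc (0 : ℝ) T, ∀ ε > 0, ∀ᶠ s in 𝓝[Icc (0 : ℝ) T] t,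
    ∀ (g : P → ℝ) (K : NNReal) (C : ℝ), LipschitzWith K g → (∀ p, |g p| ≤ C) →
      |∫ p, g p ∂(ν s) - ∫ p, g p ∂(ν t)| ≤ K * ε

namespace IsRegularCurve

variable {P : Type*} [PseudoMetricSpace P] [MeasurableSpace P] {T : ℝ} {ν : ℝ → Measure P}

lemma continuousOn_integral (hν : IsRegularCurve T ν) {g : P → ℝ} {K : NNReal} {C : ℝ}
    (hg : LipschitzWith K g) (hgC : ∀ p, |g p| ≤ C) :
    ContinuousOn (fun t => ∫ p, g p ∂(ν t)) (Icc 0 T) := by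
  intro t ht
  rw [ContinuousWithinAt, Metric.tendsto_nhds]
  intro ε hε
  have hK : (0 : ℝ) < K + 1 := by positivity
  filter_upwards [hν.continuous t ht (ε / (K + 1)) (by positivity)] with s hs
  rw [Real.dist_eq]
  refine (hs g K C hg hgC).trans_lt ?_
  rw [mul_div_assoc', div_lt_iff₀ hK]
  nlinarith

/-- Closed sets form a generating π-system, and their indicators are limits of Lipschitz thickened
indicators, whose integrals are continuous in time. `projIcc` extends the curve to all times, so
that it can be used as a Markov kernel. -/
lemma measurable [BorelSpace P] (hT : 0 ≤ T) (hν : IsRegularCurve T ν) :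
    Measurable fun t => ν (projIcc 0 T hT t) := by
  have hprob : ∀ t, IsProbabilityMeasure (ν (projIcc 0 T hT t)) :=
    fun t => hν.prob _ (projIcc 0 T hT t).2
  refine Measurable.measure_of_isPiSystem_of_isProbabilityMeasure
    (BorelSpace.measurable_eq.trans borel_eq_generateFrom_isClosed) isPiSystem_isClosed fun S hS => ?_
  have hreal : Measurable fun t => (ν (projIcc 0 T hT t)).real S := by
    have hδ : ∀ n : ℕ, 0 < 1 / ((n : ℝ) + 1) := fun n => Nat.one_div_pos_of_nat
    refine measurable_of_tendsto_metrizable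
      (f := fun (n : ℕ) t => ∫ p, (thickenedIndicator (hδ n) S p : ℝ) ∂(ν (projIcc 0 T hT t)))
      (fun n => ?_) (tendsto_pi_nhds.2 fun t =>
        tendsto_integral_thickenedIndicator_of_isClosed _ hS hδ tendsto_one_div_add_atTop_nhds_zero_nat)
    have h1 : LipschitzWith (1 / ((n : ℝ) + 1)).toNNReal⁻¹
        fun p => (thickenedIndicator (hδ n) S p : ℝ) := by
      rw [← one_mul (1 / ((n : ℝ) + 1)).toNNReal⁻¹]
      exact NNReal.isometry_coe.lipschitz.comp (lipschitzWith_thickenedIndicator (hδ n) S)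
    have h2 := hν.continuousOn_integral h1 (C := 1) fun p => by
      rw [NNReal.abs_eq]; exact_mod_cast thickenedIndicator_le_one (hδ n) S p
    have h3 : Continuous fun t => ∫ p, (thickenedIndicator (hδ n) S p : ℝ) ∂(ν (projIcc 0 T hT t)) :=
      h2.comp_continuous (continuous_subtype_val.comp continuous_projIcc)
        fun t => (projIcc 0 T hT t).2
    exact h3.measurable
  have : (fun t => ν (projIcc 0 T hT t) S)
      = fun t => ENNReal.ofReal ((ν (projIcc 0 T hT t)).real S) := by
    ext t; rw [ofReal_measureReal]
  rw [this]
  exact hreal.ennreal_ofReal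

lemma aestronglyMeasurable_integral [BorelSpace P] (hT : 0 ≤ T) (hν : IsRegularCurve T ν)
    {f : ℝ → P → ℝ} (hf : Measurable (Function.uncurry f)) :
    AEStronglyMeasurable (fun t => ∫ p, f t p ∂(ν t)) (volume.restrict (Icc 0 T)) := by
  let κ : ProbabilityTheory.Kernel ℝ P := ⟨fun t => ν (projIcc 0 T hT t), hν.measurable hT⟩
  have hκ : ProbabilityTheory.IsMarkovKernel κ := ⟨fun t => hν.prob _ (projIcc 0 T hT t).2⟩
  have h1 : StronglyMeasurable fun t => ∫ p, f t p ∂(κ t) :=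
    hf.stronglyMeasurable.integral_kernel_prod_right
  refine h1.aestronglyMeasurable.congr ?_
  filter_upwards [ae_restrict_mem measurableSet_Icc] with t ht
  have : κ t = ν t := by
    change ν (projIcc 0 T hT t) = ν t
    rw [projIcc_of_mem hT ht]
  rw [this]

end IsRegularCurve

lemma abs_integral_le_of_abs_le {X : Type*} [MeasurableSpace X] {μ : Measure X}
    [IsProbabilityMeasure μ] {f : X → ℝ} {c : ℝ} (h : ∀ x, |f x| ≤ c) : |∫ x, f x ∂μ| ≤ c := by
  simpa using norm_integral_le_of_norm_le_const (μ := μ) (f := f) (C := c) (ae_of_all _ h)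

/-! ### Mollification of Lipschitz functions. -/

section Mollifier

variable {P : Type*} [NormedAddCommGroup P] [MeasureSpace P] [BorelSpace P] [(volume : Measure P).IsAddHaarMeasure]

/-- A mollifier supported in the ball of radius `ε`. -/
structure IsMollifier (ε : ℝ) (η : P → ℝ) : Prop where
  continuous : Continuous η
  nonneg : ∀ z, 0 ≤ η z
  integral_eq_one : ∫ z, η z = 1
  hasCompactSupport : HasCompactSupport η
  eq_zero : ∀ z, ε ≤ ‖z‖ → η z = 0

/-- The mollification of `u`. -/
def mollify (η u : P → ℝ) (p : P) : ℝ := ∫ z, η z * u (p - z)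

/-- C² regularity is required because the short-time estimate uses a Lipschitz gradient. One
mollifier serves all times, since it works for every continuous function. -/
lemma exists_isMollifier [NormedSpace ℝ P] [FiniteDimensional ℝ P] {ε : ℝ} (hε : 0 < ε) : ∃ η : P → ℝ, IsMollifier ε η ∧
    ∀ u : P → ℝ, Continuous u → ContDiff ℝ 2 (mollify η u) := by
  let φ : ContDiffBump (0 : P) := ⟨ε / 2, ε, by positivity, by linarith⟩
  refine ⟨φ.normed volume, ⟨φ.continuous_normed, φ.nonneg_normed, φ.integral_normed,
    φ.hasCompactSupport_normed, fun z hz => ?_⟩, fun u hu => ?_⟩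
  · have : z ∉ Function.support (φ.normed volume) := by
      rw [φ.support_normed_eq, mem_ball_zero_iff, not_lt]; exact hz
    simpa using this
  · exact φ.hasCompactSupport_normed.contDiff_convolution_left (n := 2)
      (ContinuousLinearMap.lsmul ℝ ℝ) φ.contDiff_normed hu.locallyIntegrable

namespace IsMollifier

variable {ε : ℝ} {η u : P → ℝ}

lemma abs_integral_mul_sub_le (hη : IsMollifier ε η) {f g : P → ℝ} (hf : Continuous f)
    (hg : Continuous g) {c : ℝ} (h : ∀ z, ‖z‖ < ε → |f z - g z| ≤ c) :
    |(∫ z, η z * f z) - ∫ z, η z * g z| ≤ c := by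
  have hi : ∀ f : P → ℝ, Continuous f → Integrable fun z => η z * f z := fun f hf =>
    (hη.continuous.mul hf).integrable_of_hasCompactSupport hη.hasCompactSupport.mul_right
  rw [← integral_sub (hi f hf) (hi g hg), ← Real.norm_eq_abs]
  calc _ ≤ ∫ z, η z * c := by
        refine norm_integral_le_of_norm_le (hi _ continuous_const) (ae_of_all _ fun z => ?_)
        rw [← mul_sub, norm_mul, Real.norm_of_nonneg (hη.nonneg z)]
        by_cases hz : ‖z‖ < ε
        · exact mul_le_mul_of_nonneg_left (h z hz) (hη.nonneg z)
        · rw [hη.eq_zero z (not_lt.1 hz)]; simp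
    _ = c := by rw [integral_mul_const, hη.integral_eq_one, one_mul]

lemma abs_mollify_sub_le (hη : IsMollifier ε η) (hu : Continuous u) {c : ℝ} {p : P} {a : ℝ}
    (h : ∀ z, ‖z‖ < ε → |u (p - z) - a| ≤ c) : |mollify η u p - a| ≤ c := by
  have := hη.abs_integral_mul_sub_le (f := fun z => u (p - z)) (g := fun _ => a)
    (by fun_prop) continuous_const h
  rwa [integral_mul_const, hη.integral_eq_one, one_mul] at this

lemma lipschitzWith_mollify (hη : IsMollifier ε η) {K : NNReal} (hu : LipschitzWith K u) :
    LipschitzWith K (mollify η u) := by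
  have := hu.continuous
  refine LipschitzWith.of_dist_le_mul fun p q => ?_
  refine hη.abs_integral_mul_sub_le (f := fun z => u (p - z)) (g := fun z => u (q - z))
    (by fun_prop) (by fun_prop) fun z _ => ?_
  have := hu.dist_le_mul (p - z) (q - z)
  rwa [dist_sub_right] at this

end IsMollifier

end Mollifier

/-- The chain rule along an absolutely continuous curve, in integrated form. -/
lemma integral_fderiv_comp_eq_sub {V : Type*} [NormedAddCommGroup V] [NormedSpace ℝ V] {f : V → ℝ}
    {c c' : ℝ → V} {g : ℝ → ℝ} {K : NNReal} {s t : ℝ} (hf : Differentiable ℝ f)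
    (hK : LipschitzWith K f) (hg : AbsolutelyContinuousOnInterval g s t)
    (hcg : ∀ x ∈ uIcc s t, ∀ y ∈ uIcc s t, dist (c x) (c y) ≤ dist (g x) (g y))
    (hc : ∀ᵐ r, r ∈ uIoc s t → HasDerivAt c (c' r) r) :
    ∫ r in s..t, fderiv ℝ f (c r) (c' r) = f (c t) - f (c s) := by
  have hAC : AbsolutelyContinuousOnInterval (fun r => f (c r)) s t :=
    absolutelyContinuousOnInterval_of_dist_le (C := K) hg fun x hx y hy =>
      (hK.dist_le_mul _ _).trans (mul_le_mul_of_nonneg_left (hcg x hx y hy) K.2)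
  rw [← hAC.integral_deriv_eq_sub]
  refine intervalIntegral.integral_congr_ae ?_
  filter_upwards [hc] with r hr hr'
  exact ((hf _).hasFDerivAt.comp_hasDerivAt r (hr hr')).deriv.symm

/-! ### Uniqueness for the continuity equation by duality. -/

section Weak

variable {d : ℕ} {b : ℝ → Vec d → Vec d} {k : ℝ → ℝ} {T : ℝ}
  {ν : ℝ → Measure (Vec d × Vec d)}

instance : (volume : Measure (Vec d × Vec d)).IsAddHaarMeasure :=
  inferInstanceAs ((volume : Measure (Vec d)).prod volume).IsAddHaarMeasure

/-- The directional derivative of `v` along the vector field that moves the first component. -/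
def dirDeriv (b : ℝ → Vec d → Vec d) (v : Vec d × Vec d → ℝ) (t : ℝ) (p : Vec d × Vec d) : ℝ :=
  fderiv ℝ v p (b t p.1, 0)

/-- The weak formulation of the continuity equation for test functions of product form with
spatial part `v`. -/
def SolvesWeakly (T : ℝ) (b : ℝ → Vec d → Vec d) (ν : ℝ → Measure (Vec d × Vec d))
    (v : Vec d × Vec d → ℝ) : Prop :=
  ∀ χ : ℝ → ℝ, ContDiff ℝ 1 χ → HasCompactSupport χ → tsupport χ ⊆ Ioo 0 T →
    ∫ t in 0..T, ∫ p, (deriv χ t * v p + χ t * dirDeriv b v t p) ∂(ν t) = 0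

lemma norm_prod_zero (x : Vec d) : ‖((x, 0) : Vec d × Vec d)‖ = ‖x‖ := by
  rw [Prod.norm_mk, norm_zero, max_eq_left (norm_nonneg _)]

lemma measurable_dirDeriv (hb : IsCaratheodory b k) {v : Vec d × Vec d → ℝ} (hv : ContDiff ℝ 1 v) :
    Measurable (Function.uncurry (dirDeriv b v)) := by
  have h1 : Continuous fun q : (Vec d × Vec d) × Vec d => fderiv ℝ v q.1 (q.2, 0) :=
    ((hv.continuous_fderiv one_ne_zero).comp continuous_fst).clm_apply (by fun_prop)
  have h2 : Measurable fun q : ℝ × Vec d × Vec d => b q.1 q.2.1 :=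
    hb.measurable.comp (measurable_fst.prodMk (measurable_fst.comp measurable_snd))
  exact h1.measurable.comp (measurable_snd.prodMk h2)

lemma abs_dirDeriv_le (hb : IsCaratheodory b k) {v : Vec d × Vec d → ℝ} {M : ℝ}
    (hM : ∀ p, ‖fderiv ℝ v p‖ ≤ M) (t : ℝ) (p : Vec d × Vec d) : |dirDeriv b v t p| ≤ M * k t := by
  rw [← Real.norm_eq_abs, dirDeriv]
  refine (ContinuousLinearMap.le_opNorm _ _).trans ?_
  rw [norm_prod_zero]
  exact mul_le_mul (hM p) (hb.bound _ _) (norm_nonneg _) ((norm_nonneg _).trans (hM p))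

/-- One term varies the gradient, the other the field. The spatial Lipschitz constant is a fixed
multiple of `k t`, hence integrable in time. -/
lemma abs_dirDeriv_sub_le (hb : IsCaratheodory b k) {v : Vec d × Vec d → ℝ} {M : ℝ} {K : NNReal}
    (hM : ∀ p, ‖fderiv ℝ v p‖ ≤ M) (hK : LipschitzWith K (fderiv ℝ v)) (t : ℝ)
    (p q : Vec d × Vec d) :
    |dirDeriv b v t p - dirDeriv b v t q| ≤ (K + M) * k t * dist p q := by
  have e : dirDeriv b v t p - dirDeriv b v t q
      = (fderiv ℝ v p - fderiv ℝ v q) (b t p.1, 0) + fderiv ℝ v q (b t p.1 - b t q.1, 0) := by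
    have : ((b t p.1 - b t q.1, 0) : Vec d × Vec d) = (b t p.1, 0) - (b t q.1, 0) := by simp
    rw [this, map_sub]
    simp [dirDeriv]
  have hk := hb.nonneg t
  have h1 : |(fderiv ℝ v p - fderiv ℝ v q) (b t p.1, 0)| ≤ K * dist p q * k t := by
    rw [← Real.norm_eq_abs]
    refine (ContinuousLinearMap.le_opNorm _ _).trans ?_
    rw [norm_prod_zero, ← dist_eq_norm]
    exact mul_le_mul (hK.dist_le_mul p q) (hb.bound _ _) (norm_nonneg _) (by positivity)
  have h2 : |fderiv ℝ v q (b t p.1 - b t q.1, 0)| ≤ M * (k t * dist p q) := by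
    rw [← Real.norm_eq_abs]
    refine (ContinuousLinearMap.le_opNorm _ _).trans ?_
    rw [norm_prod_zero]
    refine mul_le_mul (hM q) ((hb.lipschitz _ _ _).trans ?_) (norm_nonneg _)
      ((norm_nonneg _).trans (hM q))
    rw [← dist_eq_norm]
    gcongr
    exact le_max_left _ _
  rw [e]
  exact (abs_add_le _ _).trans ((add_le_add h1 h2).trans (le_of_eq (by ring)))

/-- The integrated form of the continuity equation. -/
lemma SolvesWeakly.integral_sub_eq (hT : 0 < T) (hb : IsCaratheodory b k)
    (hν : IsRegularCurve T ν) {v : Vec d × Vec d → ℝ} (hv : ContDiff ℝ 1 v)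
    (hvc : HasCompactSupport v) (hw : SolvesWeakly T b ν v) :
    IntervalIntegrable (fun r => ∫ p, dirDeriv b v r p ∂(ν r)) volume 0 T ∧
    ∀ s ∈ Icc 0 T, ∀ t ∈ Icc 0 T, ∫ p, v p ∂(ν t) - ∫ p, v p ∂(ν s)
      = ∫ r in s..t, ∫ p, dirDeriv b v r p ∂(ν r) := by
  obtain ⟨M, hM⟩ := (hv.continuous_fderiv one_ne_zero).bounded_above_of_compact_support
    (hvc.fderiv ℝ)
  obtain ⟨K, hK⟩ := ContDiff.lipschitzWith_of_hasCompactSupport hvc hv one_ne_zero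
  obtain ⟨C, hC⟩ := hv.continuous.bounded_above_of_compact_support hvc
  have hmeas := measurable_dirDeriv hb hv
  have hq : IntervalIntegrable (fun r => ∫ p, dirDeriv b v r p ∂(ν r)) volume 0 T := by
    rw [intervalIntegrable_iff_integrableOn_Icc_of_le hT.le]
    refine Integrable.mono' (hb.integrable.restrict.const_mul M)
      (hν.aestronglyMeasurable_integral hT.le hmeas) ?_
    filter_upwards [ae_restrict_mem measurableSet_Icc] with t ht
    have := hν.prob t ht
    exact abs_integral_le_of_abs_le (abs_dirDeriv_le hb hM t)
  refine ⟨hq, ?_⟩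
  have hsplit : ∀ χ : ℝ → ℝ, ∀ t ∈ uIcc 0 T,
      deriv χ t * ∫ p, v p ∂(ν t) + χ t * ∫ p, dirDeriv b v t p ∂(ν t)
        = ∫ p, (deriv χ t * v p + χ t * dirDeriv b v t p) ∂(ν t) := fun χ t ht => by
    rw [uIcc_of_le hT.le] at ht
    have := hν.prob t ht
    have i1 : Integrable v (ν t) :=
      Integrable.of_bound hv.continuous.aestronglyMeasurable C (ae_of_all _ hC)
    have i2 : Integrable (dirDeriv b v t) (ν t) :=
      Integrable.of_bound (hmeas.comp measurable_prodMk_left).aestronglyMeasurable (M * k t)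
        (ae_of_all _ fun p => abs_dirDeriv_le hb hM t p)
    rw [integral_add (i1.const_mul _) (i2.const_mul _), integral_const_mul, integral_const_mul]
  have key := eq_add_integral_of_forall_integral_deriv_mul hT
    (hν.continuousOn_integral hK hC) hq fun χ hχ hχc hχs =>
      (intervalIntegral.integral_congr (hsplit χ)).trans (hw χ hχ hχc hχs)
  intro s hs t ht
  rw [← uIcc_of_le hT.le] at hs ht
  rw [← intervalIntegral.integral_interval_sub_left (hq.mono_set (uIcc_subset_uIcc_left ht))
    (hq.mono_set (uIcc_subset_uIcc_left hs))]
  rw [uIcc_of_le hT.le] at hs ht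
  rw [key s hs, key t ht]
  ring

lemma integral_dirDeriv_evolution (hb : IsCaratheodory b k) {v : Vec d × Vec d → ℝ}
    (hv : ContDiff ℝ 1 v) (hvc : HasCompactSupport v) {s t : ℝ} (hst : s ≤ t) (p : Vec d × Vec d) :
    ∫ r in s..t, dirDeriv b v r (evolution b s r p.1, p.2)
      = v (evolution b s t p.1, p.2) - v p := by
  obtain ⟨K, hK⟩ := ContDiff.lipschitzWith_of_hasCompactSupport hvc hv one_ne_zero
  have hki : ∀ u v, IntervalIntegrable k volume u v := fun u v => hb.integrable.intervalIntegrable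
  have := integral_fderiv_comp_eq_sub (c := fun r => (evolution b s r p.1, p.2))
    (c' := fun r => (b r (evolution b s r p.1), 0)) (s := s) (t := t)
    (hv.differentiable one_ne_zero) hK
    ((hki s t).absolutelyContinuousOnInterval_intervalIntegral (c := s) (by simp))
    (fun x hx y hy => by
      rw [uIcc_of_le hst] at hx hy
      rw [Prod.dist_eq, dist_self, max_eq_left dist_nonneg, dist_comm (∫ v in s..x, k v),
        dist_eq_norm, Real.dist_eq,
        intervalIntegral.integral_interval_sub_left (hki _ _) (hki _ _)]
      exact hb.norm_evolution_sub_evolution_le hx.1 hy.1 _)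
    (by
      filter_upwards [hb.ae_hasDerivAt_evolution s p.1] with r hr hr'
      rw [uIoc_of_le hst] at hr'
      exact (hr hr'.1).prodMk (hasDerivAt_const r p.2))
  simpa only [dirDeriv, hb.evolution_self, Prod.mk.eta] using this

/-- Over short time intervals, a weak solution is transported by the evolution up to an error of
higher order. -/
lemma SolvesWeakly.exists_abs_integral_sub_le (hT : 0 < T) (hb : IsCaratheodory b k)
    (hν : IsRegularCurve T ν) {v : Vec d × Vec d → ℝ} (hv : ContDiff ℝ 2 v)
    (hvc : HasCompactSupport v) (hw : SolvesWeakly T b ν v) {t : ℝ} (ht : t ∈ Icc 0 T)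
    {δ : ℝ} (hδ : 0 < δ) :
    ∃ r > 0, ∀ s ∈ Icc 0 T, s ≤ t → t - s < r →
      |∫ p, v p ∂(ν t) - ∫ p, v (evolution b s t p.1, p.2) ∂(ν s)| ≤ δ * ∫ r in s..t, k r := by
  have hv1 : ContDiff ℝ 1 v := hv.of_le (by norm_num)
  have hD : ContDiff ℝ 1 (fderiv ℝ v) := hv.fderiv_right (by norm_num)
  obtain ⟨M, hM⟩ := hD.continuous.bounded_above_of_compact_support (hvc.fderiv ℝ)
  obtain ⟨K₀, hK₀⟩ := ContDiff.lipschitzWith_of_hasCompactSupport (hvc.fderiv ℝ) hD one_ne_zero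
  obtain ⟨C, hC⟩ := hv.continuous.bounded_above_of_compact_support hvc
  have hM0 : 0 ≤ M := (norm_nonneg _).trans (hM 0)
  let K : NNReal := K₀ + M.toNNReal
  have hKe : (K : ℝ) = K₀ + M := by simp [K, hM0]
  -- Three errors of size `K * e * ∫ k` occur: one from freezing the characteristic at its starting
  -- point, two from replacing the moving measure by the one at time `s`.
  let e : ℝ := δ / (3 * (K + 1))
  have he : 0 < e := by positivity
  have hKe3 : 3 * K * e ≤ δ := by
    simp only [e]
    rw [mul_div_assoc', div_le_iff₀ (by positivity)]
    nlinarith [K.2, mul_nonneg hδ.le K.2]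
  have hki : ∀ u v, IntervalIntegrable k volume u v := fun u v => hb.integrable.intervalIntegrable
  have hI0 : ∀ s, s ≤ t → 0 ≤ ∫ r in s..t, k r := fun s hs =>
    intervalIntegral.integral_nonneg hs fun r _ => hb.nonneg r
  obtain ⟨r₁, hr₁, h₁⟩ := Metric.mem_nhdsWithin_iff.1 (hν.continuous t ht e he)
  have hcont : Continuous fun s => ∫ r in s..t, k r := by
    have : (fun s => ∫ r in s..t, k r) = fun s => -∫ r in t..s, k r := by
      ext s; exact intervalIntegral.integral_symm _ _
    rw [this]
    exact (intervalIntegral.continuous_primitive hki t).neg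
  obtain ⟨r₂, hr₂, h₂⟩ := Metric.continuous_iff.1 hcont t e he
  refine ⟨min r₁ r₂, lt_min hr₁ hr₂, fun s hs hst hsr => ?_⟩
  have hdist : dist s t = t - s := by rw [dist_comm, Real.dist_eq, abs_of_nonneg (by linarith)]
  have hIe : ∫ r in s..t, k r ≤ e := by
    have := h₂ s (by rw [hdist]; exact hsr.trans_le (min_le_right _ _))
    rw [intervalIntegral.integral_same, Real.dist_eq, sub_zero] at this
    exact (le_abs_self _).trans this.le
  have hps := hν.prob s hs
  have hpt := hν.prob t ht
  have hlip : ∀ r, LipschitzWith (K * (k r).toNNReal) (dirDeriv b v r) := fun r =>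
    LipschitzWith.of_dist_le_mul fun p q => by
      rw [NNReal.coe_mul, Real.coe_toNNReal _ (hb.nonneg r), hKe]
      exact abs_dirDeriv_sub_le hb hM hK₀ r p q
  -- Continuity is available at the fixed time `t`, so both measures are compared with the one at
  -- `t`. The integrand depends on `r`, which is why continuity must be uniform over functions with
  -- a given Lipschitz constant.
  have hnear : ∀ r ∈ Icc s t, |∫ p, dirDeriv b v r p ∂(ν r) - ∫ p, dirDeriv b v r p ∂(ν s)|
      ≤ 2 * K * e * k r := fun r hr => by
    have hr0 : r ∈ Icc 0 T := ⟨hs.1.trans hr.1, hr.2.trans ht.2⟩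
    have hdr : dist r t < r₁ := by
      rw [dist_comm, Real.dist_eq, abs_of_nonneg (by linarith [hr.2])]
      linarith [hr.1, min_le_left r₁ r₂]
    have hds : dist s t < r₁ := by rw [hdist]; exact hsr.trans_le (min_le_left _ _)
    have a1 := h₁ ⟨hdr, hr0⟩ _ _ _ (hlip r) (abs_dirDeriv_le hb hM r)
    have a2 := h₁ ⟨hds, hs⟩ _ _ _ (hlip r) (abs_dirDeriv_le hb hM r)
    rw [abs_sub_comm] at a2
    refine (abs_sub_le _ (∫ p, dirDeriv b v r p ∂(ν t)) _).trans ((add_le_add a1 a2).trans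
      (le_of_eq ?_))
    rw [NNReal.coe_mul, Real.coe_toNNReal _ (hb.nonneg r)]
    ring
  have hmeas := measurable_dirDeriv hb hv1
  have hvm : Continuous fun p : Vec d × Vec d => v (evolution b s t p.1, p.2) :=
    hv.continuous.comp (((hb.continuous_evolution_right hst).comp continuous_fst).prodMk
      continuous_snd)
  have iv : Integrable v (ν s) :=
    Integrable.of_bound hv.continuous.aestronglyMeasurable C (ae_of_all _ hC)
  have ivm : Integrable (fun p : Vec d × Vec d => v (evolution b s t p.1, p.2)) (ν s) :=
    Integrable.of_bound hvm.aestronglyMeasurable C (ae_of_all _ fun p => hC _)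
  have hprod : Integrable (Function.uncurry fun r p => dirDeriv b v r p)
      ((volume.restrict (Ioc s t)).prod (ν s)) := by
    have hdom : Integrable (fun q : ℝ × Vec d × Vec d => M * k q.1)
        ((volume.restrict (Ioc s t)).prod (ν s)) :=
      (hb.integrable.restrict.const_mul M).comp_fst (ν s)
    exact hdom.mono' hmeas.aestronglyMeasurable (ae_of_all _ fun q => abs_dirDeriv_le hb hM q.1 q.2)
  have hswap : ∫ p, (∫ r in s..t, dirDeriv b v r p) ∂(ν s)
      = ∫ r in s..t, ∫ p, dirDeriv b v r p ∂(ν s) := by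
    simp only [intervalIntegral.integral_of_le hst]
    exact (integral_integral_swap hprod).symm
  have iint : Integrable (fun p => ∫ r in s..t, dirDeriv b v r p) (ν s) := by
    simp only [intervalIntegral.integral_of_le hst]
    exact hprod.integral_prod_right
  have iint' : IntervalIntegrable (fun r => ∫ p, dirDeriv b v r p ∂(ν s)) volume s t := by
    rw [intervalIntegrable_iff_integrableOn_Ioc_of_le hst]
    exact hprod.integral_prod_left
  obtain ⟨hq, hinc⟩ := hw.integral_sub_eq hT hb hν hv1 hvc
  have hq' : IntervalIntegrable (fun r => ∫ p, dirDeriv b v r p ∂(ν r)) volume s t :=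
    hq.mono_set (by
      rw [uIcc_of_le hT.le, uIcc_of_le hst]; exact Icc_subset_Icc hs.1 ht.2)
  have hbd : ∀ p : Vec d × Vec d,
      |(v (evolution b s t p.1, p.2) - v p) - ∫ r in s..t, dirDeriv b v r p|
        ≤ K * e * ∫ r in s..t, k r := fun p => by
    have hc : Continuous fun r => ((evolution b s r p.1, p.2) : Vec d × Vec d) :=
      (hb.continuous_evolution s p.1).prodMk continuous_const
    have j1 : IntervalIntegrable (fun r => dirDeriv b v r (evolution b s r p.1, p.2)) volume s t :=
      ((hb.integrable.const_mul M).mono'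
        (hmeas.comp (measurable_id.prodMk hc.measurable)).aestronglyMeasurable
        (ae_of_all _ fun r => abs_dirDeriv_le hb hM r _)).intervalIntegrable
    have j2 : IntervalIntegrable (fun r => dirDeriv b v r p) volume s t :=
      ((hb.integrable.const_mul M).mono'
        (hmeas.comp (measurable_id.prodMk measurable_const)).aestronglyMeasurable
        (ae_of_all _ fun r => abs_dirDeriv_le hb hM r _)).intervalIntegrable
    rw [← integral_dirDeriv_evolution hb hv1 hvc hst, ← intervalIntegral.integral_sub j1 j2,
      ← intervalIntegral.integral_const_mul, ← Real.norm_eq_abs]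
    refine intervalIntegral.norm_integral_le_of_norm_le hst (ae_of_all _ fun r hr => ?_)
      ((hki s t).const_mul _)
    refine (abs_dirDeriv_sub_le hb hM hK₀ r _ _).trans ?_
    rw [← hKe, mul_assoc, mul_assoc, mul_comm e]
    have hk := hb.nonneg r
    gcongr
    rw [Prod.dist_eq, dist_self, max_eq_left dist_nonneg, dist_eq_norm]
    exact (hb.norm_evolution_sub_self_le hr.1.le _).trans
      ((hb.integral_mono hr.1.le le_rfl hr.2).trans hIe)
  have hA : |∫ p, (v (evolution b s t p.1, p.2) - v p) ∂(ν s)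
      - ∫ p, (∫ r in s..t, dirDeriv b v r p) ∂(ν s)| ≤ K * e * ∫ r in s..t, k r := by
    have iD : Integrable (fun p : Vec d × Vec d => v (evolution b s t p.1, p.2) - v p) (ν s) :=
      ivm.sub iv
    rw [← integral_sub iD iint]
    exact abs_integral_le_of_abs_le hbd
  have hB : |(∫ r in s..t, ∫ p, dirDeriv b v r p ∂(ν r))
      - ∫ r in s..t, ∫ p, dirDeriv b v r p ∂(ν s)| ≤ 2 * K * e * ∫ r in s..t, k r := by
    rw [← intervalIntegral.integral_sub hq' iint', ← intervalIntegral.integral_const_mul,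
      ← Real.norm_eq_abs]
    exact intervalIntegral.norm_integral_le_of_norm_le hst
      (ae_of_all _ fun r hr => hnear r (Ioc_subset_Icc_self hr)) ((hki s t).const_mul _)
  rw [hswap, integral_sub ivm iv] at hA
  rw [← hinc s hs t ht] at hB
  have hI := hI0 s hst
  calc _ ≤ 3 * K * e * ∫ r in s..t, k r := by
        rw [abs_le] at hA hB ⊢
        constructor <;> linarith [hA.1, hA.2, hB.1, hB.2]
    _ ≤ _ := by gcongr

/-- Weak solutions are transported by the evolution: uniqueness for the continuity equation. -/
lemma integral_eq_of_solvesWeakly (hT : 0 < T) (hb : IsCaratheodory b k) {κ : ℝ → ℝ}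
    (hκ : Integrable κ) (hκ0 : ∀ t, 0 ≤ κ t) (hbκ : ∀ t x, ‖b t x‖ ≤ κ t * (1 + ‖x‖))
    (hν : IsRegularCurve T ν) {R₀ R' : ℝ}
    (hR' : (1 + R₀) * Real.exp (∫ r, κ r) ≤ R')
    (hweak : ∀ v : Vec d × Vec d → ℝ, ContDiff ℝ 1 v → HasCompactSupport v →
      Function.support v ⊆ Metric.closedBall 0 R' → SolvesWeakly T b ν v)
    {g : Vec d × Vec d → ℝ} {Λ : NNReal} (hg : LipschitzWith Λ g)
    (hgs : ∀ p, R₀ < ‖p‖ → g p = 0) (hR₀ : 0 ≤ R₀) :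
    ∫ p, g p ∂(ν T) = ∫ p, g (evolution b 0 T p.1, p.2) ∂(ν 0) := by
  have hki : ∀ u v, IntervalIntegrable k volume u v := fun u v => hb.integrable.intervalIntegrable
  have h0T : (0 : ℝ) ∈ Icc 0 T := ⟨le_rfl, hT.le⟩
  have hTT : T ∈ Icc 0 T := ⟨hT.le, le_rfl⟩
  let A : ℝ := ∫ r in 0..T, k r
  have hA : 0 ≤ A := intervalIntegral.integral_nonneg hT.le fun r _ => hb.nonneg r
  have hgc : HasCompactSupport g := by
    refine HasCompactSupport.of_support_subset_isCompact (isCompact_closedBall 0 R₀) fun p hp => ?_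
    by_contra h
    rw [mem_closedBall_zero_iff, not_le] at h
    exact hp (hgs p h)
  obtain ⟨C, hC⟩ := hg.continuous.bounded_above_of_compact_support hgc
  -- Formally this solves the dual transport equation with terminal value `g`, so its integral
  -- against the weak solution should not depend on time.
  let u : ℝ → Vec d × Vec d → ℝ := fun t p => g (evolution b t T p.1, p.2)
  let Λ' : NNReal := Λ * (Real.exp A).toNNReal
  have hΛ' : (Λ' : ℝ) = Λ * Real.exp A := by simp [Λ', (Real.exp_pos A).le]
  have huL : ∀ t ∈ Icc 0 T, LipschitzWith Λ' (u t) := fun t ht => by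
    refine LipschitzWith.of_dist_le_mul fun p q => (hg.dist_le_mul _ _).trans ?_
    rw [hΛ', mul_assoc]
    gcongr
    have h1 : dist (evolution b t T p.1) (evolution b t T q.1) ≤ Real.exp A * dist p q := by
      rw [dist_eq_norm]
      refine (hb.norm_evolution_sub_le ht.2 _ _).trans ?_
      rw [← dist_eq_norm]
      gcongr
      · exact hb.integral_mono ht.2 ht.1 le_rfl
      · exact le_max_left _ _
    have h2 : dist p.2 q.2 ≤ Real.exp A * dist p q := by
      refine (le_max_right (dist p.1 q.1) _ : dist p.2 q.2 ≤ dist p q).trans ?_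
      exact le_mul_of_one_le_left (dist_nonneg : 0 ≤ dist p q) (Real.one_le_exp hA)
    exact max_le h1 h2
  have huc : ∀ t ∈ Icc 0 T, Continuous (u t) := fun t ht => (huL t ht).continuous
  have hub : ∀ t p, |u t p| ≤ C := fun t p => hC _
  have hucomp : ∀ s t, 0 ≤ s → s ≤ t → t ≤ T → ∀ p : Vec d × Vec d,
      u s p = u t (evolution b s t p.1, p.2) := fun s t _ hst htT p => by
    simp only [u]
    rw [hb.evolution_comp hst htT]
  -- Backward growth bounds the points that can reach the support of `g`. The margin 1 leaves room
  -- for mollification at scale at most 1 within the ball of radius `R'`.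
  have husupp : ∀ t ∈ Icc 0 T, ∀ p, R' - 1 < ‖p‖ → u t p = 0 := fun t ht p hp => by
    by_contra hne
    have h1 : ‖((evolution b t T p.1, p.2) : Vec d × Vec d)‖ ≤ R₀ := by
      by_contra h; exact hne (hgs _ (not_le.1 h))
    rw [Prod.norm_mk, max_le_iff] at h1
    have h2 := hb.one_add_norm_le_mul_exp hκ hκ0 hbκ ht.2 p.1
    have h3 : Real.exp (∫ r in t..T, κ r) ≤ Real.exp (∫ r, κ r) := by
      rw [Real.exp_le_exp, intervalIntegral.integral_of_le ht.2]
      exact setIntegral_le_integral hκ (ae_of_all _ hκ0)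
    have h4 : 1 + ‖p.1‖ ≤ (1 + R₀) * Real.exp (∫ r, κ r) :=
      h2.trans (by gcongr; exact h1.1)
    have h5 : 1 + ‖p.2‖ ≤ (1 + R₀) * Real.exp (∫ r, κ r) := by
      have : (1 : ℝ) ≤ Real.exp (∫ r, κ r) := Real.one_le_exp (integral_nonneg hκ0)
      nlinarith [h1.2]
    have h6 : ‖p‖ ≤ R' - 1 := max_le (by linarith) (by linarith)
    linarith
  -- The term `2 * Λ'` pays for removing the mollifier at the times 0 and `T`; the other term is the
  -- commutator error accumulated over [0,T].
  have hmain : ∀ ε, 0 < ε → ε ≤ 1 →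
      |∫ p, g p ∂(ν T) - ∫ p, u 0 p ∂(ν 0)| ≤ (2 * Λ' + Λ' * Real.exp A * A) * ε := by
    intro ε hε hε1
    obtain ⟨η, hη, hηd⟩ := exists_isMollifier (P := Vec d × Vec d) hε
    let w : ℝ → Vec d × Vec d → ℝ := fun t => mollify η (u t)
    have hwL : ∀ t ∈ Icc 0 T, LipschitzWith Λ' (w t) := fun t ht =>
      hη.lipschitzWith_mollify (huL t ht)
    have hwb : ∀ t ∈ Icc 0 T, ∀ p, |w t p| ≤ C := fun t ht p => by
      have := hη.abs_mollify_sub_le (huc t ht) (p := p) (a := 0) (c := C)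
        (fun z _ => by rw [sub_zero]; exact hub t _)
      rwa [sub_zero] at this
    have hwi : ∀ s ∈ Icc 0 T, ∀ t ∈ Icc 0 T, Integrable (w s) (ν t) := fun s hs t ht => by
      have := hν.prob t ht
      exact Integrable.of_bound (hwL s hs).continuous.aestronglyMeasurable C
        (ae_of_all _ (hwb s hs))
    have hws : ∀ t ∈ Icc 0 T, Function.support (w t) ⊆ Metric.closedBall 0 R' := by
      intro t ht p hp
      by_contra h
      rw [mem_closedBall_zero_iff, not_le] at h
      refine hp ?_
      have := hη.abs_mollify_sub_le (huc t ht) (p := p) (a := 0) (c := 0) (fun z hz => by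
        rw [husupp t ht (p - z) (by linarith [norm_sub_norm_le p z]), sub_zero, abs_zero])
      rw [sub_zero] at this
      exact abs_nonpos_iff.1 this
    have hwc : ∀ t ∈ Icc 0 T, HasCompactSupport (w t) := fun t ht =>
      HasCompactSupport.of_support_subset_isCompact (isCompact_closedBall 0 R') (hws t ht)
    let f : ℝ → ℝ := fun t => ∫ p, w t p ∂(ν t)
    have huclose : ∀ s ∈ Icc 0 T, ∀ t ∈ Icc 0 T, ∀ p, |u s p - u t p| ≤ Λ' * |∫ r in s..t, k r| := by
      intro s hs t ht p
      wlog hst : s ≤ t generalizing s t with H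
      · rw [abs_sub_comm, intervalIntegral.integral_symm, abs_neg]
        exact H t ht s hs (le_of_not_ge hst)
      rw [hucomp s t hs.1 hst ht.2]
      refine ((huL t ht).dist_le_mul (evolution b s t p.1, p.2) p).trans ?_
      gcongr
      rw [Prod.dist_eq, dist_self, max_eq_left dist_nonneg, dist_eq_norm]
      exact (hb.norm_evolution_sub_self_le hst _).trans (le_abs_self _)
    have hfc : ContinuousOn f (Icc 0 T) := by
      intro t ht
      rw [ContinuousWithinAt, tendsto_iff_dist_tendsto_zero]
      have c1 : Tendsto (fun s => Λ' * |∫ r in s..t, k r|) (𝓝[Icc 0 T] t) (𝓝 0) := by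
        have h1 : Continuous fun s => ∫ r in t..s, k r := intervalIntegral.continuous_primitive hki t
        have h2 : (fun s => (Λ' : ℝ) * |∫ r in s..t, k r|) = fun s => Λ' * |∫ r in t..s, k r| := by
          ext s; rw [intervalIntegral.integral_symm, abs_neg]
        have h3 : Continuous fun s => (Λ' : ℝ) * |∫ r in t..s, k r| := continuous_const.mul h1.abs
        have h4 := h3.tendsto t
        rw [intervalIntegral.integral_same, abs_zero, mul_zero] at h4
        rw [h2]
        exact h4.mono_left nhdsWithin_le_nhds
      have c2 := tendsto_iff_dist_tendsto_zero.1
        (hν.continuousOn_integral (hwL t ht) (hwb t ht) t ht)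
      have c3 := c1.add c2
      rw [add_zero] at c3
      refine squeeze_zero' (Eventually.of_forall fun _ => dist_nonneg) ?_ c3
      filter_upwards [self_mem_nhdsWithin] with s hs
      have := hν.prob s hs
      refine (dist_triangle _ (∫ p, w t p ∂(ν s)) _).trans (add_le_add ?_ le_rfl)
      rw [Real.dist_eq, ← integral_sub (hwi s hs s hs) (hwi t ht s hs)]
      refine abs_integral_le_of_abs_le fun p => ?_
      have hus := huc s hs
      have hut := huc t ht
      exact hη.abs_integral_mul_sub_le (f := fun z => u s (p - z)) (g := fun z => u t (p - z))
        (by fun_prop) (by fun_prop) fun z _ => huclose s hs t ht _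
    have hbound : |f T - f 0| ≤ (Λ' * Real.exp A * ε)
        * ((∫ r in 0..T, k r) - ∫ r in 0..(0 : ℝ), k r) := by
      refine abs_sub_le_of_forall_exists_lt hT.le hfc
        (A := fun t => ∫ r in 0..t, k r) (intervalIntegral.continuous_primitive hki 0).continuousOn ?_
      intro t ht δ hδ
      have ht' : t ∈ Icc 0 T := Ioc_subset_Icc_self ht
      have hut := huc t ht'
      obtain ⟨r, hr, hstep⟩ := (hweak (w t) ((hηd _ hut).of_le (by norm_num)) (hwc t ht')
        (hws t ht')).exists_abs_integral_sub_le hT hb hν (hηd _ hut) (hwc t ht') ht' hδ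
      obtain ⟨s, hs1, hs2⟩ := exists_between (max_lt ht.1 (by linarith : t - r < t))
      rw [max_lt_iff] at hs1
      have hs : s ∈ Icc 0 T := ⟨hs1.1.le, hs2.le.trans ht.2⟩
      have hus := huc s hs
      refine ⟨s, ⟨hs1.1.le, hs2⟩, ?_⟩
      rw [intervalIntegral.integral_interval_sub_left (hki _ _) (hki _ _)]
      have e1 := hstep s hs hs2.le (by linarith [hs1.2])
      have hps := hν.prob s hs
      have hev := hb.continuous_evolution_right hs2.le
      have hI : 0 ≤ ∫ r in s..t, k r :=
        intervalIntegral.integral_nonneg hs2.le fun r _ => hb.nonneg r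
      have hwm : Continuous fun p : Vec d × Vec d => w t (evolution b s t p.1, p.2) :=
        (hwL t ht').continuous.comp ((hev.comp continuous_fst).prodMk continuous_snd)
      have iwm : Integrable (fun p : Vec d × Vec d => w t (evolution b s t p.1, p.2)) (ν s) :=
        Integrable.of_bound hwm.aestronglyMeasurable C (ae_of_all _ fun p => hwb t ht' _)
      -- Mollifying after transport and transporting after mollifying differ only in the
      -- displacements of two points at distance below `ε`.
      have e2 : |∫ p, w t (evolution b s t p.1, p.2) ∂(ν s) - ∫ p, w s p ∂(ν s)|
          ≤ Λ' * Real.exp A * ε * ∫ r in s..t, k r := by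
        rw [← integral_sub iwm (hwi s hs s hs)]
        refine abs_integral_le_of_abs_le fun p => ?_
        refine hη.abs_integral_mul_sub_le
          (f := fun z => u t ((evolution b s t p.1, p.2) - z)) (g := fun z => u s (p - z))
          (by fun_prop) (by fun_prop) fun z hz => ?_
        rw [hucomp s t hs.1 hs2.le ht.2]
        refine ((huL t ht').dist_le_mul _ _).trans ?_
        rw [mul_assoc, mul_assoc]
        gcongr
        have hz1 : ‖z.1‖ ≤ ε := (norm_fst_le z).trans hz.le
        have e3 : dist (((evolution b s t p.1, p.2) : Vec d × Vec d) - z)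
            (evolution b s t (p - z).1, (p - z).2)
            = ‖(evolution b s t p.1 - p.1) - (evolution b s t (p.1 - z.1) - (p.1 - z.1))‖ := by
          rw [Prod.dist_eq]
          simp only [Prod.fst_sub, Prod.snd_sub, dist_self]
          rw [max_eq_left dist_nonneg, dist_eq_norm]
          congr 1; abel
        rw [e3]
        refine (hb.norm_evolution_displacement_sub_le hs2.le _ _).trans ?_
        rw [sub_sub_cancel, mul_comm, ← mul_assoc]
        gcongr
        exact hb.integral_mono hs2.le hs.1 ht.2
      calc |f t - f s| ≤ _ := abs_sub_le _ (∫ p, w t (evolution b s t p.1, p.2) ∂(ν s)) _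
        _ ≤ _ := add_le_add e1 e2
        _ = _ := by ring
    rw [intervalIntegral.integral_same, sub_zero] at hbound
    have hclose : ∀ t ∈ Icc 0 T, |f t - ∫ p, u t p ∂(ν t)| ≤ Λ' * ε := fun t ht => by
      have := hν.prob t ht
      have iu : Integrable (u t) (ν t) :=
        Integrable.of_bound (huc t ht).aestronglyMeasurable C (ae_of_all _ (hub t))
      rw [← integral_sub (hwi t ht t ht) iu]
      refine abs_integral_le_of_abs_le fun p => ?_
      refine hη.abs_mollify_sub_le (huc t ht) fun z hz => ?_
      refine ((huL t ht).dist_le_mul _ _).trans ?_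
      gcongr
      rw [dist_eq_norm, sub_sub_cancel_left, norm_neg]
      exact hz.le
    have huT : u T = g := by
      ext p; simp only [u, hb.evolution_self]
    have c1 := hclose T hTT
    have c2 := hclose 0 h0T
    rw [huT] at c1
    rw [abs_le] at c1 c2 hbound ⊢
    constructor <;> nlinarith [c1.1, c1.2, c2.1, c2.2, hbound.1, hbound.2]
  have hlim : Tendsto (fun ε : ℝ => (2 * Λ' + Λ' * Real.exp A * A) * ε) (𝓝[>] 0) (𝓝 0) := by
    have h1 : Continuous fun ε : ℝ => (2 * Λ' + Λ' * Real.exp A * A) * ε := by fun_prop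
    have h2 := h1.tendsto 0
    rw [mul_zero] at h2
    exact h2.mono_left nhdsWithin_le_nhds
  have hle := ge_of_tendsto hlim (b := |∫ p, g p ∂(ν T) - ∫ p, u 0 p ∂(ν 0)|) (by
    filter_upwards [Ioc_mem_nhdsGT (zero_lt_one' ℝ)] with ε hε using hmain ε hε.1 hε.2)
  exact sub_eq_zero.1 (abs_nonpos_iff.1 hle)

end Weak

/-! ### Identification of the mean-field curve with transport along the flow. -/

section MeanField

variable {d m : ℕ} {T : ℝ} {F : ℝ → Vec d → Vec m → Vec d} {θ : Control T m}
  {μ₀ : Measure (DataSpace d)} {μ : ℝ → Measure (DataSpace d)}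

lemma measurable_ofLp_data : Measurable fun z : DataSpace d => (z.fst, z.snd) := by fun_prop

lemma norm_ofLp_data_le (z : DataSpace d) : ‖(z.fst, z.snd)‖ ≤ ‖z‖ :=
  max_le (norm_data_fst_le z) (norm_data_snd_le z)

lemma lipschitzWith_ofLp_data : LipschitzWith 1 fun z : DataSpace d => (z.fst, z.snd) :=
  LipschitzWith.of_dist_le_mul fun z w => by
    rw [NNReal.coe_one, one_mul, dist_eq_norm, dist_eq_norm]
    exact norm_ofLp_data_le (z - w)

lemma IsWeakSolution.isRegularCurve (hμ : IsWeakSolution T F θ μ₀ μ) :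
    IsRegularCurve T fun t => (μ t).map fun z => (z.fst, z.snd) := by
  refine ⟨fun t ht => ?_, fun t ht ε hε => ?_⟩
  · have := hμ.isProbabilityMeasure t ht
    exact Measure.isProbabilityMeasure_map measurable_ofLp_data.aemeasurable
  · have h1 := (hμ.continuous t ht).eventually_lt_const (ENNReal.ofReal_pos.2 hε)
    filter_upwards [h1, self_mem_nhdsWithin] with s hs hsT g K C hg hC
    have := hμ.isProbabilityMeasure t ht
    have := hμ.isProbabilityMeasure s hsT
    have hgd : LipschitzWith K fun z : DataSpace d => g (z.fst, z.snd) := by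
      have := hg.comp (lipschitzWith_ofLp_data (d := d))
      rwa [mul_one] at this
    have hi : ∀ μ : Measure (DataSpace d), IsProbabilityMeasure μ →
        Integrable (fun z : DataSpace d => g (z.fst, z.snd)) μ := fun μ _ =>
      Integrable.of_bound hgd.continuous.aestronglyMeasurable C (ae_of_all _ fun z => hC _)
    rw [integral_map measurable_ofLp_data.aemeasurable hg.continuous.aestronglyMeasurable,
      integral_map measurable_ofLp_data.aemeasurable hg.continuous.aestronglyMeasurable]
    refine (abs_integral_sub_le_mul_wasserstein (S := univ) hgd.lipschitzOnWith (by simp) (by simp)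
      (hi _ inferInstance) (hi _ inferInstance) hs.ne_top).trans ?_
    gcongr
    exact ENNReal.toReal_le_of_le_ofReal hε.le hs.le

/-- Off the support of `v` its gradient vanishes, so the truncated and the true velocity need to
agree only on a ball containing that support. No bound on the supports of the measures that is
uniform in time is required. -/
lemma IsWeakSolution.solvesWeakly (hT : 0 < T) (hμ : IsWeakSolution T F θ μ₀ μ)
    {b : ℝ → Vec d → Vec d} {k : ℝ → ℝ} (hb : IsCaratheodory b k) {R : ℝ}
    (hbF : ∀ᵐ t ∂(volume.restrict (Icc (0 : ℝ) T)), ∀ x ∈ Metric.closedBall 0 R,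
        b t x = F t x (θ t)) {v : Vec d × Vec d → ℝ} (hv : ContDiff ℝ 1 v)
    (hvc : HasCompactSupport v) (hvR : Function.support v ⊆ Metric.closedBall 0 R) :
    SolvesWeakly T b (fun t => (μ t).map fun z => (z.fst, z.snd)) v := by
  intro χ hχ hχc hχs
  let ψ : ℝ × Vec d × Vec d → ℝ := fun p => χ p.1 * v p.2
  have hψ : ContDiff ℝ 1 ψ := (hχ.comp contDiff_fst).mul (hv.comp contDiff_snd)
  have hvt : tsupport v ⊆ Metric.closedBall 0 R := closure_minimal hvR Metric.isClosed_closedBall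
  have hψsupp : Function.support ψ ⊆ tsupport χ ×ˢ tsupport v := fun p hp =>
    ⟨subset_tsupport _ (left_ne_zero_of_mul hp), subset_tsupport _ (right_ne_zero_of_mul hp)⟩
  have hψt : tsupport ψ ⊆ tsupport χ ×ˢ tsupport v :=
    closure_minimal hψsupp ((isClosed_tsupport _).prod (isClosed_tsupport _))
  have hψc : HasCompactSupport ψ :=
    HasCompactSupport.of_support_subset_isCompact (hχc.isCompact.prod hvc.isCompact) hψsupp
  refine Eq.trans ?_ (hμ.weak ψ hψ hψc (hψt.trans (prod_mono hχs (subset_univ _))))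
  refine intervalIntegral.integral_congr_ae ?_
  rw [ae_restrict_iff' measurableSet_Icc] at hbF
  filter_upwards [hbF] with t ht htT
  rw [uIoc_of_le hT.le] at htT
  have hm : Measurable fun p => deriv χ t * v p + χ t * dirDeriv b v t p :=
    (hv.continuous.measurable.const_mul _).add
      (((measurable_dirDeriv hb hv).comp measurable_prodMk_left).const_mul _)
  rw [integral_map measurable_ofLp_data.aemeasurable hm.aestronglyMeasurable]
  refine integral_congr_ae (ae_of_all _ fun z => ?_)
  simp only [ψ]
  rw [deriv_mul_const (hχ.differentiable one_ne_zero t)]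
  congr 1
  have hd : HasFDerivAt (fun x => χ t * v (x, z.snd))
      (χ t • (fderiv ℝ v (z.fst, z.snd)).comp ((ContinuousLinearMap.id ℝ (Vec d)).prod
        (0 : Vec d →L[ℝ] Vec d))) z.fst :=
    ((hv.differentiable one_ne_zero _).hasFDerivAt.comp z.fst
      ((hasFDerivAt_id z.fst).prodMk (hasFDerivAt_const z.snd z.fst))).const_mul (χ t)
  rw [hd.fderiv]
  simp only [dirDeriv, _root_.smul_apply, ContinuousLinearMap.comp_apply,
    ContinuousLinearMap.prod_apply, ContinuousLinearMap.id_apply, _root_.zero_apply,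
    smul_eq_mul]
  by_cases hz : (z.fst, z.snd) ∈ tsupport v
  · have hz1 : z.fst ∈ Metric.closedBall (0 : Vec d) R := by
      rw [mem_closedBall_zero_iff]
      exact (norm_fst_le (z.fst, z.snd)).trans (mem_closedBall_zero_iff.1 (hvt hz))
    rw [ht (Ioc_subset_Icc_self htT) _ hz1]
  · rw [fderiv_of_notMem_tsupport ℝ hz]; simp

lemma ae_mem_closedBall_of_support_subset {R : ℝ} (h : μ₀.support ⊆ Metric.closedBall 0 R) :
    ∀ᵐ z ∂μ₀, z ∈ Metric.closedBall (0 : DataSpace d) R :=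
  Filter.mem_of_superset Measure.support_mem_ae h

/-- The terminal loss is the average of the loss along the flow. -/
lemma terminalLoss_eq (hT : 0 < T) (hF : VelocityAssumptions T F) {ℓ : Vec d → Vec d → ℝ}
    (hℓ : ContDiff ℝ 1 fun p : Vec d × Vec d => ℓ p.1 p.2) (θ : Control T m)
    [IsProbabilityMeasure μ₀] {R : ℝ} (hR : 0 < R)
    (hμ₀ : ∀ᵐ z ∂μ₀, z ∈ Metric.closedBall (0 : DataSpace d) R) :
    terminalLoss T F ℓ μ₀ θ = ∫ z, ℓ (flow T F θ T z.fst) z.snd ∂μ₀ := by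
  obtain ⟨L, hL, hgrowth⟩ := hF.linear_growth
  have hTT : T ∈ Icc 0 T := ⟨hT.le, le_rfl⟩
  let R₁ : ℝ := (1 + R) * Real.exp (L * (2 * T + ‖θ‖ ^ 2))
  have hR₁ : 0 < R₁ := by positivity
  have hx : ∀ᵐ z ∂μ₀, ‖z.fst‖ ≤ R ∧ ‖z.snd‖ ≤ R := by
    filter_upwards [hμ₀] with z hz
    rw [mem_closedBall_zero_iff] at hz
    exact ⟨(norm_data_fst_le z).trans hz, (norm_data_snd_le z).trans hz⟩
  obtain ⟨b₁, C₁, hC₁, hb₁, hbF₁, hbL₁⟩ := hF.exists_isCaratheodory θ hR₁ hL hgrowth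
  have hflow₁ : ∀ x : Vec d, ‖x‖ ≤ R → ∀ t ∈ Icc 0 T,
      flow T F θ t x = evolution b₁ 0 t x ∧ ‖flow T F θ t x‖ ≤ R₁ := fun x hx =>
    (isTrajectory_flow_and_eq_evolution hT hF hL hgrowth hb₁ hbF₁ hbL₁
      (by simp only [R₁]; linarith) hx).2
  have hμ : IsWeakSolution T F θ μ₀ (meanFieldCurve T F θ μ₀) := by
    refine Classical.epsilon_spec (p := IsWeakSolution T F θ μ₀)
      ⟨_, isWeakSolution_transport hT hb₁ hbF₁ (fun t ht x hx => ?_) hμ₀⟩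
    rw [mem_closedBall_zero_iff] at hx ⊢
    have := hflow₁ x hx t ht
    rw [← this.1]; exact this.2
  let μ := meanFieldCurve T F θ μ₀
  have hprob : IsProbabilityMeasure (μ T) := hμ.isProbabilityMeasure T hTT
  obtain ⟨M, hM⟩ := (hμ.isCompact_support T hTT).isBounded.subset_closedBall 0
  have hμT := ae_mem_closedBall_of_support_subset hM
  -- Large enough for the terminal support of the chosen curve, the labels and the endpoints of the
  -- flow; cutting off the loss beyond this radius changes neither integral.
  let R₀ : ℝ := max M (max R R₁)
  have hR₀ : 0 < R₀ := hR.trans_le ((le_max_left _ _).trans (le_max_right _ _))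
  let φ : ContDiffBump (0 : Vec d × Vec d) := ⟨R₀, R₀ + 1, hR₀, by linarith⟩
  let g : Vec d × Vec d → ℝ := fun p => φ p * ℓ p.1 p.2
  have hgd : ContDiff ℝ 1 g := φ.contDiff.mul hℓ
  have hgc : HasCompactSupport g := φ.hasCompactSupport.mul_right
  obtain ⟨Λ, hΛ⟩ := ContDiff.lipschitzWith_of_hasCompactSupport hgc hgd one_ne_zero
  have hg1 : ∀ p, ‖p‖ ≤ R₀ → g p = ℓ p.1 p.2 := fun p hp => by
    simp only [g]
    rw [φ.one_of_mem_closedBall (mem_closedBall_zero_iff.2 hp), one_mul]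
  have hg0 : ∀ p, R₀ + 1 < ‖p‖ → g p = 0 := fun p hp => by
    simp only [g]
    rw [φ.zero_of_le_dist (by rw [dist_zero_right]; exact hp.le), zero_mul]
  -- A second truncation is needed: the first was fixed before the chosen curve, and hence the
  -- radius `M`, was known. This one contains the backward images of the support of `g` as well as
  -- the flow.
  let R₂ : ℝ := max R₁ ((1 + (R₀ + 1)) * Real.exp (∫ r, controlRate θ L r))
  have hR₂ : 0 < R₂ := hR₁.trans_le (le_max_left _ _)
  obtain ⟨b₂, C₂, hC₂, hb₂, hbF₂, hbL₂⟩ := hF.exists_isCaratheodory θ hR₂ hL hgrowth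
  have key := integral_eq_of_solvesWeakly hT hb₂ (integrable_controlRate θ L)
    (controlRate_nonneg θ hL.le) hbL₂ hμ.isRegularCurve (le_max_right R₁ _)
    (fun v hv hvc hvR => hμ.solvesWeakly hT hb₂ hbF₂ hv hvc hvR) hΛ hg0 (by positivity)
  have hev := hb₂.continuous_evolution_right hT.le
  have hgm : Continuous fun p : Vec d × Vec d => g (evolution b₂ 0 T p.1, p.2) :=
    hgd.continuous.comp ((hev.comp continuous_fst).prodMk continuous_snd)
  simp only [hμ.initial] at key
  rw [integral_map measurable_ofLp_data.aemeasurable hgd.continuous.aestronglyMeasurable,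
    integral_map measurable_ofLp_data.aemeasurable hgm.aestronglyMeasurable] at key
  calc terminalLoss T F ℓ μ₀ θ = ∫ z : DataSpace d, g (z.fst, z.snd) ∂(μ T) := by
        refine integral_congr_ae ?_
        filter_upwards [hμT] with z hz
        rw [mem_closedBall_zero_iff] at hz
        exact (hg1 _ ((norm_ofLp_data_le z).trans (hz.trans (le_max_left _ _)))).symm
    _ = _ := key
    _ = _ := by
        refine integral_congr_ae ?_
        filter_upwards [hx] with z hz
        have h1 := (hflow₁ z.fst hz.1 T hTT).2
        have h2 := ((isTrajectory_flow_and_eq_evolution hT hF hL hgrowth hb₂ hbF₂ hbL₂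
          (by linarith [le_max_left R₁ ((1 + (R₀ + 1)) * Real.exp (∫ r, controlRate θ L r))])
          hz.1).2 T hTT).1
        rw [← h2]
        refine hg1 _ (max_le (h1.trans ?_) (hz.2.trans ?_))
        · exact (le_max_right _ _).trans (le_max_right _ _)
        · exact (le_max_left _ _).trans (le_max_right _ _)

end MeanField

/-! ### Empirical measures and particle costs. -/

section Empirical

variable {d m N : ℕ} {T : ℝ} {F : ℝ → Vec d → Vec m → Vec d}

lemma isProbabilityMeasure_empiricalMeasure (hN : 1 ≤ N) (Z : Fin N → DataSpace d) :
    IsProbabilityMeasure (empiricalMeasure Z) := by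
  refine ⟨?_⟩
  have hN' : (N : ENNReal) ≠ 0 := by exact_mod_cast (by omega : N ≠ 0)
  simp only [empiricalMeasure, Measure.smul_apply, Measure.finsetSum_apply, smul_eq_mul]
  simp [ENNReal.inv_mul_cancel hN' (ENNReal.natCast_ne_top N)]

lemma integral_empiricalMeasure (Z : Fin N → DataSpace d) (f : DataSpace d → ℝ) :
    ∫ z, f z ∂(empiricalMeasure Z) = (1 / (N : ℝ)) * ∑ i, f (Z i) := by
  rw [empiricalMeasure, integral_smul_measure, integral_finsetSum_measure]
  · simp
  · intro i _
    exact integrable_dirac (by simp)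

/-- Both are averages of the loss along the flow, so comparing the two problems reduces to comparing
two initial data for one functional. -/
lemma empiricalCost_eq_meanFieldCost (hT : 0 < T) (hF : VelocityAssumptions T F)
    {ℓ : Vec d → Vec d → ℝ} (hℓ : ContDiff ℝ 1 fun p : Vec d × Vec d => ℓ p.1 p.2)
    (lam : ℝ) (hN : 1 ≤ N) {Z : Fin N → DataSpace d} {R : ℝ} (hR : 0 < R)
    (hZ : (empiricalMeasure Z).support ⊆ Metric.ball 0 R) (θ : Control T m) :
    empiricalCost T F ℓ lam Z θ = meanFieldCost T F ℓ lam (empiricalMeasure Z) θ := by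
  have := isProbabilityMeasure_empiricalMeasure hN Z
  rw [empiricalCost, meanFieldCost, terminalLoss_eq hT hF hℓ θ hR
    (ae_mem_closedBall_of_support_subset (hZ.trans Metric.ball_subset_closedBall)),
    integral_empiricalMeasure]

end Empirical

/-! ### Lipschitz stability of the terminal loss. -/

section Stability

variable {d m : ℕ} {T : ℝ} {F : ℝ → Vec d → Vec m → Vec d}

/-- Finiteness ensures that `toReal` does not replace an infinite distance by 0 in the estimates. -/
lemma measure_wasserstein_ne_top {μ ν : Measure (DataSpace d)} [IsProbabilityMeasure μ]
    [IsProbabilityMeasure ν] {R : ℝ} (hμ : ∀ᵐ z ∂μ, z ∈ Metric.closedBall 0 R)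
    (hν : ∀ᵐ z ∂ν, z ∈ Metric.closedBall 0 R) : wasserstein μ ν ≠ ⊤ := by
  refine wasserstein_ne_top (D := (2 * R).toNNReal) (fun x hx y hy => ?_) hμ hν
  rw [edist_dist]
  refine ENNReal.ofReal_le_ofReal ((dist_triangle_right x y 0).trans ?_)
  rw [Metric.mem_closedBall] at hx hy
  linarith

/-- On bounded sets of controls, the terminal loss is Lipschitz in the initial datum, with respect
to the Wasserstein distance, and in the control. -/
lemma exists_lipschitz_terminalLoss (hT : 0 < T) (hF : VelocityAssumptions T F)
    {ℓ : Vec d → Vec d → ℝ} (hℓ : ContDiff ℝ 1 fun p : Vec d × Vec d => ℓ p.1 p.2)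
    {R : ℝ} (hR : 0 < R) (B : ℝ) (hB : 0 ≤ B) :
    ∃ K : ℝ, 0 < K ∧
      (∀ θ : Control T m, ‖θ‖ ≤ B → ∀ μ ν : Measure (DataSpace d), IsProbabilityMeasure μ →
        IsProbabilityMeasure ν → (∀ᵐ z ∂μ, z ∈ Metric.closedBall 0 R) →
        (∀ᵐ z ∂ν, z ∈ Metric.closedBall 0 R) →
        |terminalLoss T F ℓ μ θ - terminalLoss T F ℓ ν θ| ≤ K * (wasserstein μ ν).toReal) ∧
      ∀ θ₁ θ₂ : Control T m, ‖θ₁‖ ≤ B → ‖θ₂‖ ≤ B → ∀ μ : Measure (DataSpace d),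
        IsProbabilityMeasure μ → (∀ᵐ z ∂μ, z ∈ Metric.closedBall 0 R) →
        |terminalLoss T F ℓ μ θ₁ - terminalLoss T F ℓ μ θ₂| ≤ K * ‖θ₁ - θ₂‖ := by
  obtain ⟨M, C, hM, hC, hbound, hlip⟩ := exists_lipschitz_flow (m := m) hT hF hR B hB
  obtain ⟨Λ, hΛ⟩ := (hℓ.locallyLipschitz.locallyLipschitzOn
    (s := Metric.closedBall (0 : Vec d × Vec d) (max M R))).exists_lipschitzOnWith_of_compact
      (isCompact_closedBall _ _)
  have hfst : ∀ z ∈ Metric.closedBall (0 : DataSpace d) R, z.fst ∈ Metric.closedBall 0 R :=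
    fun z hz => by
      rw [mem_closedBall_zero_iff] at hz ⊢
      exact (norm_data_fst_le z).trans hz
  have hmem : ∀ θ : Control T m, ‖θ‖ ≤ B → ∀ z ∈ Metric.closedBall (0 : DataSpace d) R,
      (flow T F θ T z.fst, z.snd) ∈ Metric.closedBall (0 : Vec d × Vec d) (max M R) :=
    fun θ hθ z hz => by
      have h := hbound θ hθ _ (hfst z hz)
      rw [mem_closedBall_zero_iff] at hz ⊢
      exact max_le_max h ((norm_data_snd_le z).trans hz)
  have hloss : ∀ θ₁ θ₂ : Control T m, ‖θ₁‖ ≤ B → ‖θ₂‖ ≤ B →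
      ∀ z ∈ Metric.closedBall (0 : DataSpace d) R, ∀ w ∈ Metric.closedBall (0 : DataSpace d) R,
      |ℓ (flow T F θ₁ T z.fst) z.snd - ℓ (flow T F θ₂ T w.fst) w.snd|
        ≤ Λ * (C + 1) * (‖z - w‖ + ‖θ₁ - θ₂‖) := fun θ₁ θ₂ h₁ h₂ z hz w hw => by
    have h := hΛ.dist_le_mul _ (hmem θ₁ h₁ z hz) _ (hmem θ₂ h₂ w hw)
    rw [Real.dist_eq] at h
    refine h.trans ?_
    rw [mul_assoc]
    refine mul_le_mul_of_nonneg_left ?_ Λ.coe_nonneg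
    have hf := hlip θ₁ θ₂ h₁ h₂ _ (hfst z hz) _ (hfst w hw)
    have h3 : ‖z.fst - w.fst‖ ≤ ‖z - w‖ := norm_data_fst_le (z - w)
    have h4 : ‖z.snd - w.snd‖ ≤ ‖z - w‖ := norm_data_snd_le (z - w)
    have h5 := mul_le_mul_of_nonneg_left h3 hC.le
    have h6 := norm_nonneg (θ₁ - θ₂)
    have h7 := norm_nonneg (z - w)
    have h8 := mul_nonneg hC.le h7
    have h9 := mul_nonneg hC.le h6
    rw [Prod.dist_eq, dist_eq_norm, dist_eq_norm]
    exact max_le (by linarith) (by linarith)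
  have hlipschitz : ∀ θ : Control T m, ‖θ‖ ≤ B →
      LipschitzOnWith (Λ * (C + 1).toNNReal) (fun z : DataSpace d => ℓ (flow T F θ T z.fst) z.snd)
        (Metric.closedBall 0 R) := fun θ hθ =>
    LipschitzOnWith.of_dist_le_mul fun z hz w hw => by
      have := hloss θ θ hθ hθ z hz w hw
      rw [sub_self, norm_zero, add_zero] at this
      rw [Real.dist_eq, dist_eq_norm, NNReal.coe_mul, Real.coe_toNNReal _ (by positivity)]
      exact this
  have hint : ∀ θ : Control T m, ‖θ‖ ≤ B → ∀ μ : Measure (DataSpace d), IsProbabilityMeasure μ →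
      (∀ᵐ z ∂μ, z ∈ Metric.closedBall 0 R) →
      Integrable (fun z : DataSpace d => ℓ (flow T F θ T z.fst) z.snd) μ := fun θ hθ μ _ hμ => by
    have h := (hlipschitz θ hθ).continuousOn.integrableOn_compact (μ := μ)
      (isCompact_closedBall _ _)
    rwa [IntegrableOn, Measure.restrict_eq_self_of_ae_mem hμ] at h
  have hΛC : (0 : ℝ) ≤ Λ * (C + 1) := by positivity
  -- In `C + 1`, the `C` accounts for the flow and the 1 for the label; the last summand only makes
  -- the constant strictly positive.
  refine ⟨Λ * (C + 1) + 1, by positivity, fun θ hθ μ ν _ _ hμ hν => ?_,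
    fun θ₁ θ₂ h₁ h₂ μ _ hμ => ?_⟩
  · rw [terminalLoss_eq hT hF hℓ θ hR hμ, terminalLoss_eq hT hF hℓ θ hR hν]
    refine (abs_integral_sub_le_mul_wasserstein (hlipschitz θ hθ) hμ hν (hint θ hθ μ ‹_› hμ)
      (hint θ hθ ν ‹_› hν) (measure_wasserstein_ne_top hμ hν)).trans ?_
    refine mul_le_mul_of_nonneg_right ?_ ENNReal.toReal_nonneg
    rw [NNReal.coe_mul, Real.coe_toNNReal _ (by positivity)]
    linarith
  · rw [terminalLoss_eq hT hF hℓ θ₁ hR hμ, terminalLoss_eq hT hF hℓ θ₂ hR hμ,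
      ← integral_sub (hint θ₁ h₁ μ ‹_› hμ) (hint θ₂ h₂ μ ‹_› hμ), ← Real.norm_eq_abs]
    refine (norm_integral_le_of_norm_le_const (C := Λ * (C + 1) * ‖θ₁ - θ₂‖) ?_).trans ?_
    · filter_upwards [hμ] with z hz
      have := hloss θ₁ θ₂ h₁ h₂ z hz z hz
      rwa [sub_self, norm_zero, zero_add] at this
    · rw [probReal_univ, mul_one]
      exact mul_le_mul_of_nonneg_right (by linarith) (norm_nonneg _)

end Stability

/-! ### Convexity and the main estimate. -/

/-- A strongly convex function grows quadratically away from its minimum. -/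
lemma _root_.StrongConvexOn.sq_norm_sub_le {E : Type*} [NormedAddCommGroup E] [NormedSpace ℝ E]
    {s : Set E} {f : E → ℝ} {η : ℝ} (hf : StrongConvexOn s η f) {x y : E} (hx : x ∈ s)
    (hy : y ∈ s) (hmin : IsMinOn f s x) : η / 4 * ‖x - y‖ ^ 2 ≤ f y - f x := by
  obtain ⟨hs, hf⟩ := hf
  -- The midpoint gains η/8 ‖x - y‖², and its value is at least that at the minimizer; doubling
  -- gives the factor η/4.
  have h := hf hx hy (a := 1 / 2) (b := 1 / 2) (by norm_num) (by norm_num) (by norm_num)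
  have h2 := hmin (hs hx hy (a := 1 / 2) (b := 1 / 2) (by norm_num) (by norm_num)
    (by norm_num))
  simp only [mem_ofPred_eq, smul_eq_mul] at h h2
  linarith

/-- A limit of convex functions is convex. -/
lemma _root_.ConvexOn.of_tendsto {E : Type*} [AddCommGroup E] [Module ℝ E] {s : Set E}
    {f : ℕ → E → ℝ} {g : E → ℝ} (hf : ∀ᶠ n in atTop, ConvexOn ℝ s (f n))
    (hg : ∀ x ∈ s, Tendsto (fun n => f n x) atTop (𝓝 (g x))) : ConvexOn ℝ s g := by
  obtain ⟨n, hn⟩ := hf.exists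
  refine ⟨hn.1, fun x hx y hy a b ha hb hab => ?_⟩
  refine le_of_tendsto_of_tendsto (hg _ (hn.1 hx hy ha hb hab))
    (((hg x hx).const_smul a).add ((hg y hy).const_smul b)) ?_
  filter_upwards [hf] with k hk using hk.2 hx hy ha hb hab

end NeurODE

end

theorem mainTheorem1 (d m : ℕ) (T : ℝ) (hT : 0 < T)
    (F : ℝ → NeurODE.Vec d → NeurODE.Vec m → NeurODE.Vec d)
    (hF : NeurODE.VelocityAssumptions T F)
    (ℓ : NeurODE.Vec d → NeurODE.Vec d → ℝ) (hℓ : NeurODE.LossAssumptions ℓ)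
    (lam : ℝ) (hlam : 0 < lam)
    (R : ℝ) (hR : 0 < R)
    (μ₀ : Measure (NeurODE.DataSpace d)) [IsProbabilityMeasure μ₀]
    (hμ₀_supp : μ₀.support ⊆ Metric.ball 0 R)
    (Z : (N : ℕ) → Fin N → NeurODE.DataSpace d)
    (hZ_supp : ∀ N : ℕ, 1 ≤ N → (NeurODE.empiricalMeasure (Z N)).support ⊆ Metric.ball 0 R)
    (hW : Tendsto (fun N => NeurODE.wasserstein (NeurODE.empiricalMeasure (Z N)) μ₀)
      atTop (𝓝 0))
    (θstar : NeurODE.Control T m)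
    (hθstar : IsLocalMin (NeurODE.meanFieldCost T F ℓ lam μ₀) θstar)
    (ρ : ℝ) (hρ : 0 < ρ) :
    ∃ C : ℝ, 0 < C ∧
      ∀ (η : ℝ) (Nbar : ℕ) (θN : ℕ → NeurODE.Control T m), 0 < η → 1 ≤ Nbar →
        (∀ N : ℕ, 1 ≤ N → IsLocalMin (NeurODE.empiricalCost T F ℓ lam (Z N)) (θN N)) →
        (∀ N : ℕ, Nbar ≤ N → θN N ∈ Metric.ball θstar ρ ∧
          StrongConvexOn (Metric.ball θstar ρ) η (NeurODE.empiricalCost T F ℓ lam (Z N))) →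
        ∀ N : ℕ, Nbar ≤ N →
          |NeurODE.terminalLoss T F ℓ (NeurODE.empiricalMeasure (Z N)) (θN N)
              - NeurODE.terminalLoss T F ℓ μ₀ θstar|
            ≤ C * ((NeurODE.wasserstein (NeurODE.empiricalMeasure (Z N)) μ₀).toReal
                + 1 / √η *
                  √((NeurODE.wasserstein (NeurODE.empiricalMeasure (Z N)) μ₀).toReal)) := by
  open NeurODE in
  obtain ⟨K, hK, hKμ, hKθ⟩ := exists_lipschitz_terminalLoss (m := m) hT hF hℓ.contDiff hR
    (‖θstar‖ + ρ) (by positivity)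
  have hμ₀ := ae_mem_closedBall_of_support_subset (hμ₀_supp.trans Metric.ball_subset_closedBall)
  have hball : ∀ θ ∈ Metric.ball θstar ρ, ‖θ‖ ≤ ‖θstar‖ + ρ := fun θ hθ => by
    rw [mem_ball_iff_norm] at hθ
    linarith [norm_le_norm_add_norm_sub' θ θstar]
  have hcost : ∀ N, 1 ≤ N → ∀ θ ∈ Metric.ball θstar ρ,
      |empiricalCost T F ℓ lam (Z N) θ - meanFieldCost T F ℓ lam μ₀ θ|
        ≤ K * (wasserstein (empiricalMeasure (Z N)) μ₀).toReal := fun N hN θ hθ => by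
    rw [empiricalCost_eq_meanFieldCost hT hF hℓ.contDiff lam hN hR (hZ_supp N hN), meanFieldCost,
      meanFieldCost, add_sub_add_right_eq_sub]
    exact hKμ θ (hball θ hθ) _ _ (isProbabilityMeasure_empiricalMeasure hN (Z N)) inferInstance
      (ae_mem_closedBall_of_support_subset ((hZ_supp N hN).trans Metric.ball_subset_closedBall)) hμ₀
  have hstar : θstar ∈ Metric.ball θstar ρ := Metric.mem_ball_self hρ
  have hlim : ∀ θ ∈ Metric.ball θstar ρ, Tendsto (fun N => empiricalCost T F ℓ lam (Z N) θ) atTop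
      (𝓝 (meanFieldCost T F ℓ lam μ₀ θ)) := fun θ hθ => by
    rw [tendsto_iff_dist_tendsto_zero]
    have hW' := ((ENNReal.tendsto_toReal ENNReal.zero_ne_top).comp hW).const_mul K
    rw [ENNReal.toReal_zero, mul_zero] at hW'
    refine squeeze_zero' (Eventually.of_forall fun _ => dist_nonneg) ?_ hW'
    filter_upwards [eventually_ge_atTop 1] with N hN
    rw [Real.dist_eq]
    exact hcost N hN θ hθ
  -- `K` pays for changing the datum and `K * √(8 * K)` for changing the control. `K` was fixed for
  -- all controls of norm at most `‖θstar‖ + ρ`, hence before `η`, `Nbar` and the minimizers.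
  refine ⟨K + K * √(8 * K), by positivity, fun η Nbar θN hη hNbar hmin hθN N hN => ?_⟩
  have hconv : ∀ k, Nbar ≤ k →
      ConvexOn ℝ (Metric.ball θstar ρ) (empiricalCost T F ℓ lam (Z k)) := fun k hk =>
    (hθN k hk).2.convexOn fun r => by positivity
  -- Convexity of the limit is what upgrades the local minimality of `θstar` to minimality on the
  -- whole ball, so that it can be tested against `θN N`.
  have hJ : ConvexOn ℝ (Metric.ball θstar ρ) (meanFieldCost T F ℓ lam μ₀) :=
    ConvexOn.of_tendsto ((eventually_ge_atTop Nbar).mono hconv) hlim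
  have hJmin := IsMinOn.of_isLocalMinOn_of_convexOn hstar (hθstar.on _) hJ
  have hN1 : 1 ≤ N := hNbar.trans hN
  obtain ⟨hθ, hsc⟩ := hθN N hN
  have hJNmin := IsMinOn.of_isLocalMinOn_of_convexOn hθ ((hmin N hN1).on _) (hconv N hN)
  set W := (wasserstein (empiricalMeasure (Z N)) μ₀).toReal with hWdef
  have hW0 : 0 ≤ W := ENNReal.toReal_nonneg
  -- J^N(θ*) - J^N(θ^N) exceeds J(θ*) - J(θ^N) ≤ 0 by at most one discrepancy `K * W` at each of the
  -- two controls.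
  have hquad : η / 4 * ‖θN N - θstar‖ ^ 2 ≤ 2 * K * W := by
    have h1 := hsc.sq_norm_sub_le hθ hstar hJNmin
    have h2 := (abs_le.1 (hcost N hN1 _ hstar)).2
    have h3 := (abs_le.1 (hcost N hN1 _ hθ)).1
    have h4 : meanFieldCost T F ℓ lam μ₀ θstar ≤ meanFieldCost T F ℓ lam μ₀ (θN N) := hJmin hθ
    linarith
  have hdist : ‖θN N - θstar‖ ≤ √(8 * K) * (1 / √η * √W) := by
    refine abs_le_of_sq_le_sq' ?_ (by positivity) |>.2
    rw [mul_pow, mul_pow, div_pow, Real.sq_sqrt (by positivity), Real.sq_sqrt hη.le,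
      Real.sq_sqrt hW0, one_pow]
    have : 8 * K * (1 / η * W) = 8 * K * W / η := by ring
    rw [this, le_div_iff₀ hη]
    linarith
  have h1 := hKμ _ (hball _ hθ) _ μ₀ (isProbabilityMeasure_empiricalMeasure hN1 (Z N))
    inferInstance (ae_mem_closedBall_of_support_subset
      ((hZ_supp N hN1).trans Metric.ball_subset_closedBall)) hμ₀
  have h2 := hKθ _ _ (hball _ hθ) (hball _ hstar) μ₀ inferInstance hμ₀
  have h3 := mul_le_mul_of_nonneg_left hdist hK.le
  have h4 : 0 ≤ K * (1 / √η * √W) := by positivity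
  have h5 : 0 ≤ K * √(8 * K) * W := by positivity
  calc _ ≤ K * W + K * ‖θN N - θstar‖ := (abs_sub_le _ _ _).trans (add_le_add h1 h2)
    _ ≤ _ := by linarith
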